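/- Consider an M/G/1 queue with vacations. Customers arrive according to a Poisson process of rate $\lambda>0$, and service times are i.i.d., distributed as $B\ge 0$ with $E[B^2]<\infty$, independent of the arrivals and the vacations; put $\rho=\lambda E[B]$. Immediately after a service completion that leaves $i$ customers behind, the server takes a vacation with probability $\psi(i)$, where $\psi:[0,\infty)\to[0,1]$ and $\psi(0)=1$; otherwise it starts the next service. The (finite) length of a vacation may depend on the number $i$ of customers at its beginning, on independent randomness, and on the arrivals during the vacation, but not on future arrivals; after the vacation the server serves a customer. Let $X_i$ be the number of arrivals during a vacation that begins with $i$ customers; assume $P(X_0=0)=0$ and $E[X_i^2]<\infty$ for all $i$. Assume the stability condition $\limsup_{i\to\infty}\psi(i)E[X_i]<1-\rho$. Suppose that vacations are equally distributed: there is a random variable $X$ with $P(X=0)<1$ such that $X_i\overset{d}{=}X$ for all $i\ge1$, and either $X_0\overset{d}{=}X$ and $P(X=0)=0$, or $X_0$ is stochastically strictly larger than $X$ (that is, $P(X_0\le w)\le P(X\le w)$ for all $w$, with strict inequality for some $w$) and $P(X=0)>0$. Let $L(t)$ be the number of customers in the system at time $t$, the system being started at time $0$ just after a service completion that leaves an arbitrary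 number $k\ge 0$ of customers behind, and let $L$ be a random variable with the steady-state distribution, $P(L=j)=\lim_{T\to\infty}\frac1T\int_0^T P(L(t)=j)\,dt$ for all $j\ge0$ (this is $\lim_{t\to\infty}P(L(t)=j)$ whenever the latter limit exists). **Theorem.** If $\psi$ is strictly decreasing and convex on $[0,\infty)$, then $$E[L]\ \ge\ \max\Big\{\psi^{-1}\Big(\frac{1-\rho}{E[X]}\Big),\ \frac{\lambda^2E[B^2]}{2(1-\rho)}+\rho\Big\},$$ where $\psi^{-1}(y)=\inf\{x\ge0:\psi(x)\le y\}$, which is the usual inverse function at every $y$ in the range of $\psi$ and is $0$ for $y\ge1$. -/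

import Mathlib

open MeasureTheory ProbabilityTheory Filter Topology Set
open scoped ENNReal

noncomputable section

/-- A possible sequence of arrival epochs, measured from the current instant. -/
def IsArrivalPath (a : ℕ → ℝ) : Prop :=
  0 < a 0 ∧ StrictMono a ∧ Tendsto a atTop atTop

/-- The primitive data of an M/G/1 queue with vacations. The random seed in `E` stands for all the
randomness of a vacation that does not come from the arrivals. -/
structure VacationQueue (E : Type*) [MeasurableSpace E] where
  /-- the arrival rate `λ` -/
  lam : ℝ
  lam_pos : 0 < lam
  /-- the law of a service time `B` -/
  service : Measure ℝ
  service_prob : IsProbabilityMeasure service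
  service_nonneg : ∀ᵐ b ∂service, 0 ≤ b
  service_sq : Integrable (fun b : ℝ => b ^ 2) service
  /-- `psi i` is the probability that the server becomes inactive after a service completion
  that leaves `i` customers behind -/
  psi : ℝ → ℝ
  psi_mem : ∀ x, 0 ≤ x → psi x ∈ Icc (0 : ℝ) 1
  psi_zero : psi 0 = 1
  /-- the law of the seed of a vacation -/
  seed : Measure E
  seed_prob : IsProbabilityMeasure seed
  /-- `vac i e a` is the length of a vacation that begins with `i` customers in the system, when
  its seed is `e` and the subsequent arrivals occur at the epochs `a 0 < a 1 < …` after its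
  beginning -/
  vac : ℕ → E → (ℕ → ℝ) → ℝ≥0∞
  vac_measurable : ∀ i, Measurable fun x : E × (ℕ → ℝ) => vac i x.1 x.2
  /-- The end of a vacation does not depend on future arrivals: two arrival paths with the same
  arrivals up to and including the end of the vacation under the first one lead to the same
  vacation length. -/
  vac_nonanticipating : ∀ i e a a', IsArrivalPath a → IsArrivalPath a' →
    (∀ k, ENNReal.ofReal (a k) ≤ vac i e a ∨ ENNReal.ofReal (a' k) ≤ vac i e a → a' k = a k) →
      vac i e a' = vac i e a

attribute [instance] VacationQueue.service_prob VacationQueue.seed_prob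

/-- The arrival epochs when the interarrival times are `g 0, g 1, …`. -/
def arrivalEpoch (g : ℕ → ℝ) (k : ℕ) : ℝ := ∑ l ∈ Finset.range (k + 1), g l

/-- The number of arrivals in `(0, t]`. -/
def arrivalCount (g : ℕ → ℝ) (t : ℝ) : ℕ := {k : ℕ | arrivalEpoch g k ≤ t}.ncard

/-- `W₁` is stochastically larger than `W₂`, in terms of their probability mass functions. -/
def StochGE (w₁ w₂ : ℕ → ℝ≥0∞) : Prop :=
  ∀ n, ∑ m ∈ Finset.range (n + 1), w₁ m ≤ ∑ m ∈ Finset.range (n + 1), w₂ m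

/-- `W₁` is stochastically strictly larger than `W₂`. -/
def StochGT (w₁ w₂ : ℕ → ℝ≥0∞) : Prop :=
  StochGE w₁ w₂ ∧ ∃ n, ∑ m ∈ Finset.range (n + 1), w₁ m < ∑ m ∈ Finset.range (n + 1), w₂ m

namespace VacationQueue

variable {E : Type*} [MeasurableSpace E] (M : VacationQueue E)

/-- The law of the interarrival times of a Poisson process of rate `λ`: independent and
exponentially distributed. -/
def gapLaw : Measure (ℕ → ℝ) := Measure.infinitePi fun _ => expMeasure M.lam

/-- The mean service time. -/
def meanB : ℝ := ∫ b, b ∂M.service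

/-- The second moment of the service time. -/
def meanB2 : ℝ := ∫ b, b ^ 2 ∂M.service

/-- The traffic intensity. -/
def rho : ℝ := M.lam * M.meanB

/-- `vacArrivals i (g, e)` is the number `X_i` of arrivals during a vacation that begins with `i`
customers, with interarrival times `g` after its beginning and seed `e`. -/
def vacArrivals (i : ℕ) (x : (ℕ → ℝ) × E) : ℕ :=
  {k : ℕ | ENNReal.ofReal (arrivalEpoch x.1 k) ≤ M.vac i x.2 (arrivalEpoch x.1)}.ncard

/-- `alpha i m` is the probability that exactly `m` customers arrive during a vacation that begins
with `i` customers in the system. -/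
def alpha (i m : ℕ) : ℝ≥0∞ := (M.gapLaw.prod M.seed) {x | M.vacArrivals i x = m}

/-- The mean of `X_i`. -/
def meanX (i : ℕ) : ℝ≥0∞ := ∑' m : ℕ, (m : ℝ≥0∞) * M.alpha i m

/-- The standing assumptions on vacations: they end, the server does not activate in an empty
system, and the number of arrivals during a vacation has a finite second moment. -/
structure Admissible : Prop where
  vac_finite : ∀ i, ∀ᵐ x ∂(M.gapLaw.prod M.seed), M.vac i x.2 (arrivalEpoch x.1) < ∞
  alpha_zero_zero : M.alpha 0 0 = 0
  second_moment : ∀ i, ∑' m : ℕ, (m : ℝ≥0∞) ^ 2 * M.alpha i m < ∞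

/-- The stability condition `limsup_{i → ∞} ψ(i) E[X_i] < 1 - ρ`. -/
def Stable : Prop :=
  limsup (fun i : ℕ => ENNReal.ofReal (M.psi i) * M.meanX i) atTop < ENNReal.ofReal (1 - M.rho)

/-- The scenario of equal vacation distributions, `q` being the law of `X`: `X_i` has law `q` for
all `i ≥ 1`, `X` is stochastically strictly larger than `0`, and either `X_0` has law `q` too and
`P(X = 0) = 0`, or `X_0` is stochastically strictly larger than `X` and `P(X = 0) > 0`. -/
structure EqualVacations (q : PMF ℕ) : Prop where
  eq_law : ∀ i, 1 ≤ i → ∀ m, M.alpha i m = q m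
  nontrivial : StochGT q (PMF.pure 0)
  empty_law : ((∀ m, M.alpha 0 m = q m) ∧ q 0 = 0) ∨ (StochGT (M.alpha 0) q ∧ 0 < q 0)

/-- The independent inputs of the queue. The first component of a sample point holds the
interarrival times; the `n`-th entry of the second one is a triple: a uniform variable that decides
whether the server becomes inactive after the `n`-th service completion, the service time of the
next service, and the seed of the vacation (if any) in between. -/
def inputLaw : Measure ((ℕ → ℝ) × (ℕ → ℝ × ℝ × E)) :=
  M.gapLaw.prod (Measure.infinitePi fun _ =>
    (volume.restrict (Icc (0 : ℝ) 1)).prod (M.service.prod M.seed))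

/-- The epoch of the `n`-th service completion and the number of customers just after it. The
process is started at time `0` just after a service completion that leaves `k` customers behind.
From a completion at epoch `d` that leaves `i` customers, the server takes a vacation with
probability `ψ(i)`, and then serves one customer. -/
def completion (k : ℕ) (ω : (ℕ → ℝ) × (ℕ → ℝ × ℝ × E)) : ℕ → ℝ × ℕ
  | 0 => (0, k)
  | n + 1 =>
    let d := (completion k ω n).1
    let i := (completion k ω n).2
    let future : ℕ → ℝ := fun l => arrivalEpoch ω.1 (arrivalCount ω.1 d + l) - d
    let v := if (ω.2 n).1 < M.psi i then (M.vac i (ω.2 n).2.2 future).toReal else 0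
    let d' := d + v + (ω.2 n).2.1
    (d', i + (arrivalCount ω.1 d' - arrivalCount ω.1 d) - 1)

/-- `L(t)`: the number of customers in the system at time `t`, i.e. the initial number, plus the
arrivals, minus the service completions in `(0, t]` (completion number `0` is the initial epoch). -/
def customers (k : ℕ) (t : ℝ) (ω : (ℕ → ℝ) × (ℕ → ℝ × ℝ × E)) : ℕ :=
  k + arrivalCount ω.1 t - {n : ℕ | (M.completion k ω (n + 1)).1 ≤ t}.ncard

/-- `p` is the steady-state law of the number of customers, starting from `k` customers:
`p j` is the long-run average of `P(L(t) = j)`. It is the limit of `P(L(t) = j)` as `t → ∞`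
whenever the latter exists, see `isSteadyState_of_tendsto`; the average is needed only because
the latter oscillates when, e.g., all service and vacation times are multiples of a constant. -/
def IsSteadyState (k : ℕ) (p : PMF ℕ) : Prop :=
  ∀ j, Tendsto (fun T : ℝ =>
    (∫⁻ t in Ioc (0 : ℝ) T, M.inputLaw {ω | M.customers k t ω = j}) / ENNReal.ofReal T)
    atTop (𝓝 (p j))

theorem gapLaw_prob : IsProbabilityMeasure M.gapLaw := by
  have : IsProbabilityMeasure (expMeasure M.lam) := isProbabilityMeasure_expMeasure M.lam_pos
  unfold gapLaw
  infer_instance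

theorem inputLaw_prob : IsProbabilityMeasure M.inputLaw := by
  have := M.gapLaw_prob
  have : IsProbabilityMeasure (volume.restrict (Icc (0 : ℝ) 1)) := ⟨by simp⟩
  unfold inputLaw
  infer_instance

/-- If `P(L(t) = j)` converges to `p j` as `t → ∞`, for every `j`, then `p` is the steady-state
law. -/
theorem isSteadyState_of_tendsto {k : ℕ} {p : PMF ℕ}
    (h : ∀ j, Tendsto (fun t : ℝ => M.inputLaw {ω | M.customers k t ω = j}) atTop (𝓝 (p j))) :
    M.IsSteadyState k p := by
  have := M.inputLaw_prob
  suffices key : ∀ (f : ℝ → ℝ≥0∞) (c : ℝ≥0∞), (∀ t, f t ≤ 1) → Tendsto f atTop (𝓝 c) →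
      Tendsto (fun T : ℝ => (∫⁻ t in Ioc (0 : ℝ) T, f t) / ENNReal.ofReal T) atTop (𝓝 c) from
    fun j => key _ _ (fun t => prob_le_one) (h j)
  intro f c hf1 hj
  rw [tendsto_order]
  constructor
  · intro a ha
    obtain ⟨b, hab, hbc⟩ := exists_between ha
    obtain ⟨T₀, hT₀⟩ := eventually_atTop.1 (hj.eventually (lt_mem_nhds hbc))
    set S := max T₀ 0 with hS
    have hlim : Tendsto (fun T : ℝ => b * ENNReal.ofReal ((T - S) / T)) atTop (𝓝 b) := by
      have h1 : Tendsto (fun T : ℝ => (T - S) / T) atTop (𝓝 1) := by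
        have h2 : Tendsto (fun T : ℝ => 1 - S / T) atTop (𝓝 (1 - 0)) :=
          tendsto_const_nhds.sub (tendsto_const_nhds.div_atTop tendsto_id)
        rw [sub_zero] at h2
        refine h2.congr' ?_
        filter_upwards [eventually_gt_atTop 0] with T hT
        field_simp
      have h3 := ENNReal.Tendsto.const_mul (a := b) (ENNReal.tendsto_ofReal h1) (Or.inr hbc.ne_top)
      simpa using h3
    filter_upwards [hlim.eventually (lt_mem_nhds hab), eventually_gt_atTop S] with T hT hTS
    have hT0 : 0 < T := (le_max_right T₀ 0).trans_lt hTS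
    refine hT.trans_le ?_
    rw [ENNReal.ofReal_div_of_pos hT0, ← mul_div_assoc]
    gcongr
    calc b * ENNReal.ofReal (T - S) = ∫⁻ _ in Ioc S T, b := by simp
      _ ≤ ∫⁻ t in Ioc S T, f t :=
        setLIntegral_mono' measurableSet_Ioc fun t ht =>
          (hT₀ t ((le_max_left T₀ 0).trans ht.1.le)).le
      _ ≤ ∫⁻ t in Ioc 0 T, f t :=
        lintegral_mono_set (Ioc_subset_Ioc_left (le_max_right T₀ 0))
  · intro a ha
    obtain ⟨b, hcb, hba⟩ := exists_between ha
    obtain ⟨T₀, hT₀⟩ := eventually_atTop.1 (hj.eventually (gt_mem_nhds hcb))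
    set S := max T₀ 0 with hS
    have hlim : Tendsto (fun T : ℝ => ENNReal.ofReal (S / T) + b) atTop (𝓝 b) := by
      have h1 : Tendsto (fun T : ℝ => S / T) atTop (𝓝 0) :=
        tendsto_const_nhds.div_atTop tendsto_id
      have h3 := (ENNReal.tendsto_ofReal h1).add (tendsto_const_nhds (x := b))
      simpa using h3
    filter_upwards [hlim.eventually (gt_mem_nhds hba), eventually_gt_atTop S] with T hT hTS
    have hT0 : 0 < T := (le_max_right T₀ 0).trans_lt hTS
    refine lt_of_le_of_lt ?_ hT
    have hT0' : ENNReal.ofReal T ≠ 0 := by simpa using hT0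
    refine ENNReal.div_le_of_le_mul ?_
    rw [ENNReal.ofReal_div_of_pos hT0, add_mul,
      ENNReal.div_mul_cancel hT0' ENNReal.ofReal_ne_top]
    calc ∫⁻ t in Ioc 0 T, f t = ∫⁻ t in Ioc 0 S ∪ Ioc S T, f t := by
          rw [Ioc_union_Ioc_eq_Ioc (le_max_right T₀ 0) hTS.le]
      _ ≤ (∫⁻ t in Ioc 0 S, f t) + ∫⁻ t in Ioc S T, f t := lintegral_union_le _ _ _
      _ ≤ (∫⁻ _ in Ioc 0 S, 1) + ∫⁻ _ in Ioc S T, b := by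
          refine add_le_add (lintegral_mono fun t => hf1 t) ?_
          exact setLIntegral_mono' measurableSet_Ioc fun t ht =>
            (hT₀ t ((le_max_left T₀ 0).trans ht.1.le)).le
      _ ≤ ENNReal.ofReal S + b * ENNReal.ofReal T := by
          simp only [lintegral_const, MeasurableSet.univ, Measure.restrict_apply, univ_inter,
            Real.volume_Ioc, one_mul, sub_zero]
          gcongr
          exact sub_le_self _ (le_max_right T₀ 0)

end VacationQueue

/-- The inverse of a decreasing function on `[0, ∞)`: `ψ⁻¹(y) = inf {x ≥ 0 : ψ(x) ≤ y}`. -/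
def decrInv (psi : ℝ → ℝ) (y : ℝ) : ℝ := sInf {x | 0 ≤ x ∧ psi x ≤ y}

/-- On the range of a strictly decreasing function, `decrInv` is its inverse function. -/
theorem decrInv_apply {psi : ℝ → ℝ} (h : StrictAntiOn psi (Ici 0)) {x : ℝ} (hx : 0 ≤ x) :
    decrInv psi (psi x) = x := by
  have : {z | 0 ≤ z ∧ psi z ≤ psi x} = Ici x := by
    ext z
    constructor
    · rintro ⟨hz, hzx⟩
      exact (h.le_iff_ge (mem_Ici.2 hz) (mem_Ici.2 hx)).1 hzx
    · intro hz
      have hz0 : 0 ≤ z := hx.trans hz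
      exact ⟨hz0, (h.le_iff_ge (mem_Ici.2 hz0) (mem_Ici.2 hx)).2 hz⟩
  rw [decrInv, this, csInf_Ici]

end

/-! Observe the queue just after service completions. This gives a Markov chain on the natural
numbers with step `I ↦ I + N - 1`, where `N` counts the arrivals in one cycle (a possible vacation
followed by one service).

The time-average law `p` is stationary for this chain. Poisson arrivals see time averages
(`lintegral_sum_arrivals`), so λ times the expected time spent in state `j` is the expected number
of arrivals that find `j` customers. A path that goes down by single steps and serves one customer
per cycle has, up to a bounded error, as many such arrivals as completions that leave `j` behind
(`arrivals_visits`). The queue restarts at completions (`lintegral_completionEvent`, from the strong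
Markov property of the Poisson process), so the expected visit counts satisfy the balance equations
up to a bounded error. Division by `T` removes all errors (`IsSteadyState.stationary`).

If E[L] is infinite there is nothing to prove. Otherwise let `I` have law `p`, and put S = E[ψ(I)
m(I)] and S₂ = E[ψ(I) m₂(I)], where m(i), m₂(i) are the first two moments of X_i. A cycle from `i`
has on average ψ(i) m(i) + ρ arrivals, so zero drift of `I` gives S = 1 - ρ. Zero drift of I² reads
2(1-ρ) E[L] = 2 E[I ψ(I) m(I)] + S₂ + 2ρS + ρ + λ²E[B²] - 1. On the right the first term is
nonnegative, and S₂ ≥ S because a natural number is at most its square; this is the second bound.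
For the first bound, Jensen's inequality and m(i) ≥ E[X] give ψ(E[L]) E[X] ≤ E[ψ(I)] E[X] ≤ S = 1 -
ρ.

The quadratic drift identity must not assume E[I²] < ∞, hence the truncation argument in
`integral_sq_increment_of_stationary`. -/

/-! ### Sequences of independent variables -/

/-- The sequence that agrees with `g` up to index `m` and continues with `y`. -/
def splice {α : Type*} (m : ℕ) (g y : ℕ → α) : ℕ → α :=
  fun l => if l < m then g l else y (l - m)

theorem measurable_splice {α : Type*} [MeasurableSpace α] (m : ℕ) :
    Measurable fun x : (ℕ → α) × (ℕ → α) => splice m x.1 x.2 := by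
  refine measurable_pi_iff.2 fun l => ?_
  unfold splice
  split_ifs <;> fun_prop

/-- A cylinder pulls back to a product of two cylinders: its coordinates below `m` constrain the
first sequence, the remaining ones, shifted by `m`, the second. -/
theorem map_splice_infinitePi {α : Type*} [MeasurableSpace α] (μ : Measure α)
    [IsProbabilityMeasure μ] (m : ℕ) :
    ((Measure.infinitePi fun _ : ℕ => μ).prod (Measure.infinitePi fun _ : ℕ => μ)).map
      (fun x => splice m x.1 x.2) = Measure.infinitePi fun _ : ℕ => μ := by
  classical
  refine Measure.eq_infinitePi _ fun s t ht => ?_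
  rw [Measure.map_apply (measurable_splice m)
    (MeasurableSet.pi s.countable_toSet fun i _ => ht i)]
  have hset : (fun x : (ℕ → α) × (ℕ → α) => splice m x.1 x.2) ⁻¹' (Set.pi s t) =
      (Set.pi ((s.filter (· < m) : Finset ℕ) : Set ℕ) t) ×ˢ
      (Set.pi (((s.filter (fun l => ¬ l < m)).image (· - m) : Finset ℕ) : Set ℕ)
        (fun l => t (l + m))) := by
    ext x
    simp only [mem_preimage, Set.mem_pi, mem_prod, Finset.coe_filter, Finset.coe_image,
      mem_image, mem_ofPred_eq, Finset.mem_coe, splice]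
    constructor
    · intro h
      refine ⟨fun i hi => by simpa [hi.2] using h i hi.1, ?_⟩
      rintro _ ⟨i, hi, rfl⟩
      have := h i hi.1
      rw [if_neg hi.2] at this
      rwa [Nat.sub_add_cancel (not_lt.1 hi.2)]
    · rintro ⟨h1, h2⟩ i hi
      split_ifs with him
      · exact h1 i ⟨hi, him⟩
      · have := h2 (i - m) ⟨i, ⟨hi, him⟩, rfl⟩
        rwa [Nat.sub_add_cancel (not_lt.1 him)] at this
  rw [hset, Measure.prod_prod, Measure.infinitePi_pi _ (fun i _ => ht i),
    Measure.infinitePi_pi _ (fun i _ => ht _), Finset.prod_image,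
    ← Finset.prod_filter_mul_prod_filter_not s (· < m)]
  · congr 1
    refine Finset.prod_congr rfl fun i hi => ?_
    rw [Nat.sub_add_cancel (not_lt.1 (Finset.mem_filter.1 hi).2)]
  · intro a ha b hb hab
    simp only [Finset.coe_filter, mem_ofPred_eq] at ha hb
    have hab : a - m = b - m := hab
    omega

/-- Conditioning on the first `m` entries: the outer variable carries them, the inner one supplies a
fresh remainder. -/
theorem lintegral_splice {α : Type*} [MeasurableSpace α] (μ : Measure α)
    [IsProbabilityMeasure μ] (m : ℕ) {F : (ℕ → α) → ℝ≥0∞} (hF : Measurable F) :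
    ∫⁻ g, F g ∂(Measure.infinitePi fun _ : ℕ => μ) =
      ∫⁻ g, ∫⁻ y, F (splice m g y) ∂(Measure.infinitePi fun _ : ℕ => μ)
        ∂(Measure.infinitePi fun _ : ℕ => μ) := by
  conv_lhs => rw [← map_splice_infinitePi μ m]
  rw [lintegral_map hF (measurable_splice m),
    lintegral_prod (fun x : (ℕ → α) × (ℕ → α) => F (splice m x.1 x.2))
      (hF.comp (measurable_splice m)).aemeasurable]

theorem lintegral_infinitePi_eval {α : Type*} [MeasurableSpace α] (μ : Measure α)
    [IsProbabilityMeasure μ] (i : ℕ) {F : α → ℝ≥0∞} (hF : Measurable F) :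
    ∫⁻ g, F (g i) ∂(Measure.infinitePi fun _ : ℕ => μ) = ∫⁻ x, F x ∂μ :=
  (measurePreserving_eval_infinitePi (fun _ : ℕ => μ) i).lintegral_comp hF

/-! ### The exponential distribution -/

theorem lintegral_expMeasure {r : ℝ} {F : ℝ → ℝ≥0∞} (hF : Measurable F) :
    ∫⁻ x, F x ∂(expMeasure r) =
      ∫⁻ x in Ioi 0, ENNReal.ofReal (r * Real.exp (-(r * x))) * F x := by
  have hm : Measurable (exponentialPDF r) :=
    (measurable_exponentialPDFReal r).ennreal_ofReal
  have h0 : expMeasure r = volume.withDensity (exponentialPDF r) := rfl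
  rw [h0, lintegral_withDensity_eq_lintegral_mul _ hm hF, Measure.restrict_congr_set Ioi_ae_eq_Ici,
    ← lintegral_indicator measurableSet_Ici]
  refine lintegral_congr fun x => ?_
  simp only [Pi.mul_apply, indicator, mem_Ici]
  split_ifs with hx
  · rw [exponentialPDF_of_nonneg hx]
  · rw [exponentialPDF_of_neg (not_le.1 hx), zero_mul]

/-- Translation by `s` multiplies the exponential density by the constant exp(-rs). -/
theorem lintegral_expMeasure_memoryless {r : ℝ} {s : ℝ} (hs : 0 ≤ s)
    {F : ℝ → ℝ≥0∞} (hF : Measurable F) :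
    ∫⁻ x, (if s < x then F (x - s) else 0) ∂(expMeasure r) =
      ENNReal.ofReal (Real.exp (-(r * s))) * ∫⁻ x, F x ∂(expMeasure r) := by
  have hm : Measurable fun x => if s < x then F (x - s) else 0 :=
    Measurable.ite measurableSet_Ioi (by fun_prop) measurable_const
  rw [lintegral_expMeasure hm, lintegral_expMeasure hF,
    ← lintegral_const_mul _ (by fun_prop), ← lintegral_indicator measurableSet_Ioi,
    ← lintegral_indicator measurableSet_Ioi, ← lintegral_add_right_eq_self _ s]
  refine lintegral_congr fun x => ?_
  simp only [indicator, mem_Ioi, lt_add_iff_pos_left, add_sub_cancel_right]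
  by_cases hx : 0 < x
  · rw [if_pos hx, if_pos (by linarith), if_pos hx, ← mul_assoc,
      ← ENNReal.ofReal_mul (Real.exp_nonneg _)]
    congr 2
    rw [mul_left_comm, ← Real.exp_add]
    ring_nf
  · simp [hx]

theorem expMeasure_Ioi {r : ℝ} (hr : 0 < r) {s : ℝ} (hs : 0 ≤ s) :
    expMeasure r (Ioi s) = ENNReal.ofReal (Real.exp (-(r * s))) := by
  have := isProbabilityMeasure_expMeasure hr
  have h := lintegral_expMeasure_memoryless (r := r) hs (F := fun _ => 1) measurable_const
  rw [lintegral_one, measure_univ, mul_one] at h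
  rw [← h, ← lintegral_indicator_one measurableSet_Ioi]
  rfl

/-! ### Arrival epochs -/

theorem arrivalEpoch_zero (g : ℕ → ℝ) : arrivalEpoch g 0 = g 0 := by simp [arrivalEpoch]

theorem arrivalEpoch_succ (g : ℕ → ℝ) (k : ℕ) :
    arrivalEpoch g (k + 1) = arrivalEpoch g k + g (k + 1) := by
  simp [arrivalEpoch, Finset.sum_range_succ _ (k + 1)]

/-- The gaps `g` are positive and their sum diverges. -/
def GoodGaps (g : ℕ → ℝ) : Prop := (∀ l, 0 < g l) ∧ Tendsto (arrivalEpoch g) atTop atTop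

theorem GoodGaps.isArrivalPath {g : ℕ → ℝ} (h : GoodGaps g) : IsArrivalPath (arrivalEpoch g) :=
  ⟨by rw [arrivalEpoch_zero]; exact h.1 0,
    strictMono_nat_of_lt_succ fun k => by rw [arrivalEpoch_succ]; linarith [h.1 (k + 1)], h.2⟩

theorem GoodGaps.strictMono {g : ℕ → ℝ} (h : GoodGaps g) : StrictMono (arrivalEpoch g) :=
  h.isArrivalPath.2.1

theorem GoodGaps.epoch_pos {g : ℕ → ℝ} (h : GoodGaps g) (k : ℕ) : 0 < arrivalEpoch g k :=
  h.isArrivalPath.1.trans_le (h.strictMono.monotone (Nat.zero_le k))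

@[fun_prop]
theorem measurable_arrivalEpoch (k : ℕ) : Measurable fun g : ℕ → ℝ => arrivalEpoch g k := by
  unfold arrivalEpoch
  fun_prop

@[fun_prop]
theorem measurable_arrivalEpoch_pi : Measurable arrivalEpoch :=
  measurable_pi_iff.2 measurable_arrivalEpoch

theorem arrivalEpoch_splice_add (m : ℕ) (g y : ℕ → ℝ) (r : ℕ) :
    arrivalEpoch (splice m g y) (m + r) = ∑ l ∈ Finset.range m, g l + arrivalEpoch y r := by
  unfold arrivalEpoch
  rw [add_assoc, Finset.sum_range_add]
  congr 1
  · exact Finset.sum_congr rfl fun l hl => by simp [splice, Finset.mem_range.1 hl]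
  · exact Finset.sum_congr rfl fun l _ => by simp [splice]

theorem arrivalEpoch_splice_of_lt {m : ℕ} (g y : ℕ → ℝ) {l : ℕ} (hl : l < m) :
    arrivalEpoch (splice m g y) l = arrivalEpoch g l := by
  unfold arrivalEpoch
  refine Finset.sum_congr rfl fun i hi => ?_
  have : i < m := by have := Finset.mem_range.1 hi; omega
  simp [splice, this]

theorem GoodGaps.splice {m : ℕ} {g y : ℕ → ℝ} (hg : ∀ l, 0 < g l) (hy : GoodGaps y) :
    GoodGaps (splice m g y) := by
  refine ⟨fun l => ?_, ?_⟩
  · unfold _root_.splice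
    split_ifs
    · exact hg _
    · exact hy.1 _
  · rw [← tendsto_add_atTop_iff_nat m]
    simp_rw [add_comm _ m, arrivalEpoch_splice_add]
    exact tendsto_atTop_add_const_left _ _ hy.2

namespace VacationQueue

variable {E : Type*} [MeasurableSpace E] (M : VacationQueue E)

instance : IsProbabilityMeasure (expMeasure M.lam) := isProbabilityMeasure_expMeasure M.lam_pos

instance : IsProbabilityMeasure M.gapLaw := M.gapLaw_prob

theorem ae_goodGaps : ∀ᵐ g ∂M.gapLaw, GoodGaps g := by
  have hpos : ∀ᵐ g ∂M.gapLaw, ∀ l, 0 < g l := by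
    refine ae_all_iff.2 fun l => ?_
    have h1 : ∀ᵐ x ∂(expMeasure M.lam), 0 < x := by
      have h := expMeasure_Ioi M.lam_pos le_rfl
      rw [mul_zero, neg_zero, Real.exp_zero, ENNReal.ofReal_one] at h
      exact (prob_compl_eq_zero_iff measurableSet_Ioi).2 h
    exact (measurePreserving_eval_infinitePi (fun _ : ℕ => expMeasure M.lam) l
      ).quasiMeasurePreserving.ae h1
  have hlt : expMeasure M.lam (Iic 1) < 1 := by
    have h := prob_compl_eq_one_sub (μ := expMeasure M.lam) (measurableSet_Ioi (a := (1 : ℝ)))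
    rw [compl_Ioi, expMeasure_Ioi M.lam_pos zero_le_one] at h
    rw [h]
    refine ENNReal.sub_lt_self ENNReal.one_ne_top one_ne_zero ?_
    simpa using Real.exp_pos _
  -- Infinitely many gaps exceed 1, because `n` consecutive gaps at most 1 have a probability that
  -- is geometric in `n`. If the epochs stayed bounded, the gaps would be summable and tend to zero.
  have hbig : ∀ᵐ g ∂M.gapLaw, ∀ m : ℕ, ∃ l ≥ m, 1 < g l := by
    refine ae_all_iff.2 fun m => ?_
    rw [ae_iff]
    have hsub : ∀ n : ℕ, M.gapLaw {g | ¬ ∃ l ≥ m, 1 < g l} ≤ (expMeasure M.lam (Iic 1)) ^ n := by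
      intro n
      calc M.gapLaw {g | ¬ ∃ l ≥ m, 1 < g l}
          ≤ M.gapLaw (Set.pi (Finset.Ico m (m + n) : Finset ℕ) fun _ => Iic 1) := by
            refine measure_mono fun g hg l hl => ?_
            simp only [not_exists, not_and, not_lt, mem_ofPred_eq] at hg
            exact hg l (Finset.mem_Ico.1 hl).1
        _ = _ := by
            unfold gapLaw
            rw [Measure.infinitePi_pi _ (fun _ _ => measurableSet_Iic)]
            simp
    exact le_antisymm (ge_of_tendsto' (ENNReal.tendsto_pow_atTop_nhds_zero_of_lt_one hlt) hsub)
      zero_le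
  filter_upwards [hpos, hbig] with g h1 h2
  refine ⟨h1, ?_⟩
  have hmono : Monotone (arrivalEpoch g) :=
    monotone_nat_of_le_succ fun k => by rw [arrivalEpoch_succ]; linarith [h1 (k + 1)]
  by_contra hnot
  have hb : ∃ C, ∀ n, arrivalEpoch g n ≤ C := by
    by_contra hC
    push Not at hC
    exact hnot (tendsto_atTop_atTop_of_monotone hmono fun C => (hC C).imp fun _ => le_of_lt)
  obtain ⟨C, hC⟩ := hb
  have hsum : Summable g := by
    refine summable_of_sum_range_le (c := C) (fun n => (h1 n).le) fun n => ?_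
    refine le_trans ?_ (hC n)
    exact Finset.sum_le_sum_of_subset_of_nonneg (Finset.range_mono (Nat.le_succ n))
      fun i _ _ => (h1 i).le
  obtain ⟨m, hm⟩ := eventually_atTop.1 (hsum.tendsto_atTop_zero.eventually (gt_mem_nhds one_pos))
  obtain ⟨l, hl, hl1⟩ := h2 m
  exact absurd (hm l hl) (not_lt.2 hl1.le)

end VacationQueue

/-! ### Counting arrivals -/

/-- The cardinality is a countable sum of indicators. The formula survives infinite sets, where
`ncard` and `ENNReal.toReal` both take the default value 0. -/
theorem measurable_ncard_setOf {Ω : Type*} [MeasurableSpace Ω] {A : ℕ → Set Ω}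
    (hA : ∀ k, MeasurableSet (A k)) : Measurable fun ω => {k | ω ∈ A k}.ncard := by
  have h1 : Measurable fun ω => ∑' k, (A k).indicator (fun _ => (1 : ℝ≥0∞)) ω :=
    Measurable.tsum fun k => measurable_const.indicator (hA k)
  have h2 : (fun ω => {k | ω ∈ A k}.ncard) =
      fun ω => ⌊(∑' k, (A k).indicator (fun _ => (1 : ℝ≥0∞)) ω).toReal⌋₊ := by
    ext ω
    have h3 : ∑' k, (A k).indicator (fun _ => (1 : ℝ≥0∞)) ω =
        (({k | ω ∈ A k}.encard : ℕ∞) : ℝ≥0∞) := by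
      rw [← ENNReal.tsum_set_one, tsum_subtype {k | ω ∈ A k} fun _ => (1 : ℝ≥0∞)]
      rfl
    rw [h3]
    rcases {k | ω ∈ A k}.finite_or_infinite with hf | hi
    · rw [← hf.cast_ncard_eq]
      simp
    · rw [hi.encard_eq, hi.ncard]
      simp
  rw [h2]
  exact Nat.measurable_floor.comp h1.ennreal_toReal

@[fun_prop]
theorem measurable_arrivalCount {Ω : Type*} [MeasurableSpace Ω] {g : Ω → ℕ → ℝ} {t : Ω → ℝ}
    (hg : Measurable g) (ht : Measurable t) : Measurable fun ω => arrivalCount (g ω) (t ω) := by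
  unfold arrivalCount
  exact measurable_ncard_setOf (A := fun k => {ω | arrivalEpoch (g ω) k ≤ t ω})
    fun k => measurableSet_le (by fun_prop) ht

/-- Increasing unbounded epochs make the indices of the arrivals up to `t` a finite initial segment.
This equivalence turns comparisons of times into integer arithmetic. -/
theorem GoodGaps.epoch_le_iff {g : ℕ → ℝ} (h : GoodGaps g) {t : ℝ} {k : ℕ} :
    arrivalEpoch g k ≤ t ↔ k < arrivalCount g t := by
  classical
  have hex : ∃ m, t < arrivalEpoch g m := (h.2.eventually_gt_atTop t).exists
  have hset : {k | arrivalEpoch g k ≤ t} = Iio (Nat.find hex) := by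
    ext j
    rw [mem_ofPred_eq, mem_Iio]
    constructor
    · intro hj
      by_contra hc
      exact absurd (Nat.find_spec hex)
        (not_lt.2 ((h.strictMono.monotone (not_lt.1 hc)).trans hj))
    · intro hj
      exact not_lt.1 (Nat.find_min hex hj)
  have hc : arrivalCount g t = Nat.find hex := by
    rw [arrivalCount, hset, ← Nat.card_coe_set_eq]
    simp
  rw [hc, ← mem_Iio, ← hset, mem_ofPred_eq]

theorem GoodGaps.lt_epoch_iff {g : ℕ → ℝ} (h : GoodGaps g) {t : ℝ} {k : ℕ} :
    t < arrivalEpoch g k ↔ arrivalCount g t ≤ k := by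
  rw [← not_le, h.epoch_le_iff, not_lt]

theorem GoodGaps.arrivalCount_mono {g : ℕ → ℝ} (h : GoodGaps g) : Monotone (arrivalCount g) := by
  intro s t hst
  by_contra hc
  exact lt_irrefl _ (h.epoch_le_iff.1 ((h.epoch_le_iff.2 (not_le.1 hc)).trans hst))

theorem GoodGaps.arrivalCount_of_nonpos {g : ℕ → ℝ} (h : GoodGaps g) {t : ℝ} (ht : t ≤ 0) :
    arrivalCount g t = 0 :=
  Nat.le_zero.1 (h.lt_epoch_iff.1 (ht.trans_lt (h.epoch_pos 0)))

/-- The interarrival times seen from time `t` on. -/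
noncomputable def shiftGaps (t : ℝ) (g : ℕ → ℝ) : ℕ → ℝ := fun l =>
  if l = 0 then arrivalEpoch g (arrivalCount g t) - t else g (arrivalCount g t + l)

theorem arrivalEpoch_shiftGaps (t : ℝ) (g : ℕ → ℝ) (l : ℕ) :
    arrivalEpoch (shiftGaps t g) l = arrivalEpoch g (arrivalCount g t + l) - t := by
  induction l with
  | zero => simp [arrivalEpoch_zero, shiftGaps]
  | succ l ih =>
    rw [arrivalEpoch_succ, ih, ← add_assoc, arrivalEpoch_succ]
    simp only [shiftGaps, Nat.succ_ne_zero, if_false]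
    ring_nf

theorem GoodGaps.shift {g : ℕ → ℝ} (h : GoodGaps g) (t : ℝ) : GoodGaps (shiftGaps t g) := by
  refine ⟨fun l => ?_, ?_⟩
  · unfold shiftGaps
    split_ifs
    · exact sub_pos.2 (h.lt_epoch_iff.2 le_rfl)
    · exact h.1 _
  · have : arrivalEpoch (shiftGaps t g) = fun l => arrivalEpoch g (l + arrivalCount g t) - t := by
      ext l
      rw [arrivalEpoch_shiftGaps, add_comm]
    rw [this]
    exact tendsto_atTop_add_const_right _ _ ((tendsto_add_atTop_iff_nat _).2 h.2)

theorem GoodGaps.arrivalCount_add {g : ℕ → ℝ} (h : GoodGaps g) (t : ℝ) {s : ℝ} (hs : 0 ≤ s) :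
    arrivalCount g (t + s) = arrivalCount g t + arrivalCount (shiftGaps t g) s := by
  have h1 : ∀ k, k < arrivalCount (shiftGaps t g) s ↔
      arrivalCount g t + k < arrivalCount g (t + s) := fun k => by
    rw [← (h.shift t).epoch_le_iff, ← h.epoch_le_iff, arrivalEpoch_shiftGaps,
      sub_le_iff_le_add, add_comm s]
  have h2 : arrivalCount g t ≤ arrivalCount g (t + s) := h.arrivalCount_mono (by linarith)
  have h3 := h1 (arrivalCount g (t + s) - arrivalCount g t)
  have h4 := h1 (arrivalCount (shiftGaps t g) s)
  omega

theorem measurable_apply_nat {α Ω : Type*} [MeasurableSpace α] [MeasurableSpace Ω]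
    {f : ℕ → Ω → α} (hf : ∀ n, Measurable (f n)) {N : Ω → ℕ} (hN : Measurable N) :
    Measurable fun ω => f (N ω) ω := by
  have h : Measurable fun x : ℕ × Ω => f x.1 x.2 := measurable_from_prod_countable_right hf
  exact h.comp (hN.prodMk measurable_id)

@[fun_prop]
theorem measurable_shiftGaps {Ω : Type*} [MeasurableSpace Ω] {g : Ω → ℕ → ℝ} {t : Ω → ℝ}
    (ht : Measurable t) (hg : Measurable g) : Measurable fun ω => shiftGaps (t ω) (g ω) := by
  refine measurable_pi_iff.2 fun l => ?_
  have hN : Measurable fun ω => arrivalCount (g ω) (t ω) := measurable_arrivalCount hg ht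
  unfold shiftGaps
  split_ifs
  · exact (measurable_apply_nat (f := fun n ω => arrivalEpoch (g ω) n)
      (fun n => by fun_prop) hN).sub ht
  · exact measurable_apply_nat (f := fun n ω => g ω (n + l)) (fun n => by fun_prop) hN

/-- Two sequences of epochs agree up to and including time `t`. -/
def AgreeUpTo (t : ℝ) (a a' : ℕ → ℝ) : Prop := ∀ k, a k ≤ t ∨ a' k ≤ t → a' k = a k

theorem AgreeUpTo.symm {t : ℝ} {a a' : ℕ → ℝ} (h : AgreeUpTo t a a') : AgreeUpTo t a' a :=
  fun k hk => (h k hk.symm).symm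

theorem AgreeUpTo.mono {s t : ℝ} {a a' : ℕ → ℝ} (h : AgreeUpTo t a a') (hst : s ≤ t) :
    AgreeUpTo s a a' :=
  fun k hk => h k (hk.imp (fun h => h.trans hst) fun h => h.trans hst)

theorem AgreeUpTo.arrivalCount_eq {t : ℝ} {g g' : ℕ → ℝ}
    (h : AgreeUpTo t (arrivalEpoch g) (arrivalEpoch g')) :
    arrivalCount g' t = arrivalCount g t := by
  unfold arrivalCount
  congr 1
  ext k
  constructor
  · intro hk
    have := h k (Or.inr hk)
    rw [mem_ofPred_eq] at hk ⊢
    rwa [← this]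
  · intro hk
    have := h k (Or.inl hk)
    rw [mem_ofPred_eq] at hk ⊢
    rwa [this]

theorem AgreeUpTo.shiftGaps {t s : ℝ} {g g' : ℕ → ℝ} (hs : 0 ≤ s)
    (h : AgreeUpTo (t + s) (arrivalEpoch g) (arrivalEpoch g')) :
    AgreeUpTo s (arrivalEpoch (shiftGaps t g)) (arrivalEpoch (shiftGaps t g')) := by
  intro k hk
  have hc := (h.mono (le_add_of_nonneg_right hs)).arrivalCount_eq
  rw [arrivalEpoch_shiftGaps, arrivalEpoch_shiftGaps, hc] at hk ⊢
  rw [h]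
  exact hk.imp (fun h => by linarith) fun h => by linarith

/-- The arrivals made from `g` have all occurred and the first gap of `y` straddles `t`.
Nonnegativity of `t` is what the case `m = 0` needs. -/
theorem arrivalCount_splice_eq_iff {m : ℕ} {g y : ℕ → ℝ} (hg : ∀ l, 0 < g l) (hy : GoodGaps y)
    {t : ℝ} (ht : 0 ≤ t) :
    arrivalCount (splice m g y) t = m ↔
      ∑ l ∈ Finset.range m, g l ≤ t ∧ t < ∑ l ∈ Finset.range m, g l + y 0 := by
  have hgood : GoodGaps (splice m g y) := GoodGaps.splice hg hy
  have h1 : arrivalEpoch (splice m g y) m = ∑ l ∈ Finset.range m, g l + y 0 := by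
    simpa [arrivalEpoch_zero] using arrivalEpoch_splice_add m g y 0
  rw [← h1, hgood.lt_epoch_iff, le_antisymm_iff, and_comm]
  refine and_congr_left fun _ => ?_
  rcases m with _ | m
  · simp [ht]
  · rw [Nat.succ_le_iff, ← hgood.epoch_le_iff, arrivalEpoch_splice_of_lt _ _ (Nat.lt_succ_self m)]
    rfl

/-- The gap in progress at `t` loses its elapsed part and later gaps are untouched, which is the
situation of the memoryless property. -/
theorem shiftGaps_splice {m : ℕ} {g y : ℕ → ℝ} {t : ℝ}
    (hc : arrivalCount (splice m g y) t = m) :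
    shiftGaps t (splice m g y) =
      Function.update y 0 (y 0 - (t - ∑ l ∈ Finset.range m, g l)) := by
  ext l
  unfold shiftGaps
  rw [hc]
  rcases l with _ | l
  · have h1 : arrivalEpoch (splice m g y) m = ∑ l ∈ Finset.range m, g l + y 0 := by
      simpa [arrivalEpoch_zero] using arrivalEpoch_splice_add m g y 0
    simp only [if_true, h1, Function.update_self]
    ring
  · simp [splice]

/-! ### The strong Markov property of the Poisson process -/

namespace VacationQueue

variable {E : Type*} [MeasurableSpace E] (M : VacationQueue E)

theorem lintegral_gapLaw_splice (m : ℕ) {F : (ℕ → ℝ) → ℝ≥0∞} (hF : Measurable F) :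
    ∫⁻ g, F g ∂M.gapLaw = ∫⁻ g, ∫⁻ y, F (splice m g y) ∂M.gapLaw ∂M.gapLaw :=
  lintegral_splice _ m hF

theorem measurable_lintegral_splice_const {F : (ℕ → ℝ) → ℝ≥0∞} (hF : Measurable F) :
    Measurable fun x : ℝ => ∫⁻ z, F (splice 1 (fun _ => x) z) ∂M.gapLaw := by
  have h : Measurable fun p : ℝ × (ℕ → ℝ) => F (splice 1 (fun _ => p.1) p.2) :=
    hF.comp ((measurable_splice 1).comp (g := fun x : (ℕ → ℝ) × (ℕ → ℝ) => splice 1 x.1 x.2)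
      (f := fun p : ℝ × (ℕ → ℝ) => ((fun _ => p.1), p.2)) (by fun_prop))
  exact h.lintegral_prod_right'

theorem lintegral_gapLaw_head {F : (ℕ → ℝ) → ℝ≥0∞} (hF : Measurable F) :
    ∫⁻ g, F g ∂M.gapLaw =
      ∫⁻ x, ∫⁻ z, F (splice 1 (fun _ => x) z) ∂M.gapLaw ∂(expMeasure M.lam) := by
  rw [M.lintegral_gapLaw_splice 1 hF]
  have h1 : ∀ g z : ℕ → ℝ, splice 1 g z = splice 1 (fun _ => g 0) z := fun g z => by
    ext l
    unfold splice
    split_ifs with hl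
    · rw [Nat.lt_one_iff.1 hl]
    · rfl
  simp_rw [h1]
  exact lintegral_infinitePi_eval (expMeasure M.lam) 0 (M.measurable_lintegral_splice_const hF)

theorem measurable_update_ite (s : ℝ) {F : (ℕ → ℝ) → ℝ≥0∞} (hF : Measurable F) :
    Measurable fun y : ℕ → ℝ => if s < y 0 then F (Function.update y 0 (y 0 - s)) else 0 := by
  refine Measurable.ite (measurableSet_lt measurable_const (measurable_pi_apply 0)) ?_
    measurable_const
  refine hF.comp (measurable_pi_iff.2 fun l => ?_)
  by_cases hl : l = 0
  · subst hl
    simp only [Function.update_self]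
    fun_prop
  · simp only [Function.update_of_ne hl]
    fun_prop

/-- Only the first gap is altered, so the one-dimensional memoryless property applies with the other
gaps integrated out. -/
theorem lintegral_gapLaw_memoryless {s : ℝ} (hs : 0 ≤ s) {F : (ℕ → ℝ) → ℝ≥0∞}
    (hF : Measurable F) :
    ∫⁻ y, (if s < y 0 then F (Function.update y 0 (y 0 - s)) else 0) ∂M.gapLaw =
      ENNReal.ofReal (Real.exp (-(M.lam * s))) * ∫⁻ y, F y ∂M.gapLaw := by
  have hm := measurable_update_ite s hF
  rw [M.lintegral_gapLaw_head hm, M.lintegral_gapLaw_head hF,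
    ← lintegral_expMeasure_memoryless hs (M.measurable_lintegral_splice_const hF)]
  refine lintegral_congr fun x => ?_
  have h1 : ∀ z : ℕ → ℝ, Function.update (splice 1 (fun _ => x) z) 0 (x - s) =
      splice 1 (fun _ => x - s) z := fun z => by
    ext l
    rcases l with _ | l <;> simp [splice]
  have h0 : ∀ z : ℕ → ℝ, splice 1 (fun _ => x) z 0 = x := fun z => by simp [splice]
  simp_rw [h0, h1]
  split_ifs <;> simp

/-- Fix the first `m` gaps, with sum `c`. On the event that exactly `m` arrivals occur up to `τ` and
`H` is nonzero, nonanticipation leaves no freedom: `τ` and `H` are constants, and the event says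
only that the gap in progress exceeds `t - c`. The memoryless property then makes the future
independent. -/
theorem lintegral_splice_strongMarkov {τ : (ℕ → ℝ) → ℝ} {H G : (ℕ → ℝ) → ℝ≥0∞}
    (hG : Measurable G) (h0 : ∀ g, H g ≠ 0 → 0 ≤ τ g)
    (hna : ∀ g g', GoodGaps g → GoodGaps g' → H g ≠ 0 →
      AgreeUpTo (τ g) (arrivalEpoch g) (arrivalEpoch g') → τ g' = τ g ∧ H g' = H g)
    (m : ℕ) {g : ℕ → ℝ} (hg : ∀ l, 0 < g l) :
    ∫⁻ y, (if arrivalCount (splice m g y) (τ (splice m g y)) = m then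
        H (splice m g y) * G (shiftGaps (τ (splice m g y)) (splice m g y)) else 0) ∂M.gapLaw =
      (∫⁻ y, (if arrivalCount (splice m g y) (τ (splice m g y)) = m then
        H (splice m g y) else 0) ∂M.gapLaw) * ∫⁻ y, G y ∂M.gapLaw := by
  set c := ∑ l ∈ Finset.range m, g l with hc
  by_cases hS : ∃ y, GoodGaps y ∧ H (splice m g y) ≠ 0 ∧
      arrivalCount (splice m g y) (τ (splice m g y)) = m
  -- Any one admissible continuation `y₀` determines the common values of `τ` and `H`.
  · obtain ⟨y₀, hy₀, hH₀, hcnt₀⟩ := hS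
    set t := τ (splice m g y₀) with ht
    have htpos : 0 ≤ t := h0 _ hH₀
    obtain ⟨hct, hty⟩ := (arrivalCount_splice_eq_iff hg hy₀ htpos).1 hcnt₀
    have hagree : ∀ y y' : ℕ → ℝ, GoodGaps y → GoodGaps y' → ∀ u, u < c + y 0 → u < c + y' 0 →
        AgreeUpTo u (arrivalEpoch (splice m g y)) (arrivalEpoch (splice m g y')) := by
      intro y y' hy hy' u hu hu' l hl
      by_cases hlm : l < m
      · rw [arrivalEpoch_splice_of_lt _ _ hlm, arrivalEpoch_splice_of_lt _ _ hlm]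
      · exfalso
        obtain ⟨r, rfl⟩ := Nat.exists_eq_add_of_le (not_lt.1 hlm)
        rw [arrivalEpoch_splice_add, arrivalEpoch_splice_add] at hl
        have h1 := hy.strictMono.monotone (Nat.zero_le r)
        have h2 := hy'.strictMono.monotone (Nat.zero_le r)
        rw [arrivalEpoch_zero] at h1 h2
        rcases hl with hl | hl <;> linarith
    have hin : ∀ y, GoodGaps y → t - c < y 0 →
        τ (splice m g y) = t ∧ H (splice m g y) = H (splice m g y₀) ∧
          arrivalCount (splice m g y) t = m := by
      intro y hy hlt
      obtain ⟨h1, h2⟩ := hna _ _ (GoodGaps.splice hg hy₀) (GoodGaps.splice hg hy) hH₀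
        (hagree y₀ y hy₀ hy t hty (by linarith))
      exact ⟨h1, h2, (arrivalCount_splice_eq_iff hg hy htpos).2 ⟨hct, by linarith⟩⟩
    -- If the next arrival came by time `t` and yet `τ` preceded it, the path would agree with that
    -- of `y₀` up to this `τ`; nonanticipation would force `τ = t`, a contradiction.
    have hout : ∀ y, GoodGaps y → ¬ t - c < y 0 → H (splice m g y) ≠ 0 →
        arrivalCount (splice m g y) (τ (splice m g y)) ≠ m := by
      intro y hy hlt hHy hcnt
      obtain ⟨_, h2⟩ := (arrivalCount_splice_eq_iff hg hy (h0 _ hHy)).1 hcnt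
      have h3 := (hna _ _ (GoodGaps.splice hg hy) (GoodGaps.splice hg hy₀) hHy
        (hagree y y₀ hy hy₀ _ h2 (by linarith))).1
      linarith
    have key : ∀ F : (ℕ → ℝ) → ℝ≥0∞, Measurable F →
        ∫⁻ y, (if arrivalCount (splice m g y) (τ (splice m g y)) = m then
          H (splice m g y) * F (shiftGaps (τ (splice m g y)) (splice m g y)) else 0) ∂M.gapLaw =
        H (splice m g y₀) * ENNReal.ofReal (Real.exp (-(M.lam * (t - c)))) *
          ∫⁻ y, F y ∂M.gapLaw := by
      intro F hF
      rw [mul_assoc, ← M.lintegral_gapLaw_memoryless (sub_nonneg.2 hct) hF,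
        ← lintegral_const_mul _ (measurable_update_ite _ hF)]
      · refine lintegral_congr_ae ?_
        filter_upwards [M.ae_goodGaps] with y hy
        by_cases hlt : t - c < y 0
        · obtain ⟨h1, h2, h3⟩ := hin y hy hlt
          rw [h1, if_pos h3, if_pos hlt, h2, shiftGaps_splice h3]
        · rw [if_neg hlt, mul_zero]
          by_cases hHy : H (splice m g y) = 0
          · simp [hHy]
          · rw [if_neg (hout y hy hlt hHy)]
    -- The constant function 1 identifies the common factor in `key` as the integral of `H` over the
    -- event.
    have h1 := key (fun _ => 1) measurable_const
    simp only [mul_one, lintegral_one, measure_univ] at h1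
    rw [key G hG, h1]
  · push Not at hS
    have hz : ∀ᵐ y ∂M.gapLaw, arrivalCount (splice m g y) (τ (splice m g y)) = m →
        H (splice m g y) = 0 := by
      filter_upwards [M.ae_goodGaps] with y hy hcnt
      by_contra hne
      exact hS y hy hne hcnt
    have hzero : ∀ F : (ℕ → ℝ) → ℝ≥0∞,
        ∫⁻ y, (if arrivalCount (splice m g y) (τ (splice m g y)) = m then
          H (splice m g y) * F y else 0) ∂M.gapLaw = 0 := fun F => by
      rw [lintegral_congr_ae (g := fun _ => 0), lintegral_zero]
      filter_upwards [hz] with y hy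
      split_ifs with h
      · rw [hy h, zero_mul]
      · rfl
    have h1 := hzero fun _ => 1
    simp only [mul_one] at h1
    rw [hzero fun y => G (shiftGaps (τ (splice m g y)) (splice m g y)), h1, zero_mul]

/-- The strong Markov property of the Poisson process at a time that does not depend on later
arrivals. -/
theorem lintegral_strongMarkov {τ : (ℕ → ℝ) → ℝ} {H G : (ℕ → ℝ) → ℝ≥0∞} (hτ : Measurable τ)
    (hH : Measurable H) (hG : Measurable G) (h0 : ∀ g, H g ≠ 0 → 0 ≤ τ g)
    (hna : ∀ g g', GoodGaps g → GoodGaps g' → H g ≠ 0 →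
      AgreeUpTo (τ g) (arrivalEpoch g) (arrivalEpoch g') → τ g' = τ g ∧ H g' = H g) :
    ∫⁻ g, H g * G (shiftGaps (τ g) g) ∂M.gapLaw =
      (∫⁻ g, H g ∂M.gapLaw) * ∫⁻ g, G g ∂M.gapLaw := by
  have hcnt : Measurable fun g => arrivalCount g (τ g) :=
    measurable_arrivalCount measurable_id hτ
  have hcm : ∀ m, MeasurableSet {g | arrivalCount g (τ g) = m} := fun m =>
    hcnt (measurableSet_singleton m)
  have hGs : Measurable fun g => G (shiftGaps (τ g) g) :=
    hG.comp (measurable_shiftGaps hτ measurable_id)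
  have hm1 : ∀ m, Measurable fun g => if arrivalCount g (τ g) = m then
      H g * G (shiftGaps (τ g) g) else 0 := fun m =>
    Measurable.ite (hcm m) (hH.mul hGs) measurable_const
  have hm2 : ∀ m, Measurable fun g => if arrivalCount g (τ g) = m then H g else 0 := fun m =>
    Measurable.ite (hcm m) hH measurable_const
  -- Partition by the random number `m` of arrivals up to `τ`, so that each term can be spliced at a
  -- fixed index.
  have hsplit : ∀ F : (ℕ → ℝ) → ℝ≥0∞,
      (∀ m, Measurable fun g => if arrivalCount g (τ g) = m then F g else 0) →
      ∫⁻ g, F g ∂M.gapLaw =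
        ∑' m, ∫⁻ g, (if arrivalCount g (τ g) = m then F g else 0) ∂M.gapLaw := by
    intro F hF
    rw [← lintegral_tsum fun m => (hF m).aemeasurable]
    refine lintegral_congr fun g => ?_
    rw [tsum_eq_single (arrivalCount g (τ g))]
    · simp
    · intro m hm
      rw [if_neg hm.symm]
  rw [hsplit _ hm1, hsplit _ hm2, ← ENNReal.tsum_mul_right]
  refine tsum_congr fun m => ?_
  rw [M.lintegral_gapLaw_splice m (hm1 m), M.lintegral_gapLaw_splice m (hm2 m),
    ← lintegral_mul_const]
  · refine lintegral_congr_ae ?_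
    filter_upwards [M.ae_goodGaps] with g hg
    exact M.lintegral_splice_strongMarkov hG h0 hna m hg.1
  · exact ((hm2 m).comp (measurable_splice m)).lintegral_prod_right'

end VacationQueue

theorem arrivalEpoch_one (k : ℕ) : arrivalEpoch (fun _ => 1) k = k + 1 := by
  simp [arrivalEpoch]

theorem goodGaps_one : GoodGaps fun _ => 1 := by
  refine ⟨fun _ => one_pos, ?_⟩
  have : arrivalEpoch (fun _ => 1) = fun k : ℕ => (k : ℝ) + 1 := funext arrivalEpoch_one
  rw [this]
  exact tendsto_atTop_add_const_right _ _ tendsto_natCast_atTop_atTop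

theorem expMeasure_Ici {r : ℝ} (hr : 0 < r) {s : ℝ} (hs : 0 ≤ s) :
    expMeasure r (Ici s) = ENNReal.ofReal (Real.exp (-(r * s))) := by
  rw [← expMeasure_Ioi hr hs]
  refine measure_congr ?_
  have hac : expMeasure r ≪ volume := withDensity_absolutelyContinuous _ _
  exact (hac.ae_eq Ioi_ae_eq_Ici).symm

theorem measurable_ite_lt_le {Ω : Type*} [MeasurableSpace Ω] {a b c : Ω → ℝ} {F : Ω → ℝ≥0∞}
    (ha : Measurable a) (hb : Measurable b) (hc : Measurable c) (hF : Measurable F) :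
    Measurable fun ω => if a ω < b ω ∧ b ω ≤ c ω then F ω else 0 := by
  have h : MeasurableSet ({ω | a ω < b ω} ∩ {ω | b ω ≤ c ω}) :=
    (measurableSet_lt ha hb).inter (measurableSet_le hb hc)
  exact Measurable.ite h hF measurable_const

/-! ### Poisson arrivals see time averages; moments of the Poisson count -/

namespace VacationQueue

variable {E : Type*} [MeasurableSpace E] (M : VacationQueue E)

theorem lintegral_gapLaw_eval {F : ℝ → ℝ≥0∞} (hF : Measurable F) :
    ∫⁻ g, F (g 0) ∂M.gapLaw = ∫⁻ x, F x ∂(expMeasure M.lam) :=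
  lintegral_infinitePi_eval _ 0 hF

/-- The value of `Z` at time `t` when the arrivals before `t` come from the first `m` entries
of `g`. -/
def predictableValue (Z : ℝ → (ℕ → ℝ) → ℝ≥0∞) (m : ℕ) (g : ℕ → ℝ) (t : ℝ) : ℝ≥0∞ :=
  Z t (splice m g (splice 1 (fun _ => t - ∑ l ∈ Finset.range m, g l) fun _ => 1))

theorem measurable_predictableValue {Z : ℝ → (ℕ → ℝ) → ℝ≥0∞}
    (hZ : Measurable fun x : ℝ × (ℕ → ℝ) => Z x.1 x.2) (m : ℕ) (g : ℕ → ℝ) :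
    Measurable (predictableValue Z m g) := by
  have h : Measurable fun t : ℝ =>
      (t, splice m g (splice 1 (fun _ => t - ∑ l ∈ Finset.range m, g l) fun _ => 1)) := by
    refine measurable_id.prodMk (measurable_pi_iff.2 fun l => ?_)
    unfold splice
    split_ifs <;> fun_prop
  exact hZ.comp h

/-- As long as no arrival of `y` precedes `t`, a predictable `Z` sees only the first `m` gaps. The
reference path puts its next arrival exactly at `t`; its later unit gaps are immaterial. -/
theorem predictableValue_eq {Z : ℝ → (ℕ → ℝ) → ℝ≥0∞}
    (hpred : ∀ g g' t, GoodGaps g → GoodGaps g' →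
      (∀ k, arrivalEpoch g k < t ∨ arrivalEpoch g' k < t → arrivalEpoch g' k = arrivalEpoch g k) →
        Z t g' = Z t g) (m : ℕ) {g y : ℕ → ℝ} (hg : ∀ l, 0 < g l) (hy : GoodGaps y) {t : ℝ}
    (h1 : ∑ l ∈ Finset.range m, g l < t) (h2 : t ≤ ∑ l ∈ Finset.range m, g l + y 0) :
    Z t (splice m g y) = predictableValue Z m g t := by
  have hy' : GoodGaps (splice 1 (fun _ => t - ∑ l ∈ Finset.range m, g l) fun _ => 1) :=
    GoodGaps.splice (fun _ => sub_pos.2 h1) goodGaps_one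
  refine hpred _ _ t (GoodGaps.splice hg hy') (GoodGaps.splice hg hy) fun k hk => ?_
  by_cases hkm : k < m
  · rw [arrivalEpoch_splice_of_lt _ _ hkm, arrivalEpoch_splice_of_lt _ _ hkm]
  · exfalso
    obtain ⟨r, rfl⟩ := Nat.exists_eq_add_of_le (not_lt.1 hkm)
    rw [arrivalEpoch_splice_add, arrivalEpoch_splice_add] at hk
    have h3 := hy.strictMono.monotone (Nat.zero_le r)
    have h4 := hy'.strictMono.monotone (Nat.zero_le r)
    rw [arrivalEpoch_zero] at h3 h4
    have h5 : splice 1 (fun _ => t - ∑ l ∈ Finset.range m, g l) (fun _ => 1) 0 =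
        t - ∑ l ∈ Finset.range m, g l := by simp [splice]
    rcases hk with hk | hk <;> linarith

/-- During the gap after the first `m` arrivals `Z` is a deterministic function `ζ` of time. The
left side integrates `ζ` against the exponential density of the next arrival, the right side against
the tail probability that it has not yet occurred, and the density is λ times the tail. -/
theorem lintegral_predictable_splice {Z : ℝ → (ℕ → ℝ) → ℝ≥0∞}
    (hZ : Measurable fun x : ℝ × (ℕ → ℝ) => Z x.1 x.2)
    (hpred : ∀ g g' t, GoodGaps g → GoodGaps g' →
      (∀ k, arrivalEpoch g k < t ∨ arrivalEpoch g' k < t → arrivalEpoch g' k = arrivalEpoch g k) →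
        Z t g' = Z t g) (T : ℝ) (m : ℕ) {g : ℕ → ℝ} (hg : ∀ l, 0 < g l) :
    ∫⁻ y, (if arrivalEpoch (splice m g y) m ≤ T then
        Z (arrivalEpoch (splice m g y) m) (splice m g y) else 0) ∂M.gapLaw =
      ENNReal.ofReal M.lam * ∫⁻ y, (∫⁻ t in Ioc 0 T, (if ∑ l ∈ Finset.range m, g l < t ∧
        t ≤ arrivalEpoch (splice m g y) m then Z t (splice m g y) else 0)) ∂M.gapLaw := by
  set c := ∑ l ∈ Finset.range m, g l with hc
  have hc0 : 0 ≤ c := Finset.sum_nonneg fun l _ => (hg l).le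
  have hep : ∀ y, arrivalEpoch (splice m g y) m = c + y 0 := fun y => by
    simpa [arrivalEpoch_zero] using arrivalEpoch_splice_add m g y 0
  set ζ := predictableValue Z m g with hζ
  have hζm : Measurable ζ := measurable_predictableValue hZ m g
  have hL : ∫⁻ y, (if arrivalEpoch (splice m g y) m ≤ T then
        Z (arrivalEpoch (splice m g y) m) (splice m g y) else 0) ∂M.gapLaw =
      ∫⁻ x, (if c + x ≤ T then ζ (c + x) else 0) ∂(expMeasure M.lam) := by
    rw [← M.lintegral_gapLaw_eval (Measurable.ite (measurableSet_le (by fun_prop) (by fun_prop))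
      (by fun_prop) measurable_const)]
    refine lintegral_congr_ae ?_
    filter_upwards [M.ae_goodGaps] with y hy
    rw [hep, predictableValue_eq hpred m hg hy (by linarith [hy.1 0]) le_rfl]
  have hR : ∫⁻ y, (∫⁻ t in Ioc 0 T, (if c < t ∧
        t ≤ arrivalEpoch (splice m g y) m then Z t (splice m g y) else 0)) ∂M.gapLaw =
      ∫⁻ t in Ioc 0 T, (if c < t then ζ t * ENNReal.ofReal (Real.exp (-(M.lam * (t - c))))
        else 0) := by
    have h1 : ∫⁻ y, (∫⁻ t in Ioc 0 T, (if c < t ∧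
        t ≤ arrivalEpoch (splice m g y) m then Z t (splice m g y) else 0)) ∂M.gapLaw =
        ∫⁻ y, (∫⁻ t in Ioc 0 T, (if c < t ∧ t ≤ c + y 0 then ζ t else 0)) ∂M.gapLaw := by
      refine lintegral_congr_ae ?_
      filter_upwards [M.ae_goodGaps] with y hy
      refine lintegral_congr fun t => ?_
      rw [hep]
      split_ifs with h
      · exact predictableValue_eq hpred m hg hy h.1 h.2
      · rfl
    rw [h1, lintegral_lintegral_swap]
    · refine lintegral_congr fun t => ?_
      by_cases hct : c < t
      · simp only [hct, true_and, if_true]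
        rw [← expMeasure_Ici M.lam_pos (sub_nonneg.2 hct.le),
          ← lintegral_indicator_const measurableSet_Ici, ← M.lintegral_gapLaw_eval
            (measurable_const.indicator measurableSet_Ici)]
        refine lintegral_congr fun y => ?_
        simp only [indicator, mem_Ici, sub_le_iff_le_add']
      · simp [hct]
    · have hy0 : Measurable fun x : (ℕ → ℝ) × ℝ => c + x.1 0 := by fun_prop
      exact (measurable_ite_lt_le measurable_const measurable_snd hy0
        (hζm.comp measurable_snd)).aemeasurable
  rw [hL, hR, lintegral_expMeasure (Measurable.ite (measurableSet_le (by fun_prop) (by fun_prop))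
      (by fun_prop) measurable_const), ← lintegral_const_mul _ (Measurable.ite
      measurableSet_Ioi (by fun_prop) measurable_const), ← lintegral_indicator measurableSet_Ioi,
      ← lintegral_indicator measurableSet_Ioc]
  rw [← lintegral_add_left_eq_self (μ := volume) (f := (Ioc 0 T).indicator _) c]
  refine lintegral_congr fun x => ?_
  simp only [indicator, mem_Ioi, mem_Ioc, lt_add_iff_pos_right, add_sub_cancel_left]
  by_cases hx : 0 < x
  · have hcx : 0 < c + x := by linarith
    simp only [hx, hcx, true_and, if_true]
    split_ifs with hT
    · rw [ENNReal.ofReal_mul M.lam_pos.le]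
      ring
    · simp
  · simp [hx]

/-- Poisson arrivals see time averages: for a nonnegative process that depends on earlier arrivals
only, the expected sum over the arrivals in `(0, T]` is `λ` times the expected integral. -/
theorem lintegral_sum_arrivals {Z : ℝ → (ℕ → ℝ) → ℝ≥0∞}
    (hZ : Measurable fun x : ℝ × (ℕ → ℝ) => Z x.1 x.2)
    (hpred : ∀ g g' t, GoodGaps g → GoodGaps g' →
      (∀ k, arrivalEpoch g k < t ∨ arrivalEpoch g' k < t → arrivalEpoch g' k = arrivalEpoch g k) →
        Z t g' = Z t g) (T : ℝ) :
    ∫⁻ g, ∑' k, (if arrivalEpoch g k ≤ T then Z (arrivalEpoch g k) g else 0) ∂M.gapLaw =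
      ENNReal.ofReal M.lam * ∫⁻ g, (∫⁻ t in Ioc 0 T, Z t g) ∂M.gapLaw := by
  have hm1 : ∀ k, Measurable fun g => if arrivalEpoch g k ≤ T then Z (arrivalEpoch g k) g else 0 :=
    fun k => Measurable.ite (measurableSet_le (by fun_prop) measurable_const)
      (hZ.comp ((measurable_arrivalEpoch k).prodMk measurable_id)) measurable_const
  have hm2 : ∀ k, Measurable fun x : (ℕ → ℝ) × ℝ => if ∑ l ∈ Finset.range k, x.1 l < x.2 ∧
      x.2 ≤ arrivalEpoch x.1 k then Z x.2 x.1 else 0 := fun k =>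
    measurable_ite_lt_le (by fun_prop) (by fun_prop) (by fun_prop) (hZ.comp measurable_swap)
  have hm3 : ∀ k, Measurable fun g => ∫⁻ t in Ioc 0 T, (if ∑ l ∈ Finset.range k, g l < t ∧
      t ≤ arrivalEpoch g k then Z t g else 0) := fun k => (hm2 k).lintegral_prod_right'
  rw [lintegral_tsum fun k => (hm1 k).aemeasurable]
  have hR : ∫⁻ g, (∫⁻ t in Ioc 0 T, Z t g) ∂M.gapLaw =
      ∑' k, ∫⁻ g, (∫⁻ t in Ioc 0 T, (if ∑ l ∈ Finset.range k, g l < t ∧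
        t ≤ arrivalEpoch g k then Z t g else 0)) ∂M.gapLaw := by
    rw [← lintegral_tsum fun k => (hm3 k).aemeasurable]
    refine lintegral_congr_ae ?_
    filter_upwards [M.ae_goodGaps] with g hg
    have hm4 : ∀ k, Measurable fun t => if ∑ l ∈ Finset.range k, g l < t ∧
        t ≤ arrivalEpoch g k then Z t g else 0 := fun k => (hm2 k).comp measurable_prodMk_left
    rw [← lintegral_tsum fun k => (hm4 k).aemeasurable]
    refine setLIntegral_congr_fun measurableSet_Ioc fun t ht => ?_
    classical
    have hex : ∃ k, t ≤ arrivalEpoch g k := (hg.2.eventually_ge_atTop t).exists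
    -- The half-open interarrival intervals partition the positive half-line, so exactly one term of
    -- the sum survives.
    have hiff : ∀ k, (∑ l ∈ Finset.range k, g l < t ∧ t ≤ arrivalEpoch g k) ↔
        k = Nat.find hex := by
      intro k
      rw [eq_comm, Nat.find_eq_iff, and_comm]
      refine and_congr_right fun _ => ⟨fun h n hn => ?_, fun h => ?_⟩
      · refine not_le.2 (lt_of_le_of_lt ?_ h)
        exact Finset.sum_le_sum_of_subset_of_nonneg (Finset.range_mono hn)
          fun i _ _ => (hg.1 i).le
      · rcases k with _ | k
        · simpa using ht.1
        · exact not_le.1 (h k (Nat.lt_succ_self k))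
    simp_rw [hiff]
    rw [tsum_ite_eq]
  rw [hR, ← ENNReal.tsum_mul_left]
  refine tsum_congr fun k => ?_
  rw [M.lintegral_gapLaw_splice k (hm1 k), M.lintegral_gapLaw_splice k (hm3 k),
    ← lintegral_const_mul]
  · refine lintegral_congr_ae ?_
    filter_upwards [M.ae_goodGaps] with g hg
    rw [M.lintegral_predictable_splice hZ hpred T k hg.1]
    congr 1
    refine lintegral_congr fun y => ?_
    refine lintegral_congr fun t => ?_
    have : ∑ l ∈ Finset.range k, splice k g y l = ∑ l ∈ Finset.range k, g l :=
      Finset.sum_congr rfl fun l hl => by simp [splice, Finset.mem_range.1 hl]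
    rw [this]
  · exact ((hm3 k).comp (measurable_splice k)).lintegral_prod_right'

theorem _root_.GoodGaps.tsum_epoch_le {g : ℕ → ℝ} (hg : GoodGaps g) (T : ℝ) (f : ℕ → ℝ≥0∞) :
    ∑' k, (if arrivalEpoch g k ≤ T then f k else 0) =
      ∑ k ∈ Finset.range (arrivalCount g T), f k := by
  simp_rw [hg.epoch_le_iff]
  rw [tsum_eq_sum (s := Finset.range (arrivalCount g T))]
  · exact Finset.sum_congr rfl fun k hk => if_pos (Finset.mem_range.1 hk)
  · intro k hk
    exact if_neg (by simpa using hk)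

theorem lintegral_arrivalCount (T : ℝ) :
    ∫⁻ g, (arrivalCount g T : ℝ≥0∞) ∂M.gapLaw = ENNReal.ofReal (M.lam * T) := by
  have h := M.lintegral_sum_arrivals (Z := fun _ _ => 1) measurable_const
    (fun _ _ _ _ _ _ => rfl) T
  rw [ENNReal.ofReal_mul M.lam_pos.le]
  convert h using 1
  · refine lintegral_congr_ae ?_
    filter_upwards [M.ae_goodGaps] with g hg
    rw [hg.tsum_epoch_le]
    simp
  · simp

/-- Write n² = n + 2(0 + 1 + ... + (n-1)). Arrival number `k` finds `k` earlier arrivals, so the sum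
is one over arrivals of a predictable process, and its mean is λ times the integral of λt. -/
theorem lintegral_arrivalCount_sq {T : ℝ} (hT : 0 ≤ T) :
    ∫⁻ g, (arrivalCount g T : ℝ≥0∞) ^ 2 ∂M.gapLaw =
      ENNReal.ofReal (M.lam * T + (M.lam * T) ^ 2) := by
  set Z : ℝ → (ℕ → ℝ) → ℝ≥0∞ := fun t g => ∑' k, if arrivalEpoch g k < t then 1 else 0 with hZ
  have hZm : Measurable fun x : ℝ × (ℕ → ℝ) => Z x.1 x.2 :=
    Measurable.tsum fun k => Measurable.ite (measurableSet_lt (by fun_prop) (by fun_prop))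
      measurable_const measurable_const
  have h := M.lintegral_sum_arrivals hZm (fun g g' t _ _ hagree => tsum_congr fun k => by
    have : arrivalEpoch g' k < t ↔ arrivalEpoch g k < t :=
      ⟨fun hk => hagree k (Or.inr hk) ▸ hk, fun hk => (hagree k (Or.inl hk)).symm ▸ hk⟩
    simp only [this]) T
  have hl : ∀ g, GoodGaps g → ∀ k, Z (arrivalEpoch g k) g = k := fun g hg k => by
    simp only [hZ, hg.strictMono.lt_iff_lt]
    rw [tsum_eq_sum (s := Finset.range k) fun l hl => if_neg (by simpa using hl)]
    simp [Finset.sum_ite_of_true fun l hl => Finset.mem_range.1 hl]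
  have hr : ∫⁻ g, (∫⁻ t in Ioc 0 T, Z t g) ∂M.gapLaw = ENNReal.ofReal (M.lam * (T ^ 2 / 2)) := by
    have h1 : ∫⁻ g, (∫⁻ t in Ioc 0 T, Z t g) ∂M.gapLaw =
        ∫⁻ g, (∫⁻ t in Ioc 0 T, (arrivalCount g t : ℝ≥0∞)) ∂M.gapLaw := by
      refine lintegral_congr_ae ?_
      filter_upwards [M.ae_goodGaps] with g hg
      refine lintegral_congr_ae (ae_restrict_of_ae ?_)
      -- Predictability forces strict inequality in `Z`; the count up to and including `t` differs
      -- only at the countably many arrival epochs.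
      have hcount : ∀ᵐ t : ℝ, t ∉ range (arrivalEpoch g) :=
        compl_mem_ae_iff.2 ((countable_range _).measure_zero volume)
      filter_upwards [hcount] with t ht
      have h2 : ∀ k, arrivalEpoch g k < t ↔ arrivalEpoch g k ≤ t := fun k =>
        ⟨le_of_lt, fun hk => lt_of_le_of_ne hk fun he => ht ⟨k, he⟩⟩
      simp only [hZ, h2]
      rw [hg.tsum_epoch_le]
      simp
    rw [h1, lintegral_lintegral_swap]
    · have h2 : ∫⁻ t in Ioc 0 T, ∫⁻ g, (arrivalCount g t : ℝ≥0∞) ∂M.gapLaw =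
          ∫⁻ t in Ioc 0 T, ENNReal.ofReal (M.lam * t) :=
        setLIntegral_congr_fun measurableSet_Ioc fun t ht => M.lintegral_arrivalCount t
      rw [h2, ← ofReal_integral_eq_lintegral_ofReal]
      · rw [← intervalIntegral.integral_of_le hT, intervalIntegral.integral_const_mul, integral_id]
        simp
      · exact (Continuous.integrableOn_Ioc (by fun_prop))
      · filter_upwards [ae_restrict_mem measurableSet_Ioc] with t ht
        exact mul_nonneg M.lam_pos.le ht.1.le
    · exact (measurable_from_nat.comp (measurable_arrivalCount measurable_fst measurable_snd)
        ).aemeasurable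
  rw [hr, ← ENNReal.ofReal_mul M.lam_pos.le] at h
  have hsq : ∀ n : ℕ, (n : ℝ≥0∞) ^ 2 = n + 2 * ∑ k ∈ Finset.range n, (k : ℝ≥0∞) := by
    intro n
    have := Finset.sum_range_id_mul_two n
    have h3 : n ^ 2 = n + 2 * ∑ k ∈ Finset.range n, k := by
      rw [mul_comm 2, this]
      rcases n with _ | n
      · rfl
      · simp only [Nat.add_sub_cancel]
        ring
    rw [← Nat.cast_pow, h3]
    push_cast
    rfl
  have hN : Measurable fun g => (arrivalCount g T : ℝ≥0∞) :=
    measurable_from_nat.comp (measurable_arrivalCount measurable_id measurable_const)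
  simp_rw [hsq]
  rw [lintegral_add_left hN, M.lintegral_arrivalCount T, lintegral_const_mul']
  · have h4 : ∫⁻ g, ∑ k ∈ Finset.range (arrivalCount g T), (k : ℝ≥0∞) ∂M.gapLaw =
        ENNReal.ofReal (M.lam * (M.lam * (T ^ 2 / 2))) := by
      rw [← h]
      refine lintegral_congr_ae ?_
      filter_upwards [M.ae_goodGaps] with g hg
      rw [hg.tsum_epoch_le]
      exact Finset.sum_congr rfl fun k _ => (hl g hg k).symm
    have h0 := M.lam_pos.le
    rw [h4, ← ENNReal.ofReal_ofNat 2, ← ENNReal.ofReal_mul (by norm_num),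
      ← ENNReal.ofReal_add (by positivity) (by positivity)]
    congr 1
    ring
  · simp

end VacationQueue

namespace VacationQueue

variable {E : Type*} [MeasurableSpace E] (M : VacationQueue E)

/-! ### A single cycle, from one service completion to the next -/

/-- The law of the inputs of a cycle other than the arrivals: the uniform variable that decides
about the vacation, the service time, and the seed of the vacation. -/
noncomputable def cycleLaw : Measure (ℝ × ℝ × E) :=
  (volume.restrict (Icc (0 : ℝ) 1)).prod (M.service.prod M.seed)

instance isProbabilityMeasure_restrict_Icc :
    IsProbabilityMeasure (volume.restrict (Icc (0 : ℝ) 1)) := ⟨by simp⟩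

instance : IsProbabilityMeasure M.cycleLaw := by
  unfold cycleLaw
  infer_instance

/-- The length of the vacation in a cycle (zero if there is none). -/
noncomputable def cycleVac (i : ℕ) (g : ℕ → ℝ) (y : ℝ × ℝ × E) : ℝ :=
  if y.1 < M.psi i then (M.vac i y.2.2 (arrivalEpoch g)).toReal else 0

/-- The length of a cycle. -/
noncomputable def cycleLength (i : ℕ) (g : ℕ → ℝ) (y : ℝ × ℝ × E) : ℝ :=
  M.cycleVac i g y + y.2.1

/-- The number of arrivals in a cycle. -/
noncomputable def cycleArrivals (i : ℕ) (g : ℕ → ℝ) (y : ℝ × ℝ × E) : ℕ :=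
  arrivalCount g (M.cycleLength i g y)

/-- The service time is nonnegative, the vacation is finite, and there is a customer to serve. -/
def ProperCycle (i : ℕ) (g : ℕ → ℝ) (y : ℝ × ℝ × E) : Prop :=
  0 ≤ y.2.1 ∧ (y.1 < M.psi i → M.vac i y.2.2 (arrivalEpoch g) < ∞) ∧
    1 ≤ i + M.cycleArrivals i g y

theorem measurable_vac_epoch {Ω : Type*} [MeasurableSpace Ω] (i : ℕ) {e : Ω → E}
    {g : Ω → ℕ → ℝ} (he : Measurable e) (hg : Measurable g) :
    Measurable fun ω => M.vac i (e ω) (arrivalEpoch (g ω)) :=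
  (M.vac_measurable i).comp (he.prodMk (measurable_arrivalEpoch_pi.comp hg))

theorem measurable_cycleVac {Ω : Type*} [MeasurableSpace Ω] (i : ℕ) {g : Ω → ℕ → ℝ}
    {y : Ω → ℝ × ℝ × E} (hg : Measurable g) (hy : Measurable y) :
    Measurable fun ω => M.cycleVac i (g ω) (y ω) :=
  Measurable.ite (measurableSet_lt hy.fst measurable_const)
    (M.measurable_vac_epoch i hy.snd.snd hg).ennreal_toReal measurable_const

theorem measurable_cycleLength {Ω : Type*} [MeasurableSpace Ω] (i : ℕ) {g : Ω → ℕ → ℝ}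
    {y : Ω → ℝ × ℝ × E} (hg : Measurable g) (hy : Measurable y) :
    Measurable fun ω => M.cycleLength i (g ω) (y ω) :=
  (M.measurable_cycleVac i hg hy).add hy.snd.fst

theorem measurable_cycleArrivals {Ω : Type*} [MeasurableSpace Ω] (i : ℕ) {g : Ω → ℕ → ℝ}
    {y : Ω → ℝ × ℝ × E} (hg : Measurable g) (hy : Measurable y) :
    Measurable fun ω => M.cycleArrivals i (g ω) (y ω) :=
  measurable_arrivalCount hg (M.measurable_cycleLength i hg hy)

theorem measurableSet_properCycle {Ω : Type*} [MeasurableSpace Ω] (i : ℕ) {g : Ω → ℕ → ℝ}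
    {y : Ω → ℝ × ℝ × E} (hg : Measurable g) (hy : Measurable y) :
    MeasurableSet {ω | M.ProperCycle i (g ω) (y ω)} := by
  refine (measurableSet_le measurable_const hy.snd.fst).inter (MeasurableSet.inter ?_ ?_)
  · have h : {ω | (y ω).1 < M.psi i → M.vac i (y ω).2.2 (arrivalEpoch (g ω)) < ∞} =
        {ω | (y ω).1 < M.psi i}ᶜ ∪ {ω | M.vac i (y ω).2.2 (arrivalEpoch (g ω)) < ∞} := by
      ext ω
      simp only [mem_union, mem_compl_iff, mem_ofPred_eq, imp_iff_not_or]
    have h' := (measurableSet_lt hy.fst (measurable_const (a := M.psi i))).compl.union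
      (measurableSet_lt (M.measurable_vac_epoch i hy.snd.snd hg) (measurable_const (a := ∞)))
    rw [← h] at h'
    exact h'
  · exact (measurable_const.add (M.measurable_cycleArrivals i hg hy))
      (measurableSet_Ici (a := (1 : ℕ)))

variable {M}

theorem cycleVac_nonneg (i : ℕ) (g : ℕ → ℝ) (y : ℝ × ℝ × E) : 0 ≤ M.cycleVac i g y := by
  unfold cycleVac
  split_ifs
  · exact ENNReal.toReal_nonneg
  · exact le_rfl

theorem ProperCycle.length_nonneg {i : ℕ} {g : ℕ → ℝ} {y : ℝ × ℝ × E}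
    (h : M.ProperCycle i g y) : 0 ≤ M.cycleLength i g y :=
  add_nonneg (cycleVac_nonneg i g y) h.1

theorem vac_congr {i : ℕ} {g g' : ℕ → ℝ} {e : E} (hg : GoodGaps g) (hg' : GoodGaps g')
    (h : M.vac i e (arrivalEpoch g) < ∞)
    (ha : AgreeUpTo (M.vac i e (arrivalEpoch g)).toReal (arrivalEpoch g) (arrivalEpoch g')) :
    M.vac i e (arrivalEpoch g') = M.vac i e (arrivalEpoch g) := by
  refine M.vac_nonanticipating i e _ _ hg.isArrivalPath hg'.isArrivalPath fun k hk => ha k ?_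
  rwa [ENNReal.ofReal_le_iff_le_toReal h.ne, ENNReal.ofReal_le_iff_le_toReal h.ne] at hk

/-- Service times are nonnegative, so the vacation ends within the cycle, and agreement up to the
end of the cycle activates nonanticipation of the vacation. -/
theorem ProperCycle.congr {i : ℕ} {g g' : ℕ → ℝ} {y : ℝ × ℝ × E} (h : M.ProperCycle i g y)
    (hg : GoodGaps g) (hg' : GoodGaps g')
    (ha : AgreeUpTo (M.cycleLength i g y) (arrivalEpoch g) (arrivalEpoch g')) :
    M.cycleLength i g' y = M.cycleLength i g y ∧ M.ProperCycle i g' y := by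
  have hv : y.1 < M.psi i →
      M.vac i y.2.2 (arrivalEpoch g') = M.vac i y.2.2 (arrivalEpoch g) := fun hu => by
    refine vac_congr hg hg' (h.2.1 hu) (ha.mono ?_)
    unfold cycleLength cycleVac
    rw [if_pos hu]
    linarith [h.1]
  have hl : M.cycleLength i g' y = M.cycleLength i g y := by
    unfold cycleLength cycleVac
    split_ifs with hu
    · rw [hv hu]
    · rfl
  refine ⟨hl, h.1, fun hu => hv hu ▸ h.2.1 hu, ?_⟩
  have := h.2.2
  unfold cycleArrivals at this ⊢
  rwa [hl, ha.arrivalCount_eq]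

theorem vacArrivals_eq {i : ℕ} {g : ℕ → ℝ} {e : E}
    (h : M.vac i e (arrivalEpoch g) < ∞) :
    M.vacArrivals i (g, e) = arrivalCount g (M.vac i e (arrivalEpoch g)).toReal := by
  unfold vacArrivals arrivalCount
  congr 1
  ext k
  simp only [mem_ofPred_eq, ENNReal.ofReal_le_iff_le_toReal h.ne]

variable (M)

theorem measurePreserving_seed : MeasurePreserving
    (fun x : (ℕ → ℝ) × (ℝ × ℝ × E) => (x.1, x.2.2.2)) (M.gapLaw.prod M.cycleLaw)
    (M.gapLaw.prod M.seed) :=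
  (MeasurePreserving.id M.gapLaw).prod (measurePreserving_snd.comp
    (measurePreserving_snd (μ := volume.restrict (Icc (0 : ℝ) 1))
      (ν := M.service.prod M.seed)))

theorem ae_cycleLaw_service_nonneg : ∀ᵐ y ∂M.cycleLaw, 0 ≤ y.2.1 :=
  (measurePreserving_fst.comp (measurePreserving_snd (μ := volume.restrict (Icc (0 : ℝ) 1))
    (ν := M.service.prod M.seed))).quasiMeasurePreserving.ae M.service_nonneg

theorem ae_cycleLaw_lt_one : ∀ᵐ y ∂M.cycleLaw, y.1 < 1 := by
  have h : ∀ᵐ u ∂(volume.restrict (Icc (0 : ℝ) 1)), u < 1 := by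
    rw [← restrict_Ico_eq_restrict_Icc]
    filter_upwards [ae_restrict_mem measurableSet_Ico] with u hu
    exact hu.2
  exact (measurePreserving_fst (μ := volume.restrict (Icc (0 : ℝ) 1))
    (ν := M.service.prod M.seed)).quasiMeasurePreserving.ae h

theorem ae_prod_goodGaps : ∀ᵐ x ∂(M.gapLaw.prod M.cycleLaw), GoodGaps x.1 :=
  measurePreserving_fst.quasiMeasurePreserving.ae M.ae_goodGaps

theorem measurable_vacArrivals (i : ℕ) : Measurable (M.vacArrivals i) :=
  measurable_ncard_setOf (A := fun k => {x : (ℕ → ℝ) × E |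
    ENNReal.ofReal (arrivalEpoch x.1 k) ≤ M.vac i x.2 (arrivalEpoch x.1)}) fun k =>
      measurableSet_le (by fun_prop) (M.measurable_vac_epoch i measurable_snd measurable_fst)

theorem ae_properCycle (hM : M.Admissible) (i : ℕ) :
    ∀ᵐ x ∂(M.gapLaw.prod M.cycleLaw), M.ProperCycle i x.1 x.2 := by
  have hb : ∀ᵐ x ∂(M.gapLaw.prod M.cycleLaw), 0 ≤ x.2.2.1 :=
    measurePreserving_snd.quasiMeasurePreserving.ae M.ae_cycleLaw_service_nonneg
  have hu : ∀ᵐ x ∂(M.gapLaw.prod M.cycleLaw), x.2.1 < 1 :=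
    measurePreserving_snd.quasiMeasurePreserving.ae M.ae_cycleLaw_lt_one
  have hv := M.measurePreserving_seed.quasiMeasurePreserving.ae (hM.vac_finite i)
  have h0 : ∀ᵐ x ∂(M.gapLaw.prod M.seed), M.vacArrivals 0 x ≠ 0 := by
    rw [ae_iff]
    simpa [alpha] using hM.alpha_zero_zero
  have hx := M.measurePreserving_seed.quasiMeasurePreserving.ae h0
  filter_upwards [hb, hu, hv, hx, M.ae_prod_goodGaps] with x hb hu hv hx hg
  refine ⟨hb, fun _ => hv, ?_⟩
  rcases i with _ | i
  -- From an empty system a vacation is almost surely taken, as ψ(0) = 1, and it brings at least one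
  -- customer, as P(X_0 = 0) = 0.
  · have hu' : x.2.1 < M.psi ((0 : ℕ) : ℝ) := by rwa [Nat.cast_zero, M.psi_zero]
    have h1 : (M.vac 0 x.2.2.2 (arrivalEpoch x.1)).toReal ≤ M.cycleLength 0 x.1 x.2 := by
      unfold cycleLength cycleVac
      rw [if_pos hu']
      linarith
    have h2 := hg.arrivalCount_mono h1
    have h3 : arrivalCount x.1 (M.vac 0 x.2.2.2 (arrivalEpoch x.1)).toReal ≠ 0 := by
      rwa [← vacArrivals_eq hv]
    have h4 : M.cycleArrivals 0 x.1 x.2 = arrivalCount x.1 (M.cycleLength 0 x.1 x.2) := rfl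
    omega
  · omega

/-! ### The embedded process -/

/-- The future epochs passed to the vacation are those of the shifted gaps, so each step is a single
cycle run on the arrivals seen from the current completion. -/
theorem completion_succ_fst (k : ℕ) (ω : (ℕ → ℝ) × (ℕ → ℝ × ℝ × E)) (n : ℕ) :
    (M.completion k ω (n + 1)).1 = (M.completion k ω n).1 +
      M.cycleLength (M.completion k ω n).2 (shiftGaps (M.completion k ω n).1 ω.1) (ω.2 n) := by
  have h : (fun l => arrivalEpoch ω.1 (arrivalCount ω.1 (M.completion k ω n).1 + l) -
      (M.completion k ω n).1) = arrivalEpoch (shiftGaps (M.completion k ω n).1 ω.1) :=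
    funext fun l => (arrivalEpoch_shiftGaps _ _ l).symm
  rw [completion, cycleLength, cycleVac]
  simp only [h]
  ring

theorem completion_succ_snd (k : ℕ) (ω : (ℕ → ℝ) × (ℕ → ℝ × ℝ × E)) (n : ℕ) :
    (M.completion k ω (n + 1)).2 = (M.completion k ω n).2 +
      (arrivalCount ω.1 (M.completion k ω (n + 1)).1 -
        arrivalCount ω.1 (M.completion k ω n).1) - 1 := rfl

/-- The first `n` cycles are proper. -/
def Proper (k : ℕ) (ω : (ℕ → ℝ) × (ℕ → ℝ × ℝ × E)) (n : ℕ) : Prop :=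
  ∀ m < n, M.ProperCycle (M.completion k ω m).2 (shiftGaps (M.completion k ω m).1 ω.1) (ω.2 m)

variable {M}

theorem proper_succ {k : ℕ} {ω : (ℕ → ℝ) × (ℕ → ℝ × ℝ × E)} {n : ℕ} :
    M.Proper k ω (n + 1) ↔ M.Proper k ω n ∧ M.ProperCycle (M.completion k ω n).2
      (shiftGaps (M.completion k ω n).1 ω.1) (ω.2 n) := by
  unfold Proper
  rw [Nat.forall_lt_succ_right]

theorem Proper.mono {k : ℕ} {ω : (ℕ → ℝ) × (ℕ → ℝ × ℝ × E)} {m n : ℕ} (h : M.Proper k ω n)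
    (hmn : m ≤ n) : M.Proper k ω m := fun l hl => h l (hl.trans_le hmn)

theorem Proper.epoch_le_succ {k : ℕ} {ω : (ℕ → ℝ) × (ℕ → ℝ × ℝ × E)} {n : ℕ}
    (h : M.Proper k ω (n + 1)) : (M.completion k ω n).1 ≤ (M.completion k ω (n + 1)).1 := by
  rw [completion_succ_fst]
  exact le_add_of_nonneg_right (proper_succ.1 h).2.length_nonneg

theorem Proper.epoch_nonneg {k : ℕ} {ω : (ℕ → ℝ) × (ℕ → ℝ × ℝ × E)} {n : ℕ}
    (h : M.Proper k ω n) : 0 ≤ (M.completion k ω n).1 := by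
  induction n with
  | zero => exact le_rfl
  | succ n ih => exact (ih (h.mono n.le_succ)).trans h.epoch_le_succ

theorem Proper.completion_snd {k : ℕ} {ω : (ℕ → ℝ) × (ℕ → ℝ × ℝ × E)} {n : ℕ}
    (hg : GoodGaps ω.1) (h : M.Proper k ω (n + 1)) :
    (M.completion k ω (n + 1)).2 + 1 = (M.completion k ω n).2 +
      M.cycleArrivals (M.completion k ω n).2 (shiftGaps (M.completion k ω n).1 ω.1) (ω.2 n) := by
  have h1 := (proper_succ.1 h).2
  have h2 := h1.2.2
  rw [completion_succ_snd, completion_succ_fst, hg.arrivalCount_add _ h1.length_nonneg]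
  unfold cycleArrivals at h2 ⊢
  omega

/-- Conservation of customers. Properness guarantees someone to serve, so the truncated subtractions
in `completion` are genuine. -/
theorem Proper.balance {k : ℕ} {ω : (ℕ → ℝ) × (ℕ → ℝ × ℝ × E)} {n : ℕ}
    (hg : GoodGaps ω.1) (h : M.Proper k ω n) :
    (M.completion k ω n).2 + n = k + arrivalCount ω.1 (M.completion k ω n).1 := by
  induction n with
  | zero => simp [completion, hg.arrivalCount_of_nonpos le_rfl]
  | succ n ih =>
    have h1 := h.completion_snd hg
    have h2 := ih (h.mono n.le_succ)
    rw [completion_succ_fst, hg.arrivalCount_add _ (proper_succ.1 h).2.length_nonneg]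
    unfold cycleArrivals at h1
    omega

/-- For fixed inputs `w`, completion epochs are stopping times of the arrival process: the cycles
inherit nonanticipation one after another. -/
theorem Proper.congr {k : ℕ} {g g' : ℕ → ℝ} {w : ℕ → ℝ × ℝ × E} {n : ℕ}
    (hg : GoodGaps g) (hg' : GoodGaps g') (h : M.Proper k (g, w) n)
    (ha : AgreeUpTo (M.completion k (g, w) n).1 (arrivalEpoch g) (arrivalEpoch g')) :
    M.completion k (g', w) n = M.completion k (g, w) n ∧ M.Proper k (g', w) n := by
  induction n with
  | zero => exact ⟨rfl, fun m hm => absurd hm (Nat.not_lt_zero m)⟩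
  | succ n ih =>
    obtain ⟨h1, h2⟩ := ih (h.mono n.le_succ) (ha.mono h.epoch_le_succ)
    have hp := (proper_succ.1 h).2
    have hlen := completion_succ_fst M k (g, w) n
    have ha' := ha
    rw [hlen] at ha'
    obtain ⟨h3, h4⟩ := hp.congr (hg.shift _) (hg'.shift _) (ha'.shiftGaps hp.length_nonneg)
    have hfst : (M.completion k (g', w) (n + 1)).1 = (M.completion k (g, w) (n + 1)).1 := by
      rw [completion_succ_fst, completion_succ_fst, h1]
      exact congrArg _ h3
    refine ⟨Prod.ext hfst ?_, proper_succ.2 ⟨h2, by rw [h1]; exact h4⟩⟩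
    rw [completion_succ_snd, completion_succ_snd, hfst, h1]
    change _ + (arrivalCount g' _ - arrivalCount g' _) - 1 = _ + (arrivalCount g _ -
      arrivalCount g _) - 1
    rw [ha.arrivalCount_eq, (ha.mono h.epoch_le_succ).arrivalCount_eq]

theorem completion_splice (k : ℕ) (g : ℕ → ℝ) (w w' : ℕ → ℝ × ℝ × E) {m n : ℕ} (hmn : m ≤ n) :
    M.completion k (g, splice n w w') m = M.completion k (g, w) m := by
  induction m with
  | zero => rfl
  | succ m ih =>
    have hw : splice n w w' m = w m := by
      have : m < n := hmn
      simp [splice, this]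
    simp only [completion, ih (by omega), hw]

theorem proper_splice (k : ℕ) (g : ℕ → ℝ) (w w' : ℕ → ℝ × ℝ × E) (n : ℕ) :
    M.Proper k (g, splice n w w') n ↔ M.Proper k (g, w) n := by
  refine forall₂_congr fun m hm => ?_
  have hw : splice n w w' m = w m := by simp [splice, hm]
  simp only [completion_splice k g w w' hm.le, hw]

variable (M)

theorem measurable_completion (k n : ℕ) :
    Measurable fun ω : (ℕ → ℝ) × (ℕ → ℝ × ℝ × E) => M.completion k ω n := by
  induction n with
  | zero => exact measurable_const
  | succ n ih =>
    have h1 : Measurable fun ω : (ℕ → ℝ) × (ℕ → ℝ × ℝ × E) => (M.completion k ω (n + 1)).1 := by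
      simp_rw [completion_succ_fst]
      refine ih.fst.add (measurable_apply_nat (f := fun i ω => M.cycleLength i
        (shiftGaps (M.completion k ω n).1 ω.1) (ω.2 n)) (fun i => ?_) ih.snd)
      exact M.measurable_cycleLength i (measurable_shiftGaps ih.fst measurable_fst) (by fun_prop)
    refine h1.prodMk ?_
    have h2 := measurable_arrivalCount (measurable_fst (α := ℕ → ℝ) (β := ℕ → ℝ × ℝ × E)) h1
    have h3 := measurable_arrivalCount (measurable_fst (α := ℕ → ℝ) (β := ℕ → ℝ × ℝ × E)) ih.fst
    exact (ih.snd.add (h2.sub h3)).sub measurable_const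

theorem measurableSet_proper (k n : ℕ) :
    MeasurableSet {ω : (ℕ → ℝ) × (ℕ → ℝ × ℝ × E) | M.Proper k ω n} := by
  have h : {ω : (ℕ → ℝ) × (ℕ → ℝ × ℝ × E) | M.Proper k ω n} = ⋂ m, ⋂ (_ : m < n), {ω |
      M.ProperCycle (M.completion k ω m).2 (shiftGaps (M.completion k ω m).1 ω.1) (ω.2 m)} := by
    ext ω
    simp [Proper]
  rw [h]
  refine MeasurableSet.iInter fun m => MeasurableSet.iInter fun _ => ?_
  have h1 : {ω : (ℕ → ℝ) × (ℕ → ℝ × ℝ × E) |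
      M.ProperCycle (M.completion k ω m).2 (shiftGaps (M.completion k ω m).1 ω.1) (ω.2 m)} =
      ⋃ i, ({ω | (M.completion k ω m).2 = i} ∩
        {ω | M.ProperCycle i (shiftGaps (M.completion k ω m).1 ω.1) (ω.2 m)}) := by
    ext ω
    simp
  rw [h1]
  refine MeasurableSet.iUnion fun i => ?_
  exact ((M.measurable_completion k m).snd (measurableSet_singleton i)).inter
    (M.measurableSet_properCycle i (measurable_shiftGaps (M.measurable_completion k m).fst
      measurable_fst) (by fun_prop))

theorem inputLaw_eq : M.inputLaw = M.gapLaw.prod (Measure.infinitePi fun _ => M.cycleLaw) := rfl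

instance : IsProbabilityMeasure M.inputLaw := M.inputLaw_prob

/-- The event that the first `n` cycles are proper and the `n`-th service completion is at an
epoch in `S` and leaves `i` customers. -/
def completionEvent (k n i : ℕ) (S : Set ℝ) : Set ((ℕ → ℝ) × (ℕ → ℝ × ℝ × E)) :=
  {ω | M.Proper k ω n ∧ (M.completion k ω n).2 = i ∧ (M.completion k ω n).1 ∈ S}

theorem measurableSet_completionEvent (k n i : ℕ) {S : Set ℝ} (hS : MeasurableSet S) :
    MeasurableSet (M.completionEvent k n i S) :=
  (M.measurableSet_proper k n).inter
    (((M.measurable_completion k n).snd (measurableSet_singleton i)).inter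
      ((M.measurable_completion k n).fst hS))

/-- After a service completion the queue starts afresh. -/
theorem lintegral_completionEvent (k n i : ℕ) {S : Set ℝ} (hS : MeasurableSet S)
    {G : (ℕ → ℝ) × (ℝ × ℝ × E) → ℝ≥0∞} (hG : Measurable G) :
    ∫⁻ ω, (M.completionEvent k n i S).indicator 1 ω *
        G (shiftGaps (M.completion k ω n).1 ω.1, ω.2 n) ∂M.inputLaw =
      M.inputLaw (M.completionEvent k n i S) * ∫⁻ x, G x ∂(M.gapLaw.prod M.cycleLaw) := by
  have hA := M.measurableSet_completionEvent k n i hS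
  set A := M.completionEvent k n i S with hAdef
  have hI : Measurable (A.indicator (1 : (ℕ → ℝ) × (ℕ → ℝ × ℝ × E) → ℝ≥0∞)) := measurable_one.indicator hA
  have hmain : Measurable fun ω : (ℕ → ℝ) × (ℕ → ℝ × ℝ × E) => A.indicator (1 : (ℕ → ℝ) × (ℕ → ℝ × ℝ × E) → ℝ≥0∞) ω *
      G (shiftGaps (M.completion k ω n).1 ω.1, ω.2 n) :=
    hI.mul (hG.comp ((measurable_shiftGaps (M.measurable_completion k n).fst
      measurable_fst).prodMk (by fun_prop)))
  have hγ : Measurable fun y : ℝ × ℝ × E => ∫⁻ g, G (g, y) ∂M.gapLaw := hG.lintegral_prod_left'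
  have hh : Measurable fun w => ∫⁻ g, A.indicator (1 : (ℕ → ℝ) × (ℕ → ℝ × ℝ × E) → ℝ≥0∞) (g, w) ∂M.gapLaw :=
    hI.lintegral_prod_left'
  rw [inputLaw_eq, lintegral_prod_symm' _ hmain]
  -- With the other inputs frozen, this is the strong Markov property at the `n`-th completion
  -- epoch.
  have hsm : ∀ w, ∫⁻ g, A.indicator (1 : (ℕ → ℝ) × (ℕ → ℝ × ℝ × E) → ℝ≥0∞) (g, w) *
      G (shiftGaps (M.completion k (g, w) n).1 g, w n) ∂M.gapLaw =
      (∫⁻ g, A.indicator (1 : (ℕ → ℝ) × (ℕ → ℝ × ℝ × E) → ℝ≥0∞) (g, w) ∂M.gapLaw) * ∫⁻ g, G (g, w n) ∂M.gapLaw := by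
    intro w
    refine M.lintegral_strongMarkov (τ := fun g => (M.completion k (g, w) n).1)
      (H := fun g => A.indicator (1 : (ℕ → ℝ) × (ℕ → ℝ × ℝ × E) → ℝ≥0∞) (g, w)) (G := fun g => G (g, w n))
      ((M.measurable_completion k n).fst.comp measurable_prodMk_right)
      (hI.comp measurable_prodMk_right) (hG.comp measurable_prodMk_right) ?_ ?_
    · intro g hg
      have : (g, w) ∈ A := mem_of_indicator_ne_zero hg
      exact this.1.epoch_nonneg
    · intro g g' hg hg' hne ha
      have hmem : (g, w) ∈ A := mem_of_indicator_ne_zero hne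
      obtain ⟨h1, h2⟩ := hmem.1.congr hg hg' ha
      refine ⟨congrArg Prod.fst h1, ?_⟩
      have hmem' : (g', w) ∈ A := ⟨h2, by rw [h1]; exact hmem.2.1, by rw [h1]; exact hmem.2.2⟩
      rw [indicator_of_mem hmem, indicator_of_mem hmem']
      rfl
  -- The event reads only the entries of `w` before `n`, and `G` reads only entry `n`; splicing at
  -- `n` makes the two independent.
  have hAw : ∀ g w w', A.indicator (1 : (ℕ → ℝ) × (ℕ → ℝ × ℝ × E) → ℝ≥0∞) (g, splice n w w') =
      A.indicator (1 : (ℕ → ℝ) × (ℕ → ℝ × ℝ × E) → ℝ≥0∞) (g, w) := by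
    intro g w w'
    have : (g, splice n w w') ∈ A ↔ (g, w) ∈ A := by
      simp only [hAdef, completionEvent, mem_ofPred_eq, proper_splice,
        completion_splice k g w w' le_rfl]
    by_cases hm : (g, w) ∈ A
    · rw [indicator_of_mem hm, indicator_of_mem (this.2 hm)]
      rfl
    · rw [indicator_of_notMem hm, indicator_of_notMem (fun h => hm (this.1 h))]
  have hwn : ∀ w w' : ℕ → ℝ × ℝ × E, splice n w w' n = w' 0 := fun w w' => by simp [splice]
  simp_rw [hsm]
  have hprod : Measurable fun w : ℕ → ℝ × ℝ × E =>
      (∫⁻ g, A.indicator (1 : (ℕ → ℝ) × (ℕ → ℝ × ℝ × E) → ℝ≥0∞) (g, w) ∂M.gapLaw) *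
        ∫⁻ g, G (g, w n) ∂M.gapLaw := hh.mul (hγ.comp (measurable_pi_apply n))
  rw [lintegral_splice _ n hprod]
  simp only [hAw, hwn]
  have hA2 : M.inputLaw A = ∫⁻ w, (∫⁻ g, A.indicator (1 : (ℕ → ℝ) × (ℕ → ℝ × ℝ × E) → ℝ≥0∞) (g, w) ∂M.gapLaw)
      ∂(Measure.infinitePi fun _ : ℕ => M.cycleLaw) := by
    rw [← lintegral_prod_symm' _ hI, ← inputLaw_eq, lintegral_indicator_one hA]
  rw [← inputLaw_eq, hA2, lintegral_prod_symm' _ hG, ← lintegral_mul_const _ hh]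
  refine lintegral_congr fun w => ?_
  have hγ0 : Measurable fun y : ℕ → ℝ × ℝ × E => ∫⁻ g, G (g, y 0) ∂M.gapLaw :=
    hγ.comp (measurable_pi_apply 0)
  rw [lintegral_const_mul _ hγ0,
    lintegral_infinitePi_eval _ 0 hγ]

/-- By the restart property, the next cycle is improper from state `i` with the probability of a
single improper cycle, which is zero; there are countably many states. -/
theorem ae_proper (hM : M.Admissible) (k : ℕ) :
    ∀ᵐ ω ∂M.inputLaw, ∀ n, M.Proper k ω n := by
  refine ae_all_iff.2 fun n => ?_
  induction n with
  | zero => exact ae_of_all _ fun ω m hm => absurd hm (Nat.not_lt_zero m)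
  | succ n ih =>
    have hi : ∀ i, ∀ᵐ ω ∂M.inputLaw, ω ∈ M.completionEvent k n i univ →
        M.ProperCycle i (shiftGaps (M.completion k ω n).1 ω.1) (ω.2 n) := by
      intro i
      have hB : MeasurableSet {x : (ℕ → ℝ) × (ℝ × ℝ × E) | M.ProperCycle i x.1 x.2}ᶜ :=
        (M.measurableSet_properCycle i measurable_fst measurable_snd).compl
      have h := M.lintegral_completionEvent k n i MeasurableSet.univ
        (measurable_one.indicator hB)
      have h0 : (M.gapLaw.prod M.cycleLaw)
          {x : (ℕ → ℝ) × (ℝ × ℝ × E) | M.ProperCycle i x.1 x.2}ᶜ = 0 := M.ae_properCycle hM i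
      rw [lintegral_indicator_one hB, h0, mul_zero, lintegral_eq_zero_iff] at h
      · filter_upwards [h] with ω hω hmem
        by_contra hnot
        rw [indicator_of_mem hmem, indicator_of_mem] at hω
        · simp at hω
        · exact hnot
      · exact (measurable_one.indicator
          (M.measurableSet_completionEvent k n i MeasurableSet.univ)).mul
          ((measurable_one.indicator hB).comp ((measurable_shiftGaps
            (M.measurable_completion k n).fst measurable_fst).prodMk (by fun_prop)))
    filter_upwards [ih, ae_all_iff.2 hi] with ω h1 h2
    exact proper_succ.2 ⟨h1, h2 _ ⟨h1, rfl, mem_univ _⟩⟩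

end VacationQueue

/-! ### Level crossings -/

theorem mem_iff_lt_ncard {P : ℕ → Prop} (hP : ∀ m n, m ≤ n → P n → P m) {B : ℕ}
    (hB : ∀ n, P n → n < B) (n : ℕ) : P n ↔ n < {n | P n}.ncard := by
  classical
  have hex : ∃ m, ¬ P m := ⟨B, fun h => lt_irrefl _ (hB _ h)⟩
  have hset : {n | P n} = Iio (Nat.find hex) := by
    ext j
    rw [mem_ofPred_eq, mem_Iio]
    refine ⟨fun hj => ?_, fun hj => not_not.1 (Nat.find_min hex hj)⟩
    by_contra hc
    exact Nat.find_spec hex (hP _ _ (not_lt.1 hc) hj)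
  have hc : {n | P n}.ncard = Nat.find hex := by
    rw [hset, ← Nat.card_coe_set_eq]
    simp
  rw [hc, ← mem_Iio, ← hset, mem_ofPred_eq]

theorem ncard_setOf_lt_epoch {g : ℕ → ℝ} (hg : GoodGaps g) (m : ℕ) :
    {l | arrivalEpoch g l < arrivalEpoch g m}.ncard = m := by
  have : {l | arrivalEpoch g l < arrivalEpoch g m} = Iio m := by
    ext l
    rw [mem_ofPred_eq, mem_Iio, hg.strictMono.lt_iff_lt]
  rw [this, ← Nat.card_coe_set_eq]
  simp

/-- For a sequence that goes down by steps of size one, crossings of a level and visits to it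
differ by the number of net upward crossings. -/
theorem card_crossings (I : ℕ → ℕ) (hI : ∀ n, I n ≤ I (n + 1) + 1) (j K : ℕ) :
    ((Finset.range K).filter fun c => I c ≤ j ∧ j ≤ I (c + 1)).card + (if j < I 0 then 1 else 0) =
      ((Finset.range K).filter fun c => I (c + 1) = j).card + (if j < I K then 1 else 0) := by
  induction K with
  | zero => simp
  | succ K ih =>
    rw [Finset.range_add_one, Finset.filter_insert, Finset.filter_insert]
    have h := hI K
    have hn1 : K ∉ (Finset.range K).filter fun c => I c ≤ j ∧ j ≤ I (c + 1) := by simp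
    have hn2 : K ∉ (Finset.range K).filter fun c => I (c + 1) = j := by simp
    split_ifs at ih ⊢ <;> try simp only [Finset.card_insert_of_notMem hn1,
      Finset.card_insert_of_notMem hn2]
    all_goals omega

theorem card_visits_succ (I : ℕ → ℕ) (j K : ℕ) :
    ((Finset.range K).filter fun c => I (c + 1) = j).card + (if I 0 = j then 1 else 0) =
      ((Finset.range K).filter fun c => I c = j).card + (if I K = j then 1 else 0) := by
  induction K with
  | zero => simp
  | succ K ih =>
    rw [Finset.range_add_one, Finset.filter_insert, Finset.filter_insert]
    have hn1 : K ∉ (Finset.range K).filter fun c => I (c + 1) = j := by simp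
    have hn2 : K ∉ (Finset.range K).filter fun c => I c = j := by simp
    split_ifs at ih ⊢ <;> try simp only [Finset.card_insert_of_notMem hn1,
      Finset.card_insert_of_notMem hn2]
    all_goals omega

section Crossing

variable {g : ℕ → ℝ} {D : ℕ → ℝ} {I : ℕ → ℕ} {k : ℕ}

/-- Every completion uses up an initial or arrived customer, so only finitely many occur before `t`,
and `ncard` is a true count. -/
theorem lt_ncard_departures (hg : GoodGaps g) (hD : Monotone D)
    (hI : ∀ n, I n + n = k + arrivalCount g (D n)) (t : ℝ) (n : ℕ) :
    D (n + 1) < t ↔ n < {n | D (n + 1) < t}.ncard := by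
  refine mem_iff_lt_ncard (P := fun n => D (n + 1) < t) (fun m n hmn h => (hD (by omega)).trans_lt h)
    (B := k + arrivalCount g t) (fun n hn => ?_) n
  have h1 := hI (n + 1)
  have h2 := hg.arrivalCount_mono hn.le
  omega

theorem exists_departures_le (hg : GoodGaps g) (hD : Monotone D)
    (hI : ∀ n, I n + n = k + arrivalCount g (D n)) (T : ℝ) :
    ∃ K, ∀ n, D n ≤ T ↔ n < K := by
  refine ⟨_, mem_iff_lt_ncard (P := fun n => D n ≤ T) (fun m n hmn h => (hD hmn).trans h)
    (B := k + arrivalCount g T + 1) (fun n hn => ?_)⟩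
  have h1 := hI n
  have h2 := hg.arrivalCount_mono hn
  omega

/-- The arrivals that find `j` customers correspond to the crossings of level `j`. -/
theorem card_arrivals_le (hg : GoodGaps g) (hD : Monotone D) (hD0 : D 0 = 0)
    (hI : ∀ n, I n + n = k + arrivalCount g (D n)) {T : ℝ} {K : ℕ} (hK : ∀ n, D n ≤ T ↔ n < K)
    (j : ℕ) :
    ((Finset.range (arrivalCount g T)).filter fun m =>
        k + m = j + {n | D (n + 1) < arrivalEpoch g m}.ncard).card ≤
      ((Finset.range K).filter fun c => I c ≤ j ∧ j ≤ I (c + 1)).card := by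
  -- Send an arrival to the cycle `c` containing it. Nobody leaves before the end of a cycle, so the
  -- state climbs by ones from `I c` to `I (c + 1) + 1`, and at most one arrival of the cycle finds
  -- `j`.
  refine Finset.card_le_card_of_injOn (fun m => {n | D (n + 1) < arrivalEpoch g m}.ncard) ?_ ?_
  · intro m hm
    simp only [Finset.coe_filter, Finset.mem_range, mem_ofPred_eq] at hm ⊢
    obtain ⟨hmT, hmj⟩ := hm
    set c := {n | D (n + 1) < arrivalEpoch g m}.ncard with hc
    have hiff := lt_ncard_departures hg hD hI (arrivalEpoch g m)
    have h1 : D c < arrivalEpoch g m := by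
      rcases hcc : c with _ | c'
      · rw [hD0]
        exact hg.epoch_pos m
      · exact (hiff c').2 (by omega)
    have h2 : arrivalEpoch g m ≤ D (c + 1) := not_lt.1 fun h => lt_irrefl _ ((hiff c).1 h)
    have h3 := hg.lt_epoch_iff.1 h1
    have h4 := hg.epoch_le_iff.1 h2
    have h5 := hI c
    have h6 := hI (c + 1)
    refine ⟨(hK c).1 (h1.le.trans (hg.epoch_le_iff.2 hmT)), ?_, ?_⟩ <;> omega
  · intro m hm m' hm' h
    simp only [Finset.coe_filter, Finset.mem_range, mem_ofPred_eq] at hm hm' h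
    omega

/-- Conversely, a completed cycle `c` that crosses level `j` contains the arrival with index `j + c
- k`, which finds `j`. The shift from `K` to `K + 1` excludes the cycle still in progress at `T`. -/
theorem card_crossings_le (hg : GoodGaps g) (hD : Monotone D)
    (hI : ∀ n, I n + n = k + arrivalCount g (D n)) {T : ℝ} {K : ℕ}
    (hK : ∀ n, D n ≤ T ↔ n < K + 1) (j : ℕ) :
    ((Finset.range K).filter fun c => I c ≤ j ∧ j ≤ I (c + 1)).card ≤
      ((Finset.range (arrivalCount g T)).filter fun m =>
        k + m = j + {n | D (n + 1) < arrivalEpoch g m}.ncard).card := by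
  refine Finset.card_le_card_of_injOn (fun c => j + c - k) ?_ ?_
  · intro c hc
    simp only [Finset.coe_filter, Finset.mem_range, mem_ofPred_eq] at hc ⊢
    obtain ⟨hcK, h1, h2⟩ := hc
    have h5 := hI c
    have h6 := hI (c + 1)
    obtain ⟨m, hm⟩ : ∃ m, j + c = k + m := ⟨j + c - k, by omega⟩
    rw [show j + c - k = m by omega]
    have h3 : D c < arrivalEpoch g m := hg.lt_epoch_iff.2 (by omega)
    have h4 : arrivalEpoch g m ≤ D (c + 1) := hg.epoch_le_iff.2 (by omega)
    have hiff := lt_ncard_departures hg hD hI (arrivalEpoch g m)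
    refine ⟨hg.epoch_le_iff.1 (h4.trans ((hK _).2 (by omega))), ?_⟩
    have h7 : ¬ c < {n | D (n + 1) < arrivalEpoch g m}.ncard := fun h =>
      absurd ((hiff c).2 h) (not_lt.2 h4)
    have h8 : c ≤ {n | D (n + 1) < arrivalEpoch g m}.ncard := by
      rcases c with _ | c
      · exact Nat.zero_le _
      · exact (hiff c).1 h3
    omega
  · intro c hc c' hc' h
    simp only [Finset.coe_filter, Finset.mem_range, mem_ofPred_eq] at hc hc' h
    have h5 := hI c
    have h6 := hI c'
    omega

/-- Arrivals that find `j`, crossings of `j` and visits to `j` differ only through the initial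
state, the last state and the unfinished cycle. The constant 2 covers these; all that matters later
is that it does not depend on `T`. -/
theorem arrivals_visits (hg : GoodGaps g) (hD : Monotone D) (hD0 : D 0 = 0)
    (hI : ∀ n, I n + n = k + arrivalCount g (D n)) {T : ℝ} (hT : 0 ≤ T) {K : ℕ}
    (hK : ∀ n, D n ≤ T ↔ n < K) (j : ℕ) :
    ((Finset.range (arrivalCount g T)).filter fun m =>
        k + m = j + {n | D (n + 1) < arrivalEpoch g m}.ncard).card ≤
      ((Finset.range K).filter fun c => I c = j).card + 2 ∧
    ((Finset.range K).filter fun c => I c = j).card ≤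
      ((Finset.range (arrivalCount g T)).filter fun m =>
        k + m = j + {n | D (n + 1) < arrivalEpoch g m}.ncard).card + 2 := by
  obtain ⟨K, rfl⟩ : ∃ K', K = K' + 1 := ⟨K - 1, by
    have := (hK 0).1 (hD0.le.trans hT)
    omega⟩
  have hstep : ∀ n, I n ≤ I (n + 1) + 1 := fun n => by
    have h1 := hI n
    have h2 := hI (n + 1)
    have h3 := hg.arrivalCount_mono (hD n.le_succ)
    simp only [Nat.succ_eq_add_one] at h3
    omega
  have h1 := card_arrivals_le hg hD hD0 hI hK j
  have h2 := card_crossings_le hg hD hI hK j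
  have h3 := card_crossings I hstep j (K + 1)
  have h4 := card_crossings I hstep j K
  have h5 := card_visits_succ I j (K + 1)
  have h6 := card_visits_succ I j K
  have h7 : ((Finset.range (K + 1)).filter fun c => I c = j).card ≤
      ((Finset.range K).filter fun c => I c = j).card + 1 := by
    rw [Finset.range_add_one, Finset.filter_insert]
    split_ifs
    · exact Finset.card_insert_le _ _
    · omega
  split_ifs at h3 h4 h5 h6 <;> omega

end Crossing

/-! ### From time averages to a stationary law of the embedded chain -/

namespace VacationQueue

variable {E : Type*} [MeasurableSpace E] (M : VacationQueue E)

/-- A sample point with positive interarrival times and proper cycles. -/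
def GoodPath (k : ℕ) (ω : (ℕ → ℝ) × (ℕ → ℝ × ℝ × E)) : Prop :=
  GoodGaps ω.1 ∧ ∀ n, M.Proper k ω n

theorem ae_goodPath (hM : M.Admissible) (k : ℕ) : ∀ᵐ ω ∂M.inputLaw, M.GoodPath k ω := by
  have h : ∀ᵐ ω ∂M.inputLaw, GoodGaps ω.1 :=
    (measurePreserving_fst (μ := M.gapLaw)
      (ν := Measure.infinitePi fun _ : ℕ => M.cycleLaw)).quasiMeasurePreserving.ae M.ae_goodGaps
  filter_upwards [h, M.ae_proper hM k] with ω h1 h2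
  exact ⟨h1, h2⟩

variable {M}

theorem GoodPath.monotone {k : ℕ} {ω : (ℕ → ℝ) × (ℕ → ℝ × ℝ × E)} (h : M.GoodPath k ω) :
    Monotone fun n => (M.completion k ω n).1 :=
  monotone_nat_of_le_succ fun n => (h.2 (n + 1)).epoch_le_succ

theorem GoodPath.balance {k : ℕ} {ω : (ℕ → ℝ) × (ℕ → ℝ × ℝ × E)} (h : M.GoodPath k ω) (n : ℕ) :
    (M.completion k ω n).2 + n = k + arrivalCount ω.1 (M.completion k ω n).1 :=
  (h.2 n).balance h.1

variable (M)

/-- The indicator of the event that just before time `t` there are `j` customers. -/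
noncomputable def stateBefore (k j : ℕ) (t : ℝ) (ω : (ℕ → ℝ) × (ℕ → ℝ × ℝ × E)) : ℝ≥0∞ :=
  if k + {m | arrivalEpoch ω.1 m < t}.ncard =
    j + {n | M.Proper k ω (n + 1) ∧ (M.completion k ω (n + 1)).1 < t}.ncard then 1 else 0

theorem measurable_stateBefore {Ω : Type*} [MeasurableSpace Ω] (k j : ℕ) {t : Ω → ℝ}
    {f : Ω → (ℕ → ℝ) × (ℕ → ℝ × ℝ × E)} (ht : Measurable t) (hf : Measurable f) :
    Measurable fun x => M.stateBefore k j (t x) (f x) := by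
  have h1 : Measurable fun x => k + {m | arrivalEpoch (f x).1 m < t x}.ncard :=
    measurable_const.add (measurable_ncard_setOf (A := fun m => {x |
      arrivalEpoch (f x).1 m < t x}) fun m => measurableSet_lt (by fun_prop) ht)
  have h2 : Measurable fun x =>
      j + {n | M.Proper k (f x) (n + 1) ∧ (M.completion k (f x) (n + 1)).1 < t x}.ncard :=
    measurable_const.add (measurable_ncard_setOf (A := fun n => {x |
      M.Proper k (f x) (n + 1) ∧ (M.completion k (f x) (n + 1)).1 < t x}) fun n =>
        (hf (M.measurableSet_proper k (n + 1))).inter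
          (measurableSet_lt ((M.measurable_completion k (n + 1)).fst.comp hf) ht))
  exact Measurable.ite (measurableSet_eq_fun h1 h2) measurable_const measurable_const

/-- Properness is part of the departure count in `stateBefore` because `Proper.congr` transfers a
completion epoch between paths only after proper cycles. Thus predictability holds for all good
gaps, not just almost surely. -/
theorem stateBefore_predictable (k j : ℕ) (w : ℕ → ℝ × ℝ × E) {g g' : ℕ → ℝ} {t : ℝ}
    (hg : GoodGaps g) (hg' : GoodGaps g')
    (ha : ∀ m, arrivalEpoch g m < t ∨ arrivalEpoch g' m < t →
      arrivalEpoch g' m = arrivalEpoch g m) :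
    M.stateBefore k j t (g', w) = M.stateBefore k j t (g, w) := by
  have hsub : ∀ g g' : ℕ → ℝ, GoodGaps g → GoodGaps g' →
      (∀ m, arrivalEpoch g m < t ∨ arrivalEpoch g' m < t →
        arrivalEpoch g' m = arrivalEpoch g m) → ∀ n,
      (M.Proper k (g, w) (n + 1) ∧ (M.completion k (g, w) (n + 1)).1 < t) →
      (M.Proper k (g', w) (n + 1) ∧ (M.completion k (g', w) (n + 1)).1 < t) := by
    intro g g' hg hg' ha n ⟨h1, h2⟩
    obtain ⟨h3, h4⟩ := h1.congr hg hg' fun m hm =>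
      ha m (hm.imp (fun h => h.trans_lt h2) fun h => h.trans_lt h2)
    exact ⟨h4, by rw [h3]; exact h2⟩
  have h1 : {m | arrivalEpoch g' m < t} = {m | arrivalEpoch g m < t} := by
    ext m
    simp only [mem_ofPred_eq]
    exact ⟨fun h => ha m (Or.inr h) ▸ h, fun h => (ha m (Or.inl h)).symm ▸ h⟩
  have h2 : {n | M.Proper k (g', w) (n + 1) ∧ (M.completion k (g', w) (n + 1)).1 < t} =
      {n | M.Proper k (g, w) (n + 1) ∧ (M.completion k (g, w) (n + 1)).1 < t} := by
    ext n
    exact ⟨hsub g' g hg' hg (fun m hm => (ha m hm.symm).symm) n, hsub g g' hg hg' ha n⟩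
  unfold stateBefore
  simp only [h1, h2]

theorem lintegral_arrivals_stateBefore (k j : ℕ) (T : ℝ) :
    ∫⁻ ω, ∑' m, (if arrivalEpoch ω.1 m ≤ T then M.stateBefore k j (arrivalEpoch ω.1 m) ω else 0)
        ∂M.inputLaw =
      ENNReal.ofReal M.lam * ∫⁻ ω, (∫⁻ t in Ioc 0 T, M.stateBefore k j t ω) ∂M.inputLaw := by
  have hm1 : Measurable fun ω : (ℕ → ℝ) × (ℕ → ℝ × ℝ × E) => ∑' m,
      (if arrivalEpoch ω.1 m ≤ T then M.stateBefore k j (arrivalEpoch ω.1 m) ω else 0) :=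
    Measurable.tsum fun m => Measurable.ite (measurableSet_le (by fun_prop) measurable_const)
      (M.measurable_stateBefore k j (by fun_prop) measurable_id) measurable_const
  have hm2 : Measurable fun ω => ∫⁻ t in Ioc 0 T, M.stateBefore k j t ω :=
    (M.measurable_stateBefore k j measurable_snd measurable_fst).lintegral_prod_right'
  have hm3 : Measurable fun w => ∫⁻ g, (∫⁻ t in Ioc 0 T, M.stateBefore k j t (g, w))
      ∂M.gapLaw := hm2.lintegral_prod_left'
  rw [inputLaw_eq, lintegral_prod_symm' _ hm1, lintegral_prod_symm' _ hm2,
    ← lintegral_const_mul _ hm3]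
  refine lintegral_congr fun w => ?_
  exact M.lintegral_sum_arrivals (Z := fun t g => M.stateBefore k j t (g, w))
    (M.measurable_stateBefore k j measurable_fst (by fun_prop))
    (fun g g' t hg hg' ha => M.stateBefore_predictable k j w hg hg' ha) T

/-- The expected number of service completions up to time `T` that leave `j` customers. -/
noncomputable def visits (k j : ℕ) (T : ℝ) : ℝ≥0∞ :=
  ∑' n, M.inputLaw (M.completionEvent k n j (Iic T))

theorem visits_eq_lintegral (k j : ℕ) (T : ℝ) :
    M.visits k j T =
      ∫⁻ ω, ∑' n, (M.completionEvent k n j (Iic T)).indicator 1 ω ∂M.inputLaw := by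
  have h := fun n => M.measurableSet_completionEvent k n j (measurableSet_Iic (a := T))
  rw [lintegral_tsum fun n => (measurable_one.indicator (h n)).aemeasurable]
  exact tsum_congr fun n => (lintegral_indicator_one (h n)).symm

theorem tsum_range_filter {f : ℕ → ℝ≥0∞} {K : ℕ} {P : ℕ → Prop} [DecidablePred P]
    (hf : ∀ n, f n = if n < K ∧ P n then 1 else 0) :
    ∑' n, f n = (((Finset.range K).filter P).card : ℝ≥0∞) := by
  rw [tsum_eq_sum (s := (Finset.range K).filter P)]
  · rw [Finset.sum_congr rfl fun n hn => (hf n).trans (if_pos (by simpa using hn))]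
    simp
  · intro n hn
    rw [hf, if_neg]
    simpa using hn

variable {M}

theorem GoodPath.tsum_completionEvent {k : ℕ} {ω : (ℕ → ℝ) × (ℕ → ℝ × ℝ × E)}
    (h : M.GoodPath k ω) {T : ℝ} {K : ℕ} (hK : ∀ n, (M.completion k ω n).1 ≤ T ↔ n < K) (j : ℕ) :
    ∑' n, (M.completionEvent k n j (Iic T)).indicator (1 : (ℕ → ℝ) × (ℕ → ℝ × ℝ × E) → ℝ≥0∞) ω =
      (((Finset.range K).filter fun c => (M.completion k ω c).2 = j).card : ℝ≥0∞) := by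
  refine tsum_range_filter fun n => ?_
  simp only [← hK, indicator, completionEvent, mem_ofPred_eq, h.2 n, true_and, mem_Iic, Pi.one_apply,
    and_comm]

theorem GoodPath.departures_eq {k : ℕ} {ω : (ℕ → ℝ) × (ℕ → ℝ × ℝ × E)}
    (h : M.GoodPath k ω) (t : ℝ) :
    {n | M.Proper k ω (n + 1) ∧ (M.completion k ω (n + 1)).1 < t} =
      {n | (M.completion k ω (n + 1)).1 < t} := by
  ext n
  simp [h.2 (n + 1)]

theorem GoodPath.tsum_stateBefore {k : ℕ} {ω : (ℕ → ℝ) × (ℕ → ℝ × ℝ × E)}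
    (h : M.GoodPath k ω) (T : ℝ) (j : ℕ) :
    ∑' m, (if arrivalEpoch ω.1 m ≤ T then M.stateBefore k j (arrivalEpoch ω.1 m) ω else 0) =
      (((Finset.range (arrivalCount ω.1 T)).filter fun m => k + m = j +
        {n | (M.completion k ω (n + 1)).1 < arrivalEpoch ω.1 m}.ncard).card : ℝ≥0∞) := by
  refine tsum_range_filter fun m => ?_
  simp only [← h.1.epoch_le_iff, ite_and]
  unfold stateBefore
  rw [h.departures_eq, ncard_setOf_lt_epoch h.1]

/-- The left-continuous state needed for predictability differs from the right-continuous one only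
at the countably many arrival and completion epochs. -/
theorem GoodPath.stateBefore_ae {k : ℕ} {ω : (ℕ → ℝ) × (ℕ → ℝ × ℝ × E)}
    (h : M.GoodPath k ω) (j : ℕ) :
    ∀ᵐ t : ℝ, M.stateBefore k j t ω = if M.customers k t ω = j then 1 else 0 := by
  have h1 : ∀ᵐ t : ℝ, t ∉ range (arrivalEpoch ω.1) :=
    compl_mem_ae_iff.2 ((countable_range _).measure_zero volume)
  have h2 : ∀ᵐ t : ℝ, t ∉ range fun n => (M.completion k ω (n + 1)).1 :=
    compl_mem_ae_iff.2 ((countable_range _).measure_zero volume)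
  filter_upwards [h1, h2] with t h1 h2
  have h3 : {m | arrivalEpoch ω.1 m < t} = {m | arrivalEpoch ω.1 m ≤ t} := by
    ext m
    simp only [mem_ofPred_eq]
    exact ⟨le_of_lt, fun hk => lt_of_le_of_ne hk fun he => h1 ⟨m, he⟩⟩
  have h4 : {n | (M.completion k ω (n + 1)).1 < t} = {n | (M.completion k ω (n + 1)).1 ≤ t} := by
    ext n
    simp only [mem_ofPred_eq]
    exact ⟨le_of_lt, fun hk => lt_of_le_of_ne hk fun he => h2 ⟨n, he⟩⟩
  have hlt := lt_ncard_departures h.1 h.monotone h.balance t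
  -- Departures never outnumber customers, so the truncated subtraction in `customers` loses
  -- nothing.
  have hle : {n | (M.completion k ω (n + 1)).1 < t}.ncard ≤ k + arrivalCount ω.1 t := by
    rcases hc : {n | (M.completion k ω (n + 1)).1 < t}.ncard with _ | c
    · exact Nat.zero_le _
    · have h5 := (hlt c).2 (by omega)
      have h6 := h.balance (c + 1)
      have h7 := h.1.arrivalCount_mono h5.le
      omega
  unfold stateBefore customers
  rw [h.departures_eq, h3, ← h4]
  unfold arrivalCount at hle ⊢
  refine if_congr ?_ rfl rfl
  omega

variable (M)

/-- The expected time up to `T` during which there are `j` customers. -/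
noncomputable def occupation (k j : ℕ) (T : ℝ) : ℝ≥0∞ :=
  ∫⁻ t in Ioc (0 : ℝ) T, M.inputLaw {ω | M.customers k t ω = j}

theorem measurable_customers (k : ℕ) :
    Measurable fun x : ℝ × ((ℕ → ℝ) × (ℕ → ℝ × ℝ × E)) => M.customers k x.1 x.2 := by
  have h1 : Measurable fun x : ℝ × ((ℕ → ℝ) × (ℕ → ℝ × ℝ × E)) => arrivalCount x.2.1 x.1 :=
    measurable_arrivalCount (by fun_prop) (by fun_prop)
  have h2 : Measurable fun x : ℝ × ((ℕ → ℝ) × (ℕ → ℝ × ℝ × E)) =>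
      {n | (M.completion k x.2 (n + 1)).1 ≤ x.1}.ncard :=
    measurable_ncard_setOf (A := fun n => {x : ℝ × ((ℕ → ℝ) × (ℕ → ℝ × ℝ × E)) |
      (M.completion k x.2 (n + 1)).1 ≤ x.1}) fun n =>
        measurableSet_le ((M.measurable_completion k (n + 1)).fst.comp measurable_snd)
          measurable_fst
  exact (measurable_const.add h1).sub h2

theorem occupation_eq (hM : M.Admissible) (k j : ℕ) (T : ℝ) :
    M.occupation k j T =
      ∫⁻ ω, (∫⁻ t in Ioc 0 T, M.stateBefore k j t ω) ∂M.inputLaw := by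
  have hm : Measurable fun x : ℝ × ((ℕ → ℝ) × (ℕ → ℝ × ℝ × E)) =>
      if M.customers k x.1 x.2 = j then (1 : ℝ≥0∞) else 0 :=
    Measurable.ite (M.measurable_customers k (measurableSet_singleton j)) measurable_const
      measurable_const
  have h1 : M.occupation k j T = ∫⁻ t in Ioc (0 : ℝ) T,
      (∫⁻ ω, (if M.customers k t ω = j then (1 : ℝ≥0∞) else 0) ∂M.inputLaw) := by
    refine lintegral_congr fun t => ?_
    rw [← lintegral_indicator_one]
    · refine lintegral_congr fun ω => ?_
      simp only [indicator, mem_ofPred_eq, Pi.one_apply]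
    · exact ((M.measurable_customers k).comp measurable_prodMk_left) (measurableSet_singleton j)
  rw [h1, lintegral_lintegral_swap hm.aemeasurable]
  refine lintegral_congr_ae ?_
  filter_upwards [M.ae_goodPath hM k] with ω hω
  refine lintegral_congr_ae (ae_restrict_of_ae ?_)
  filter_upwards [hω.stateBefore_ae j] with t ht
  exact ht.symm

/-- Both quantities are compared with the expected number of arrivals that find `j`: occupation
through PASTA, visits through level crossings. -/
theorem occupation_visits (hM : M.Admissible) (k j : ℕ) {T : ℝ} (hT : 0 ≤ T) :
    ENNReal.ofReal M.lam * M.occupation k j T ≤ M.visits k j T + 2 ∧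
      M.visits k j T ≤ ENNReal.ofReal M.lam * M.occupation k j T + 2 := by
  rw [M.occupation_eq hM, ← M.lintegral_arrivals_stateBefore, visits_eq_lintegral]
  have h2 : ∀ f : (ℕ → ℝ) × (ℕ → ℝ × ℝ × E) → ℝ≥0∞,
      ∫⁻ ω, f ω ∂M.inputLaw + 2 = ∫⁻ ω, (f ω + 2) ∂M.inputLaw := fun f => by
    rw [lintegral_add_right _ measurable_const]
    simp
  rw [h2, h2]
  constructor
  all_goals
    refine lintegral_mono_ae ?_
    filter_upwards [M.ae_goodPath hM k] with ω hω
    obtain ⟨K, hK⟩ := exists_departures_le hω.1 hω.monotone hω.balance T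
    have hc := arrivals_visits hω.1 hω.monotone rfl hω.balance hT hK j
    rw [hω.tsum_stateBefore, hω.tsum_completionEvent hK]
  · exact_mod_cast hc.1
  · exact_mod_cast hc.2

/-- The probability that the embedded process goes from `i` to `j` in one cycle. -/
noncomputable def transition (i j : ℕ) : ℝ≥0∞ :=
  (M.gapLaw.prod M.cycleLaw) {x | i + M.cycleArrivals i x.1 x.2 = j + 1}

theorem measurableSet_transition (i j : ℕ) : MeasurableSet
    {x : (ℕ → ℝ) × (ℝ × ℝ × E) | i + M.cycleArrivals i x.1 x.2 = j + 1} :=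
  (measurable_const.add (M.measurable_cycleArrivals i measurable_fst measurable_snd))
    (measurableSet_singleton (j + 1))

/-- A proper cycle has `i + N ≥ 1`, so almost surely its end state is some `j` with `i + N = j + 1`.
-/
theorem tsum_transition (hM : M.Admissible) (i : ℕ) : ∑' j, M.transition i j = 1 := by
  unfold transition
  rw [← measure_iUnion _ (M.measurableSet_transition i), ← prob_compl_eq_zero_iff
    (MeasurableSet.iUnion (M.measurableSet_transition i))]
  · refine measure_mono_null ?_ (M.ae_properCycle hM i)
    intro x hx hp
    simp only [mem_compl_iff, mem_iUnion, mem_ofPred_eq, not_exists] at hx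
    have hp : M.ProperCycle i x.1 x.2 := hp
    have := hp.2.2
    exact hx (i + M.cycleArrivals i x.1 x.2 - 1) (by omega)
  · intro a b hab
    refine Set.disjoint_left.2 fun x h1 h2 => hab ?_
    simp only [mem_ofPred_eq] at h1 h2
    omega

/-- By the restart property the left side is the expected number of completions up to `T` whose
successor leaves `j`; shifting the index by one changes a visit count by at most 1. -/
theorem tsum_visits_transition (hM : M.Admissible) (k j : ℕ) (T : ℝ) :
    ∑' i, M.visits k i T * M.transition i j ≤ M.visits k j T + 1 := by
  set F : ℕ → ℕ → (ℕ → ℝ) × (ℕ → ℝ × ℝ × E) → ℝ≥0∞ := fun i n ω =>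
    (M.completionEvent k n i (Iic T)).indicator 1 ω *
      {x : (ℕ → ℝ) × (ℝ × ℝ × E) | i + M.cycleArrivals i x.1 x.2 = j + 1}.indicator 1
        (shiftGaps (M.completion k ω n).1 ω.1, ω.2 n) with hF
  have hFm : ∀ i n, Measurable (F i n) := fun i n =>
    (measurable_one.indicator (M.measurableSet_completionEvent k n i measurableSet_Iic)).mul
      ((measurable_one.indicator (M.measurableSet_transition i j)).comp ((measurable_shiftGaps
        (M.measurable_completion k n).fst measurable_fst).prodMk (by fun_prop)))
  have h1 : ∀ i, M.visits k i T * M.transition i j = ∫⁻ ω, ∑' n, F i n ω ∂M.inputLaw := by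
    intro i
    rw [lintegral_tsum fun n => (hFm i n).aemeasurable, visits, ← ENNReal.tsum_mul_right]
    refine tsum_congr fun n => ?_
    rw [hF, M.lintegral_completionEvent k n i measurableSet_Iic
      (measurable_one.indicator (M.measurableSet_transition i j)),
      lintegral_indicator_one (M.measurableSet_transition i j), transition]
  simp_rw [h1]
  rw [← lintegral_tsum fun i => (Measurable.tsum (hFm i)).aemeasurable, visits_eq_lintegral]
  have h2 : ∀ f : (ℕ → ℝ) × (ℕ → ℝ × ℝ × E) → ℝ≥0∞,
      ∫⁻ ω, f ω ∂M.inputLaw + 1 = ∫⁻ ω, (f ω + 1) ∂M.inputLaw := fun f => by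
    rw [lintegral_add_right _ measurable_const]
    simp
  rw [h2]
  refine lintegral_mono_ae ?_
  filter_upwards [M.ae_goodPath hM k] with ω hω
  obtain ⟨K, hK⟩ := exists_departures_le hω.1 hω.monotone hω.balance T
  rw [hω.tsum_completionEvent hK, ENNReal.tsum_comm]
  have h3 : ∑' n, ∑' i, F i n ω =
      (((Finset.range K).filter fun c => (M.completion k ω (c + 1)).2 = j).card : ℝ≥0∞) := by
    refine tsum_range_filter fun n => ?_
    rw [tsum_eq_single (M.completion k ω n).2]
    · have h4 := (hω.2 (n + 1)).completion_snd hω.1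
      simp only [← hK, hF, indicator, completionEvent, mem_ofPred_eq, hω.2 n, true_and, mem_Iic,
        Pi.one_apply, ← h4, add_left_inj, ite_and, mul_ite, mul_one, mul_zero]
      split_ifs <;> rfl
    · intro i hi
      simp only [hF]
      rw [indicator_of_notMem, zero_mul]
      exact fun hmem => hi hmem.2.1.symm
  rw [h3]
  have h4 := card_visits_succ (fun n => (M.completion k ω n).2) j K
  have h5 : ((Finset.range K).filter fun c => (M.completion k ω (c + 1)).2 = j).card ≤
      ((Finset.range K).filter fun c => (M.completion k ω c).2 = j).card + 1 := by
    split_ifs at h4 <;> omega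
  exact_mod_cast h5

/-- The steady-state law is stationary for the embedded process. -/
theorem IsSteadyState.stationary {M : VacationQueue E} (hM : M.Admissible) {k : ℕ} {p : PMF ℕ}
    (hp : M.IsSteadyState k p) (j : ℕ) : ∑' i, p i * M.transition i j = p j := by
  have hlam0 : ENNReal.ofReal M.lam ≠ 0 := by simpa using M.lam_pos
  have hlam : ENNReal.ofReal M.lam ≠ ∞ := ENNReal.ofReal_ne_top
  have htr : ∀ i j, M.transition i j ≠ ∞ := fun i j => measure_ne_top _ _
  -- Only finite partial sums are compared, because each state contributes its own error 2; the
  -- total `3 + 2 * s.card` vanishes after division by `T`.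
  have hle : ∀ j, ∑' i, p i * M.transition i j ≤ p j := by
    intro j
    rw [ENNReal.tsum_eq_iSup_sum]
    refine iSup_le fun s => ?_
    have hocc : ∀ i, Tendsto (fun T : ℝ => ENNReal.ofReal M.lam * (M.occupation k i T /
        ENNReal.ofReal T)) atTop (𝓝 (ENNReal.ofReal M.lam * p i)) := fun i =>
      ENNReal.Tendsto.const_mul (hp i) (Or.inr hlam)
    have hT : Tendsto (fun T : ℝ => (3 + 2 * (s.card : ℝ≥0∞)) / ENNReal.ofReal T) atTop
        (𝓝 0) := by
      refine ENNReal.Tendsto.const_div ENNReal.tendsto_ofReal_atTop (Or.inr ?_) |>.trans_eq ?_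
      · finiteness
      · simp
    have hlim1 : Tendsto (fun T : ℝ => ∑ i ∈ s, ENNReal.ofReal M.lam * (M.occupation k i T /
        ENNReal.ofReal T) * M.transition i j) atTop
        (𝓝 (∑ i ∈ s, ENNReal.ofReal M.lam * p i * M.transition i j)) :=
      tendsto_finsetSum _ fun i _ => ENNReal.Tendsto.mul_const (hocc i) (Or.inr (htr i j))
    have hlim2 := (hocc j).add hT
    rw [add_zero] at hlim2
    have hfin := le_of_tendsto_of_tendsto hlim1 hlim2 (by
      filter_upwards [eventually_gt_atTop 0] with T hT
      have hT0 := hT.le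
      have h1 : ∑ i ∈ s, ENNReal.ofReal M.lam * M.occupation k i T * M.transition i j ≤
          ENNReal.ofReal M.lam * M.occupation k j T + (3 + 2 * (s.card : ℝ≥0∞)) := by
        calc ∑ i ∈ s, ENNReal.ofReal M.lam * M.occupation k i T * M.transition i j
            ≤ ∑ i ∈ s, (M.visits k i T * M.transition i j + 2) := by
              refine Finset.sum_le_sum fun i _ => ?_
              calc _ ≤ (M.visits k i T + 2) * M.transition i j := by
                    gcongr
                    exact (M.occupation_visits hM k i hT0).1
                _ ≤ _ := by
                    rw [add_mul]
                    gcongr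
                    exact mul_le_of_le_one_right zero_le prob_le_one
          _ ≤ ∑' i, M.visits k i T * M.transition i j + 2 * s.card := by
              rw [Finset.sum_add_distrib, Finset.sum_const, nsmul_eq_mul, mul_comm (2 : ℝ≥0∞)]
              gcongr
              exact ENNReal.sum_le_tsum s
          _ ≤ (M.visits k j T + 1) + 2 * s.card := by
              gcongr
              exact M.tsum_visits_transition hM k j T
          _ ≤ (ENNReal.ofReal M.lam * M.occupation k j T + 2 + 1) + 2 * s.card := by
              gcongr
              exact (M.occupation_visits hM k j hT0).2
          _ = _ := by ring
      have h2 := ENNReal.div_le_div_right h1 (ENNReal.ofReal T)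
      rw [ENNReal.add_div] at h2
      refine le_trans (le_of_eq ?_) (h2.trans (le_of_eq ?_))
      · simp only [div_eq_mul_inv, Finset.sum_mul]
        exact Finset.sum_congr rfl fun i _ => by ring
      · rw [mul_div_assoc])
    have h3 : ENNReal.ofReal M.lam * ∑ i ∈ s, p i * M.transition i j ≤
        ENNReal.ofReal M.lam * p j := by
      rw [Finset.mul_sum]
      simpa only [mul_assoc] using hfin
    exact (ENNReal.mul_le_mul_iff_right hlam0 hlam).1 h3
  have hsum : ∑' j, ∑' i, p i * M.transition i j = 1 := by
    rw [ENNReal.tsum_comm]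
    simp_rw [ENNReal.tsum_mul_left, M.tsum_transition hM, mul_one]
    exact p.tsum_coe
  -- Both sides have total mass 1, so the termwise inequality cannot be strict anywhere.
  by_contra hne
  have hlt := ENNReal.tsum_lt_tsum (f := fun j => ∑' i, p i * M.transition i j) (g := p)
    (by rw [hsum]; exact ENNReal.one_ne_top) hle (lt_of_le_of_ne (hle j) hne)
  rw [hsum, p.tsum_coe] at hlt
  exact lt_irrefl _ hlt

end VacationQueue

namespace VacationQueue

variable {E : Type*} [MeasurableSpace E] (M : VacationQueue E)

/-! ### Moments of the number of arrivals in a cycle -/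

/-- The second moment of the number of arrivals during a vacation. -/
noncomputable def meanX2 (i : ℕ) : ℝ≥0∞ := ∑' m : ℕ, (m : ℝ≥0∞) ^ 2 * M.alpha i m

theorem lintegral_vacArrivals (i : ℕ) (f : ℕ → ℝ≥0∞) :
    ∫⁻ x, f (M.vacArrivals i x) ∂(M.gapLaw.prod M.seed) = ∑' m, f m * M.alpha i m := by
  rw [← lintegral_map (f := f) measurable_from_nat (M.measurable_vacArrivals i),
    lintegral_countable']
  refine tsum_congr fun m => ?_
  rw [Measure.map_apply (M.measurable_vacArrivals i) (measurableSet_singleton m)]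
  rfl

theorem tsum_alpha (i : ℕ) : ∑' m, M.alpha i m = 1 := by
  have h := M.lintegral_vacArrivals i fun _ => 1
  simpa using h.symm

/-- Arrivals during a vacation are independent of those during a subsequent service. -/
theorem lintegral_vacation_service (i : ℕ) (b : ℝ) {e : E}
    (he : ∀ᵐ g ∂M.gapLaw, M.vac i e (arrivalEpoch g) < ∞) (f h : ℕ → ℝ≥0∞) :
    ∫⁻ g, f (M.vacArrivals i (g, e)) * h (arrivalCount
        (shiftGaps (M.vac i e (arrivalEpoch g)).toReal g) b) ∂M.gapLaw =
      (∫⁻ g, f (M.vacArrivals i (g, e)) ∂M.gapLaw) *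
        ∫⁻ g, h (arrivalCount g b) ∂M.gapLaw := by
  have hv : Measurable fun g => M.vac i e (arrivalEpoch g) :=
    M.measurable_vac_epoch i measurable_const measurable_id
  have hX : Measurable fun g => f (M.vacArrivals i (g, e)) :=
    measurable_from_nat.comp ((M.measurable_vacArrivals i).comp measurable_prodMk_right)
  have hG : Measurable fun g => h (arrivalCount g b) :=
    measurable_from_nat.comp (measurable_arrivalCount measurable_id measurable_const)
  -- Infinite vacations are cut out because their `toReal` is 0, which is not a nonanticipating
  -- time.
  have hH : Measurable fun g => if M.vac i e (arrivalEpoch g) < ∞ then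
      f (M.vacArrivals i (g, e)) else 0 :=
    Measurable.ite (measurableSet_lt hv measurable_const) hX measurable_const
  have hsm := M.lintegral_strongMarkov hv.ennreal_toReal hH hG
    (fun g _ => ENNReal.toReal_nonneg) (fun g g' hg hg' hne ha => by
      have hfin : M.vac i e (arrivalEpoch g) < ∞ := by
        by_contra hnot
        exact hne (if_neg hnot)
      have h1 := vac_congr hg hg' hfin ha
      refine ⟨by rw [h1], ?_⟩
      rw [h1, if_pos hfin, if_pos hfin, vacArrivals_eq hfin, vacArrivals_eq (h1 ▸ hfin), h1,
        ha.arrivalCount_eq])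
  have hae : (fun g => if M.vac i e (arrivalEpoch g) < ∞ then f (M.vacArrivals i (g, e)) else 0)
      =ᵐ[M.gapLaw] fun g => f (M.vacArrivals i (g, e)) := by
    filter_upwards [he] with g hg
    rw [if_pos hg]
  rw [lintegral_congr_ae hae] at hsm
  rw [← hsm]
  refine lintegral_congr_ae ?_
  filter_upwards [he] with g hg
  rw [if_pos hg]

/-- When a vacation is taken, the count is the sum of the vacation arrivals and an independent
Poisson count with mean λ times the service time. The cross term of the square factorizes. -/
theorem lintegral_cycleArrivals_gaps (i : ℕ) {y : ℝ × ℝ × E} (hb : 0 ≤ y.2.1)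
    (he : ∀ᵐ g ∂M.gapLaw, M.vac i y.2.2 (arrivalEpoch g) < ∞) :
    (∫⁻ g, (M.cycleArrivals i g y : ℝ≥0∞) ∂M.gapLaw =
      (if y.1 < M.psi i then 1 else 0) * (∫⁻ g, (M.vacArrivals i (g, y.2.2) : ℝ≥0∞) ∂M.gapLaw) +
        ENNReal.ofReal (M.lam * y.2.1)) ∧
    ∫⁻ g, (M.cycleArrivals i g y : ℝ≥0∞) ^ 2 ∂M.gapLaw =
      (if y.1 < M.psi i then 1 else 0) *
        ((∫⁻ g, (M.vacArrivals i (g, y.2.2) : ℝ≥0∞) ^ 2 ∂M.gapLaw) +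
        2 * (ENNReal.ofReal (M.lam * y.2.1) *
          ∫⁻ g, (M.vacArrivals i (g, y.2.2) : ℝ≥0∞) ∂M.gapLaw)) +
        ENNReal.ofReal (M.lam * y.2.1 + (M.lam * y.2.1) ^ 2) := by
  by_cases hu : y.1 < M.psi i
  · have hN : ∀ᵐ g ∂M.gapLaw, M.cycleArrivals i g y = M.vacArrivals i (g, y.2.2) +
        arrivalCount (shiftGaps (M.vac i y.2.2 (arrivalEpoch g)).toReal g) y.2.1 := by
      filter_upwards [he, M.ae_goodGaps] with g h1 h2
      rw [vacArrivals_eq h1, ← h2.arrivalCount_add _ hb]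
      simp only [cycleArrivals, cycleLength, cycleVac, hu, if_true]
    have hv : Measurable fun g => M.vac i y.2.2 (arrivalEpoch g) :=
      M.measurable_vac_epoch i measurable_const measurable_id
    have hX : Measurable fun g => (M.vacArrivals i (g, y.2.2) : ℝ≥0∞) :=
      measurable_from_nat.comp ((M.measurable_vacArrivals i).comp measurable_prodMk_right)
    have hA : Measurable fun g => (arrivalCount
        (shiftGaps (M.vac i y.2.2 (arrivalEpoch g)).toReal g) y.2.1 : ℝ≥0∞) :=
      measurable_from_nat.comp (measurable_arrivalCount
        (measurable_shiftGaps hv.ennreal_toReal measurable_id) measurable_const)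
    have h01 := M.lintegral_vacation_service i y.2.1 he (fun _ => 1) fun m => m
    have h02 := M.lintegral_vacation_service i y.2.1 he (fun _ => 1) fun m => (m : ℝ≥0∞) ^ 2
    have h11 := M.lintegral_vacation_service i y.2.1 he (fun m => m) fun m => m
    simp only [one_mul, lintegral_one, measure_univ, M.lintegral_arrivalCount,
      M.lintegral_arrivalCount_sq hb] at h01 h02 h11
    rw [if_pos hu, one_mul, one_mul]
    constructor
    · rw [← h01, ← lintegral_add_left hX]
      refine lintegral_congr_ae ?_
      filter_upwards [hN] with g hg
      rw [hg, Nat.cast_add]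
    · rw [mul_comm (ENNReal.ofReal (M.lam * y.2.1)), ← h02, ← h11,
        ← lintegral_const_mul' _ _ (by simp), ← lintegral_add_left, ← lintegral_add_left]
      · refine lintegral_congr_ae ?_
        filter_upwards [hN] with g hg
        rw [hg, Nat.cast_add]
        ring
      · exact (hX.pow_const 2).add ((hX.mul hA).const_mul 2)
      · exact hX.pow_const 2
  · have hN : ∀ g, M.cycleArrivals i g y = arrivalCount g y.2.1 := fun g => by
      simp only [cycleArrivals, cycleLength, cycleVac, hu, if_false, zero_add]
    simp only [hN, if_neg hu, zero_mul, zero_add, M.lintegral_arrivalCount,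
      M.lintegral_arrivalCount_sq hb, and_self]

theorem integrable_service : Integrable (fun b : ℝ => b) M.service := by
  have h : Integrable (fun b : ℝ => 1 + b ^ 2) M.service := (integrable_const 1).add M.service_sq
  refine h.mono' measurable_id.aestronglyMeasurable (ae_of_all _ fun b => ?_)
  rw [Real.norm_eq_abs, abs_le]
  constructor <;> nlinarith [sq_nonneg (b - 1), sq_nonneg (b + 1)]

theorem lintegral_service : ∫⁻ b, ENNReal.ofReal (M.lam * b) ∂M.service = ENNReal.ofReal M.rho := by
  rw [← ofReal_integral_eq_lintegral_ofReal (M.integrable_service.const_mul _)]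
  · rw [integral_const_mul]
    rfl
  · filter_upwards [M.service_nonneg] with b hb
    exact mul_nonneg M.lam_pos.le hb

theorem lintegral_service_sq :
    ∫⁻ b, ENNReal.ofReal (M.lam * b + (M.lam * b) ^ 2) ∂M.service =
      ENNReal.ofReal (M.rho + M.lam ^ 2 * M.meanB2) := by
  have h1 := M.integrable_service.const_mul M.lam
  have h2 : Integrable (fun b => (M.lam * b) ^ 2) M.service := by
    simp_rw [mul_pow]
    exact M.service_sq.const_mul _
  have h3 : Integrable (fun b => M.lam * b + (M.lam * b) ^ 2) M.service := h1.add h2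
  rw [← ofReal_integral_eq_lintegral_ofReal h3]
  · rw [integral_add h1 h2, integral_const_mul]
    simp_rw [mul_pow]
    rw [integral_const_mul]
    rfl
  · filter_upwards [M.service_nonneg] with b hb
    have := mul_nonneg M.lam_pos.le hb
    positivity

theorem rho_nonneg : 0 ≤ M.rho :=
  mul_nonneg M.lam_pos.le (integral_nonneg_of_ae M.service_nonneg)

theorem meanB2_nonneg : 0 ≤ M.meanB2 := integral_nonneg fun b => sq_nonneg b

theorem lintegral_vacation_indicator (i : ℕ) :
    ∫⁻ u in Icc (0 : ℝ) 1, (if u < M.psi i then 1 else 0) = ENNReal.ofReal (M.psi i) := by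
  obtain ⟨h0, h1⟩ := M.psi_mem i (Nat.cast_nonneg i)
  have h : (fun u : ℝ => if u < M.psi i then (1 : ℝ≥0∞) else 0) = (Iio (M.psi i)).indicator 1 := by
    ext u
    simp [indicator]
  rw [h, lintegral_indicator_one measurableSet_Iio, Measure.restrict_apply measurableSet_Iio]
  have h2 : Iio (M.psi i) ∩ Icc 0 1 = Ico 0 (M.psi i) := by
    ext u
    simp only [mem_inter_iff, mem_Iio, mem_Icc, mem_Ico]
    constructor
    · rintro ⟨a, b, c⟩
      exact ⟨b, a⟩
    · rintro ⟨a, b⟩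
      exact ⟨b, a, by linarith⟩
  rw [h2, Real.volume_Ico, sub_zero]

/-- The integral over the inputs of a cycle of a product of functions of them. -/
theorem lintegral_cycleLaw_mul (i : ℕ) {f : ℝ → ℝ≥0∞} {h : E → ℝ≥0∞} (hf : Measurable f)
    (hh : Measurable h) :
    ∫⁻ y, (if y.1 < M.psi i then 1 else 0) * (f y.2.1 * h y.2.2) ∂M.cycleLaw =
      ENNReal.ofReal (M.psi i) * ((∫⁻ b, f b ∂M.service) * ∫⁻ e, h e ∂M.seed) := by
  have hI : Measurable fun u : ℝ => if u < M.psi i then (1 : ℝ≥0∞) else 0 :=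
    Measurable.ite measurableSet_Iio measurable_const measurable_const
  have hfh : Measurable fun z : ℝ × E => f z.1 * h z.2 :=
    (hf.comp measurable_fst).mul (hh.comp measurable_snd)
  unfold cycleLaw
  rw [lintegral_prod_mul (f := fun u : ℝ => if u < M.psi i then (1 : ℝ≥0∞) else 0)
    (g := fun z : ℝ × E => f z.1 * h z.2) hI.aemeasurable hfh.aemeasurable,
    lintegral_prod_mul hf.aemeasurable hh.aemeasurable, M.lintegral_vacation_indicator]

theorem ae_cycleLaw_vac_finite (hM : M.Admissible) (i : ℕ) :
    ∀ᵐ y ∂M.cycleLaw, ∀ᵐ g ∂M.gapLaw, M.vac i y.2.2 (arrivalEpoch g) < ∞ := by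
  have hset : MeasurableSet {x : E × (ℕ → ℝ) | M.vac i x.1 (arrivalEpoch x.2) < ∞} :=
    measurableSet_lt (M.measurable_vac_epoch i measurable_fst measurable_snd) measurable_const
  have h1 : ∀ᵐ x ∂(M.seed.prod M.gapLaw), M.vac i x.1 (arrivalEpoch x.2) < ∞ :=
    (Measure.measurePreserving_swap (μ := M.seed) (ν := M.gapLaw)).quasiMeasurePreserving.ae
      (hM.vac_finite i)
  have h2 := Measure.ae_ae_of_ae_prod h1
  exact (measurePreserving_snd.comp (measurePreserving_snd (μ := volume.restrict (Icc (0 : ℝ) 1))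
    (ν := M.service.prod M.seed))).quasiMeasurePreserving.ae h2

theorem lintegral_seed_vacArrivals (i : ℕ) (f : ℕ → ℝ≥0∞) :
    ∫⁻ e, (∫⁻ g, f (M.vacArrivals i (g, e)) ∂M.gapLaw) ∂M.seed = ∑' m, f m * M.alpha i m := by
  rw [← M.lintegral_vacArrivals, lintegral_prod_symm']
  exact measurable_from_nat.comp (M.measurable_vacArrivals i)

theorem measurable_lintegral_vacArrivals (i : ℕ) (f : ℕ → ℝ≥0∞) :
    Measurable fun e => ∫⁻ g, f (M.vacArrivals i (g, e)) ∂M.gapLaw :=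
  (measurable_from_nat.comp (M.measurable_vacArrivals i)).lintegral_prod_left'

theorem lintegral_cycleLaw_service {f : ℝ → ℝ≥0∞} (hf : Measurable f) :
    ∫⁻ y, f y.2.1 ∂M.cycleLaw = ∫⁻ b, f b ∂M.service :=
  (measurePreserving_fst.comp (measurePreserving_snd (μ := volume.restrict (Icc (0 : ℝ) 1))
    (ν := M.service.prod M.seed))).lintegral_comp hf

theorem lintegral_cycleArrivals (hM : M.Admissible) (i : ℕ) :
    ∫⁻ x, (M.cycleArrivals i x.1 x.2 : ℝ≥0∞) ∂(M.gapLaw.prod M.cycleLaw) =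
      ENNReal.ofReal (M.psi i) * M.meanX i + ENNReal.ofReal M.rho := by
  have hm : Measurable fun x : (ℕ → ℝ) × (ℝ × ℝ × E) => (M.cycleArrivals i x.1 x.2 : ℝ≥0∞) :=
    measurable_from_nat.comp (M.measurable_cycleArrivals i measurable_fst measurable_snd)
  have hs : Measurable fun b => ENNReal.ofReal (M.lam * b) := by fun_prop
  have hx := M.measurable_lintegral_vacArrivals i fun m => (m : ℝ≥0∞)
  have h1 := M.lintegral_cycleLaw_mul i (f := fun _ => 1) measurable_const hx
  have h2 := M.lintegral_cycleLaw_service hs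
  simp only [one_mul, lintegral_one, measure_univ, M.lintegral_seed_vacArrivals i
    fun m => (m : ℝ≥0∞)] at h1
  rw [M.lintegral_service] at h2
  rw [lintegral_prod_symm' _ hm, meanX, ← h1, ← h2, ← lintegral_add_right]
  · refine lintegral_congr_ae ?_
    filter_upwards [M.ae_cycleLaw_vac_finite hM i, M.ae_cycleLaw_service_nonneg] with y hy hb
    exact (M.lintegral_cycleArrivals_gaps i hb hy).1
  · exact hs.comp measurable_snd.fst

theorem lintegral_cycleArrivals_sq (hM : M.Admissible) (i : ℕ) :
    ∫⁻ x, (M.cycleArrivals i x.1 x.2 : ℝ≥0∞) ^ 2 ∂(M.gapLaw.prod M.cycleLaw) =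
      ENNReal.ofReal (M.psi i) * (M.meanX2 i + 2 * (ENNReal.ofReal M.rho * M.meanX i)) +
        ENNReal.ofReal (M.rho + M.lam ^ 2 * M.meanB2) := by
  have hm : Measurable fun x : (ℕ → ℝ) × (ℝ × ℝ × E) =>
      (M.cycleArrivals i x.1 x.2 : ℝ≥0∞) ^ 2 :=
    (measurable_from_nat.comp
      (M.measurable_cycleArrivals i measurable_fst measurable_snd)).pow_const 2
  have hs : Measurable fun b => ENNReal.ofReal (M.lam * b) := by fun_prop
  have hs2 : Measurable fun b => ENNReal.ofReal (M.lam * b + (M.lam * b) ^ 2) := by fun_prop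
  have hx := M.measurable_lintegral_vacArrivals i fun m => (m : ℝ≥0∞)
  have hx2 := M.measurable_lintegral_vacArrivals i fun m => (m : ℝ≥0∞) ^ 2
  have h1 := M.lintegral_cycleLaw_mul i (f := fun _ => 1) measurable_const hx2
  have h3 := M.lintegral_cycleLaw_mul i hs hx
  have h2 := M.lintegral_cycleLaw_service hs2
  simp only [one_mul, lintegral_one, measure_univ, M.lintegral_seed_vacArrivals i
    fun m => (m : ℝ≥0∞) ^ 2] at h1
  rw [M.lintegral_seed_vacArrivals i fun m => (m : ℝ≥0∞), M.lintegral_service] at h3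
  rw [M.lintegral_service_sq] at h2
  have hI : Measurable fun y : ℝ × ℝ × E => if y.1 < M.psi i then (1 : ℝ≥0∞) else 0 :=
    Measurable.ite (measurableSet_lt measurable_fst measurable_const) measurable_const
      measurable_const
  rw [lintegral_prod_symm' _ hm, meanX, meanX2, mul_add, mul_left_comm _ (2 : ℝ≥0∞), ← h1, ← h2,
    ← h3, ← lintegral_const_mul, ← lintegral_add_left, ← lintegral_add_right]
  · refine lintegral_congr_ae ?_
    filter_upwards [M.ae_cycleLaw_vac_finite hM i, M.ae_cycleLaw_service_nonneg] with y hy hb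
    rw [(M.lintegral_cycleArrivals_gaps i hb hy).2]
    ring
  · exact hs2.comp measurable_snd.fst
  · exact hI.mul (hx2.comp measurable_snd.snd)
  · exact hI.mul ((hs.comp measurable_snd.fst).mul (hx.comp measurable_snd.snd))

end VacationQueue

/-! ### Drift identities for a stationary step -/

section Drift

variable {Ω : Type*} [MeasurableSpace Ω] {P : Measure Ω} [IsProbabilityMeasure P] {I J : Ω → ℕ}

/-- Equality of laws kills the mean increment of each bounded `f n`, and domination of the
increments suffices to pass to the limit; the limit function of the state need not be integrable. -/
theorem integral_eq_zero_of_stationary (hI : Measurable I) (hJ : Measurable J)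
    (hmap : P.map J = P.map I) (f : ℕ → ℕ → ℝ) (hf : ∀ n, ∃ C, ∀ i, |f n i| ≤ C)
    {bound F : Ω → ℝ} (hbound : Integrable bound P)
    (hle : ∀ n, ∀ᵐ ω ∂P, |f n (J ω) - f n (I ω)| ≤ bound ω)
    (hlim : ∀ᵐ ω ∂P, Tendsto (fun n => f n (J ω) - f n (I ω)) atTop (𝓝 (F ω))) :
    ∫ ω, F ω ∂P = 0 := by
  have hint : ∀ n, ∀ K : Ω → ℕ, Measurable K → Integrable (fun ω => f n (K ω)) P := by
    intro n K hK
    obtain ⟨C, hC⟩ := hf n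
    exact Integrable.of_bound (measurable_from_nat.comp hK).aestronglyMeasurable C
      (ae_of_all _ fun ω => hC _)
  have hzero : ∀ n, ∫ ω, (f n (J ω) - f n (I ω)) ∂P = 0 := by
    intro n
    rw [integral_sub (hint n J hJ) (hint n I hI),
      ← integral_map (φ := J) (f := f n) hJ.aemeasurable measurable_from_nat.aestronglyMeasurable,
      ← integral_map (φ := I) (f := f n) hI.aemeasurable measurable_from_nat.aestronglyMeasurable,
      hmap, sub_self]
  have h := tendsto_integral_of_dominated_convergence bound
    (fun n => ((hint n J hJ).sub (hint n I hI)).aestronglyMeasurable) hbound hle hlim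
  simp only [Pi.sub_apply, hzero] at h
  exact (tendsto_nhds_unique h tendsto_const_nhds)

theorem tendsto_min_natCast (i : ℕ) : ∀ᶠ n : ℕ in atTop, min (i : ℝ) n = i := by
  filter_upwards [eventually_ge_atTop i] with n hn
  exact min_eq_left (Nat.cast_le.2 hn)

theorem abs_min_natCast_le (n i : ℕ) : |min (i : ℝ) n| ≤ n := by
  rw [abs_of_nonneg (by positivity)]
  exact min_le_right _ _

variable {N : Ω → ℕ}

/-- Truncation at `n` is 1-Lipschitz, and the untruncated increment is `m - 1`. -/
theorem abs_min_sub_min_le {i j m : ℕ} (h : j + 1 = i + m) (n : ℕ) :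
    |min (j : ℝ) n - min (i : ℝ) n| ≤ m + 1 := by
  have h1 : (j : ℝ) + 1 = i + m := by exact_mod_cast h
  have h2 := abs_min_sub_min_le_max (j : ℝ) n i n
  rw [sub_self, abs_zero, max_eq_left (abs_nonneg _)] at h2
  refine h2.trans (abs_le.2 ⟨?_, ?_⟩) <;> linarith [Nat.cast_nonneg (α := ℝ) m]

/-- In a stationary step the mean of the increment vanishes. -/
theorem integral_increment_of_stationary (hI : Measurable I) (hJ : Measurable J)
    (hmap : P.map J = P.map I) (hstep : ∀ᵐ ω ∂P, J ω + 1 = I ω + N ω)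
    (hN : Integrable (fun ω => (N ω : ℝ)) P) : ∫ ω, (N ω : ℝ) ∂P = 1 := by
  have h := integral_eq_zero_of_stationary hI hJ hmap (fun n i => min (i : ℝ) n)
    (fun n => ⟨n, abs_min_natCast_le n⟩) (F := fun ω => (N ω : ℝ) - 1)
    (hN.add (integrable_const 1)) (fun n => by
      filter_upwards [hstep] with ω hω
      exact abs_min_sub_min_le hω n) (by
      filter_upwards [hstep] with ω hω
      refine tendsto_const_nhds.congr' ?_
      filter_upwards [tendsto_min_natCast (I ω), tendsto_min_natCast (J ω)] with n h1 h2
      have h3 : (J ω : ℝ) + 1 = I ω + N ω := by exact_mod_cast hω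
      rw [h1, h2]
      linarith)
  rw [integral_sub hN (integrable_const 1)] at h
  simp at h
  linarith

/-- In a stationary step the mean of the increment of the square vanishes, even if the square
itself is not integrable. -/
theorem integral_sq_increment_of_stationary (hI : Measurable I) (hJ : Measurable J)
    (hmap : P.map J = P.map I) (hstep : ∀ᵐ ω ∂P, J ω + 1 = I ω + N ω)
    (hN : Integrable (fun ω => (N ω : ℝ)) P) (hN2 : Integrable (fun ω => (N ω : ℝ) ^ 2) P)
    (hI1 : Integrable (fun ω => (I ω : ℝ)) P)
    (hIN : Integrable (fun ω => (I ω : ℝ) * N ω) P) :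
    2 * ∫ ω, (I ω : ℝ) * N ω ∂P + ∫ ω, (N ω : ℝ) ^ 2 ∂P + 1 =
      2 * ∫ ω, (I ω : ℝ) ∂P + 2 * ∫ ω, (N ω : ℝ) ∂P := by
  -- This is (2I + N + 1)(N + 1), a bound for the sum times the difference of the truncated states.
  -- It contains no I².
  have hb : Integrable (fun ω => 2 * ((I ω : ℝ) * N ω) + 2 * (I ω : ℝ) + ((N ω : ℝ) ^ 2 +
      2 * (N ω : ℝ) + 1)) P :=
    ((hIN.const_mul 2).add (hI1.const_mul 2)).add
      ((hN2.add (hN.const_mul 2)).add (integrable_const 1))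
  have h := integral_eq_zero_of_stationary hI hJ hmap (fun n i => min (i : ℝ) n ^ 2)
    (fun n => ⟨(n : ℝ) ^ 2, fun i => by
      rw [abs_pow]
      gcongr
      exact abs_min_natCast_le n i⟩)
    (F := fun ω => 2 * ((I ω : ℝ) * N ω) - 2 * (I ω : ℝ) + ((N ω : ℝ) ^ 2 -
      2 * (N ω : ℝ) + 1))
    hb (fun n => by
      filter_upwards [hstep] with ω hω
      have h3 : (J ω : ℝ) + 1 = I ω + N ω := by exact_mod_cast hω
      have h4 : 0 ≤ min (J ω : ℝ) n + min (I ω : ℝ) n := by positivity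
      have h5 := min_le_left (J ω : ℝ) n
      have h6 := min_le_left (I ω : ℝ) n
      have h7 : (0 : ℝ) ≤ I ω := Nat.cast_nonneg _
      have h8 : (0 : ℝ) ≤ N ω := Nat.cast_nonneg _
      rw [sq_sub_sq, abs_mul, abs_of_nonneg h4]
      calc _ ≤ (2 * (I ω : ℝ) + N ω + 1) * ((N ω : ℝ) + 1) :=
            mul_le_mul (by linarith) (abs_min_sub_min_le hω n) (abs_nonneg _) (by linarith)
        _ = _ := by ring) (by
      filter_upwards [hstep] with ω hω
      refine tendsto_const_nhds.congr' ?_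
      filter_upwards [tendsto_min_natCast (I ω), tendsto_min_natCast (J ω)] with n h1 h2
      have h3 : (J ω : ℝ) = I ω + N ω - 1 := by
        have : (J ω : ℝ) + 1 = I ω + N ω := by exact_mod_cast hω
        linarith
      rw [h1, h2, h3]
      ring)
  have e1 : Integrable (fun ω => 2 * ((I ω : ℝ) * N ω) - 2 * (I ω : ℝ)) P :=
    (hIN.const_mul 2).sub (hI1.const_mul 2)
  have e2 : Integrable (fun ω => (N ω : ℝ) ^ 2 - 2 * (N ω : ℝ)) P := hN2.sub (hN.const_mul 2)
  have e3 : Integrable (fun ω => (N ω : ℝ) ^ 2 - 2 * (N ω : ℝ) + 1) P :=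
    e2.add (integrable_const 1)
  rw [integral_add e1 e3, integral_add e2 (integrable_const 1), integral_sub (hIN.const_mul 2)
    (hI1.const_mul 2), integral_sub hN2 (hN.const_mul 2), integral_const_mul, integral_const_mul,
    integral_const_mul] at h
  simp only [integral_const, probReal_univ, smul_eq_mul, mul_one] at h
  linarith

end Drift

/-! ### Convexity -/

/-- The slope is the supremum of the left difference quotients, which every right one bounds above;
`x > 0` ensures that left quotients exist. -/
theorem ConvexOn.exists_supporting_line {f : ℝ → ℝ} (hf : ConvexOn ℝ (Ici 0) f) {x : ℝ}
    (hx : 0 < x) : ∃ c, ∀ y, 0 ≤ y → f x + c * (y - x) ≤ f y := by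
  set S := (fun y => (f x - f y) / (x - y)) '' Ico 0 x with hS
  have hle : ∀ y ∈ Ico 0 x, ∀ z, x < z → (f x - f y) / (x - y) ≤ (f z - f x) / (z - x) :=
    fun y hy z hz => hf.slope_mono_adjacent (mem_Ici.2 hy.1) (mem_Ici.2 (hx.le.trans hz.le))
      hy.2 hz
  have hbdd : BddAbove S := ⟨(f (x + 1) - f x) / (x + 1 - x), by
    rintro _ ⟨y, hy, rfl⟩
    exact hle y hy _ (lt_add_one x)⟩
  have hne : S.Nonempty := ⟨_, 0, ⟨le_rfl, hx⟩, rfl⟩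
  refine ⟨sSup S, fun y hy => ?_⟩
  rcases lt_trichotomy y x with h | h | h
  · have h1 : (f x - f y) / (x - y) ≤ sSup S := le_csSup hbdd ⟨y, ⟨hy, h⟩, rfl⟩
    rw [div_le_iff₀ (sub_pos.2 h)] at h1
    linarith
  · rw [h]
    simp
  · have h1 : sSup S ≤ (f y - f x) / (y - x) := csSup_le hne (by
      rintro _ ⟨z, hz, rfl⟩
      exact hle z hz y h)
    rw [le_div_iff₀ (sub_pos.2 h)] at h1
    linarith

/-- Jensen's inequality for a random variable with values in the natural numbers; the convex
function need not be continuous at zero. -/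
theorem ConvexOn.map_integral_natCast_le {Ω : Type*} [MeasurableSpace Ω] {P : Measure Ω}
    [IsProbabilityMeasure P] {f : ℝ → ℝ} (hf : ConvexOn ℝ (Ici 0) f) {I : Ω → ℕ}
    (hI : Integrable (fun ω => (I ω : ℝ)) P)
    (hfI : Integrable (fun ω => f (I ω)) P) :
    f (∫ ω, (I ω : ℝ) ∂P) ≤ ∫ ω, f (I ω) ∂P := by
  have h0 : 0 ≤ ∫ ω, (I ω : ℝ) ∂P := integral_nonneg fun ω => Nat.cast_nonneg _
  rcases h0.eq_or_lt with h | h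
  -- No supporting line need exist at zero, but a vanishing mean makes `I` zero almost surely.
  · have h1 := (integral_eq_zero_iff_of_nonneg (fun ω => Nat.cast_nonneg (I ω)) hI).1 h.symm
    have h2 : ∫ ω, f (I ω) ∂P = ∫ _, f 0 ∂P := by
      refine integral_congr_ae ?_
      filter_upwards [h1] with ω hω
      rw [show (I ω : ℝ) = 0 from hω]
    rw [← h, h2]
    simp
  · obtain ⟨c, hc⟩ := hf.exists_supporting_line h
    set x := ∫ ω, (I ω : ℝ) ∂P with hx
    have h1 : Integrable (fun ω => c * ((I ω : ℝ) - x)) P :=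
      (hI.sub (integrable_const x)).const_mul c
    have h2 := integral_mono ((integrable_const (f x)).add h1) hfI
      fun ω => hc (I ω) (Nat.cast_nonneg _)
    have h3 : ∫ ω, (f x + c * ((I ω : ℝ) - x)) ∂P = f x := by
      rw [integral_add (integrable_const _) h1, integral_const_mul,
        integral_sub hI (integrable_const x), ← hx]
      simp
    rw [← h3]
    exact h2

/-! ### Stochastic order -/

/-- The tail formula for the mean, by interchange of summations. -/
theorem tsum_natCast_mul (w : ℕ → ℝ≥0∞) :
    ∑' m : ℕ, (m : ℝ≥0∞) * w m = ∑' n : ℕ, ∑' m : ℕ, if n < m then w m else 0 := by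
  rw [ENNReal.tsum_comm]
  refine tsum_congr fun m => ?_
  rw [tsum_eq_sum (s := Finset.range m) fun n hn => if_neg (by simpa using hn),
    Finset.sum_congr rfl fun n hn => if_pos (Finset.mem_range.1 hn)]
  simp

/-- A stochastically larger random variable has a larger mean. -/
theorem StochGE.mean_le {w₁ w₂ : ℕ → ℝ≥0∞} (h : StochGE w₁ w₂) (h₁ : ∑' m, w₁ m = 1)
    (h₂ : ∑' m, w₂ m = 1) : ∑' m : ℕ, (m : ℝ≥0∞) * w₂ m ≤ ∑' m : ℕ, (m : ℝ≥0∞) * w₁ m := by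
  have hsplit : ∀ (w : ℕ → ℝ≥0∞) (n : ℕ),
      (∑ m ∈ Finset.range (n + 1), w m) + (∑' m : ℕ, if n < m then w m else 0) = ∑' m, w m := by
    intro w n
    have h3 : ∑ m ∈ Finset.range (n + 1), w m = ∑' m, if m ≤ n then w m else 0 := by
      rw [tsum_eq_sum (s := Finset.range (n + 1))
        fun m hm => if_neg (by simp only [Finset.mem_range] at hm; omega)]
      exact Finset.sum_congr rfl fun m hm =>
        (if_pos (by simp only [Finset.mem_range] at hm; omega)).symm
    rw [h3, ← ENNReal.tsum_add]
    refine tsum_congr fun m => ?_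
    by_cases hm : m ≤ n
    · simp [hm, not_lt.2 hm]
    · simp [hm, not_le.1 hm]
  rw [tsum_natCast_mul, tsum_natCast_mul]
  refine ENNReal.tsum_le_tsum fun n => ?_
  have e1 := hsplit w₁ n
  have e2 := hsplit w₂ n
  rw [h₁, ← h₂, ← e2] at e1
  have hfin : ∑ m ∈ Finset.range (n + 1), w₁ m ≠ ∞ :=
    ne_top_of_le_ne_top (h₁ ▸ ENNReal.one_ne_top) (ENNReal.sum_le_tsum _)
  refine (ENNReal.add_le_add_iff_left hfin).1 ?_
  rw [e1]
  exact add_le_add (h n) le_rfl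

/-! ### Equal vacation laws and the stationary cycle -/

namespace VacationQueue

variable {E : Type*} [MeasurableSpace E] (M : VacationQueue E)

theorem meanX_le_meanX2 (i : ℕ) : M.meanX i ≤ M.meanX2 i := by
  refine ENNReal.tsum_le_tsum fun m => ?_
  gcongr
  exact_mod_cast Nat.le_self_pow two_ne_zero m

variable {M}

theorem EqualVacations.meanX_eq {q : PMF ℕ} (hq : M.EqualVacations q) {i : ℕ} (hi : 1 ≤ i) :
    M.meanX i = ∑' m : ℕ, (m : ℝ≥0∞) * q m :=
  tsum_congr fun m => by rw [hq.eq_law i hi]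

theorem EqualVacations.le_meanX {q : PMF ℕ} (hq : M.EqualVacations q) (i : ℕ) :
    ∑' m : ℕ, (m : ℝ≥0∞) * q m ≤ M.meanX i := by
  rcases i with _ | i
  · rcases hq.empty_law with h | h
    · exact (tsum_congr fun m => by rw [h.1]).le
    · exact h.1.1.mean_le (M.tsum_alpha 0) q.tsum_coe
  · exact (hq.meanX_eq (Nat.le_add_left 1 i)).ge

/-- Only two vacation laws occur, those for `i = 0` and for `i ≥ 1`; a uniform bound makes the
stationary moments finite. -/
theorem EqualVacations.exists_meanX2_le {q : PMF ℕ} (hM : M.Admissible)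
    (hq : M.EqualVacations q) : ∃ C, C ≠ ∞ ∧ ∀ i, M.meanX2 i ≤ C := by
  refine ⟨M.meanX2 0 + M.meanX2 1, ENNReal.add_ne_top.2
    ⟨(hM.second_moment 0).ne, (hM.second_moment 1).ne⟩, fun i => ?_⟩
  rcases i with _ | i
  · exact le_self_add
  · have : M.meanX2 (i + 1) = M.meanX2 1 :=
      tsum_congr fun m => by rw [hq.eq_law _ (Nat.le_add_left 1 i), hq.eq_law 1 le_rfl]
    rw [this]
    exact le_add_self

theorem EqualVacations.mean_pos {q : PMF ℕ} (hq : M.EqualVacations q) :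
    ∑' m : ℕ, (m : ℝ≥0∞) * q m ≠ 0 := by
  intro h0
  rw [ENNReal.tsum_eq_zero] at h0
  have h1 : ∀ m, m ≠ 0 → q m = 0 := fun m hm => by
    simpa [hm] using h0 m
  have h2 : q 0 = 1 := by
    rw [← q.tsum_coe, tsum_eq_single 0 h1]
  obtain ⟨n, hn⟩ := hq.nontrivial.2
  refine absurd hn (not_lt.2 ?_)
  calc ∑ m ∈ Finset.range (n + 1), PMF.pure 0 m ≤ ∑' m, PMF.pure 0 m := ENNReal.sum_le_tsum _
    _ = q 0 := by rw [PMF.tsum_coe, h2]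
    _ ≤ _ := Finset.single_le_sum (f := fun m => q m) (fun _ _ => zero_le) (by simp)

variable (M)

/-- The law of a stationary number of customers together with the inputs of a cycle. -/
noncomputable def stationaryLaw (p : PMF ℕ) : Measure (ℕ × ((ℕ → ℝ) × (ℝ × ℝ × E))) :=
  p.toMeasure.prod (M.gapLaw.prod M.cycleLaw)

instance (p : PMF ℕ) : IsProbabilityMeasure (M.stationaryLaw p) := by
  unfold stationaryLaw
  infer_instance

theorem lintegral_stationaryLaw (p : PMF ℕ) {F : ℕ → (ℕ → ℝ) × (ℝ × ℝ × E) → ℝ≥0∞}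
    (hF : ∀ i, Measurable (F i)) :
    ∫⁻ z, F z.1 z.2 ∂(M.stationaryLaw p) =
      ∑' i, p i * ∫⁻ x, F i x ∂(M.gapLaw.prod M.cycleLaw) := by
  have hm : Measurable fun z : ℕ × ((ℕ → ℝ) × (ℝ × ℝ × E)) => F z.1 z.2 :=
    measurable_from_prod_countable_right hF
  unfold stationaryLaw
  rw [lintegral_prod _ hm.aemeasurable, lintegral_countable']
  refine tsum_congr fun i => ?_
  rw [PMF.toMeasure_apply_singleton _ _ (measurableSet_singleton i), mul_comm]

theorem measurable_cycleArrivals_nat : Measurable fun z : ℕ × ((ℕ → ℝ) × (ℝ × ℝ × E)) =>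
    M.cycleArrivals z.1 z.2.1 z.2.2 :=
  measurable_from_prod_countable_right fun i =>
    M.measurable_cycleArrivals i measurable_fst measurable_snd

theorem ae_stationaryLaw_step (hM : M.Admissible) (p : PMF ℕ) : ∀ᵐ z ∂(M.stationaryLaw p),
    (z.1 + M.cycleArrivals z.1 z.2.1 z.2.2 - 1) + 1 =
      z.1 + M.cycleArrivals z.1 z.2.1 z.2.2 := by
  have hset : MeasurableSet {z : ℕ × ((ℕ → ℝ) × (ℝ × ℝ × E)) |
      (z.1 + M.cycleArrivals z.1 z.2.1 z.2.2 - 1) + 1 =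
        z.1 + M.cycleArrivals z.1 z.2.1 z.2.2} := by
    have h := measurable_fst.add M.measurable_cycleArrivals_nat
    exact measurableSet_eq_fun ((h.sub measurable_const).add measurable_const) h
  refine (Measure.ae_prod_iff_ae_ae hset).2 (ae_of_all _ fun i => ?_)
  filter_upwards [M.ae_properCycle hM i] with x hx
  have := hx.2.2
  change i + M.cycleArrivals i x.1 x.2 - 1 + 1 = i + M.cycleArrivals i x.1 x.2
  omega

/-- The balance equations, recast as equality in law of the states before and after a cycle on one
probability space, as the drift identities require. -/
theorem map_stationaryLaw (hM : M.Admissible) {p : PMF ℕ}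
    (hp : ∀ j, ∑' i, p i * M.transition i j = p j) :
    (M.stationaryLaw p).map (fun z => z.1 + M.cycleArrivals z.1 z.2.1 z.2.2 - 1) =
      (M.stationaryLaw p).map Prod.fst := by
  have hfst : (M.stationaryLaw p).map Prod.fst = p.toMeasure := by
    unfold stationaryLaw
    exact measurePreserving_fst.map_eq
  have hJ : Measurable fun z : ℕ × ((ℕ → ℝ) × (ℝ × ℝ × E)) =>
      z.1 + M.cycleArrivals z.1 z.2.1 z.2.2 - 1 :=
    (measurable_fst.add M.measurable_cycleArrivals_nat).sub measurable_const
  rw [hfst]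
  refine Measure.ext_of_singleton fun j => ?_
  rw [PMF.toMeasure_apply_singleton _ _ (measurableSet_singleton j), ← hp j,
    Measure.map_apply hJ (measurableSet_singleton j)]
  have h1 : (M.stationaryLaw p) ((fun z => z.1 + M.cycleArrivals z.1 z.2.1 z.2.2 - 1) ⁻¹' {j}) =
      (M.stationaryLaw p) {z | z.1 + M.cycleArrivals z.1 z.2.1 z.2.2 = j + 1} := by
    refine measure_congr (eventuallyEq_set.2 ?_)
    filter_upwards [M.ae_stationaryLaw_step hM p] with z hz
    simp only [mem_preimage, mem_singleton_iff]
    omega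
  have hset : MeasurableSet {z : ℕ × ((ℕ → ℝ) × (ℝ × ℝ × E)) |
      z.1 + M.cycleArrivals z.1 z.2.1 z.2.2 = j + 1} :=
    (measurable_fst.add M.measurable_cycleArrivals_nat) (measurableSet_singleton (j + 1))
  rw [h1, ← lintegral_indicator_one hset]
  have h2 := M.lintegral_stationaryLaw p (F := fun i => {x : (ℕ → ℝ) × (ℝ × ℝ × E) |
    i + M.cycleArrivals i x.1 x.2 = j + 1}.indicator 1)
    fun i => measurable_one.indicator (M.measurableSet_transition i j)
  simp_rw [lintegral_indicator_one (M.measurableSet_transition _ j)] at h2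
  exact h2

end VacationQueue

/-! ### The lower bound on the mean number of customers -/

theorem mainTheorem9 {E : Type*} [MeasurableSpace E] (M : VacationQueue E)
    (hM : M.Admissible) (hstable : M.Stable)
    (q : PMF ℕ) (hscen : M.EqualVacations q)
    (hanti : StrictAntiOn M.psi (Set.Ici 0)) (hconv : ConvexOn ℝ (Set.Ici 0) M.psi)
    (k : ℕ) (p : PMF ℕ) (hp : M.IsSteadyState k p) :
    ENNReal.ofReal
        (max (decrInv M.psi ((1 - M.rho) / ∑' m : ℕ, (m : ℝ) * (q m).toReal))
          (M.lam ^ 2 * M.meanB2 / (2 * (1 - M.rho)) + M.rho))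
      ≤ ∑' j : ℕ, (j : ℝ≥0∞) * p j := by
  -- The limsup is nonnegative in `ℝ≥0∞`, so stability forces ρ < 1.
  have hrho : 0 < 1 - M.rho := by
    have h := hstable
    unfold VacationQueue.Stable at h
    exact ENNReal.ofReal_pos.1 (zero_le.trans_lt h)
  by_cases hL : ∑' j : ℕ, (j : ℝ≥0∞) * p j = ∞
  · rw [hL]
    exact le_top
  obtain ⟨C, hC, hCle⟩ := hscen.exists_meanX2_le hM
  have hstat := fun j => hp.stationary hM j
  set P := M.stationaryLaw p with hP
  set I : ℕ × ((ℕ → ℝ) × (ℝ × ℝ × E)) → ℕ := Prod.fst with hI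
  set N : ℕ × ((ℕ → ℝ) × (ℝ × ℝ × E)) → ℕ := fun z => M.cycleArrivals z.1 z.2.1 z.2.2 with hN
  have hIm : Measurable I := measurable_fst
  have hNm : Measurable N := M.measurable_cycleArrivals_nat
  have hJm : Measurable fun z => I z + N z - 1 := (hIm.add hNm).sub measurable_const
  have hcm : ∀ i, Measurable fun x : (ℕ → ℝ) × (ℝ × ℝ × E) =>
      (M.cycleArrivals i x.1 x.2 : ℝ≥0∞) := fun i =>
    measurable_from_nat.comp (M.measurable_cycleArrivals i measurable_fst measurable_snd)
  -- moments under the stationary law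
  set ψ : ℕ → ℝ≥0∞ := fun i => ENNReal.ofReal (M.psi i) with hψ
  have hψ1 : ∀ i, ψ i ≤ 1 := fun i =>
    ENNReal.ofReal_le_one.2 (M.psi_mem i (Nat.cast_nonneg i)).2
  set S := ∑' i, p i * (ψ i * M.meanX i) with hS
  set S2 := ∑' i, p i * (ψ i * M.meanX2 i) with hS2
  set SI := ∑' i : ℕ, p i * (i * (ψ i * M.meanX i)) with hSI
  set L := ∑' j : ℕ, (j : ℝ≥0∞) * p j with hLdef
  set r := ENNReal.ofReal M.rho with hr
  set β := ENNReal.ofReal (M.rho + M.lam ^ 2 * M.meanB2) with hβ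
  have eI : ∫⁻ z, (I z : ℝ≥0∞) ∂P = L := by
    rw [M.lintegral_stationaryLaw p (F := fun i _ => (i : ℝ≥0∞)) fun i => measurable_const]
    exact tsum_congr fun i => by simp [mul_comm]
  have eN : ∫⁻ z, (N z : ℝ≥0∞) ∂P = S + r := by
    rw [M.lintegral_stationaryLaw p (F := fun i x => (M.cycleArrivals i x.1 x.2 : ℝ≥0∞)) hcm]
    simp_rw [M.lintegral_cycleArrivals hM, mul_add]
    rw [ENNReal.tsum_add, ENNReal.tsum_mul_right, p.tsum_coe, one_mul]
  have eN2 : ∫⁻ z, (N z : ℝ≥0∞) ^ 2 ∂P = S2 + 2 * r * S + β := by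
    rw [M.lintegral_stationaryLaw p (F := fun i x => (M.cycleArrivals i x.1 x.2 : ℝ≥0∞) ^ 2)
      fun i => (hcm i).pow_const 2]
    simp_rw [M.lintegral_cycleArrivals_sq hM, mul_add]
    rw [ENNReal.tsum_add, ENNReal.tsum_mul_right, p.tsum_coe, one_mul, ENNReal.tsum_add, hS,
      ← ENNReal.tsum_mul_left]
    congr 2
    exact tsum_congr fun i => by ring
  have eIN : ∫⁻ z, (I z : ℝ≥0∞) * N z ∂P = SI + r * L := by
    rw [M.lintegral_stationaryLaw p
      (F := fun i x => (i : ℝ≥0∞) * (M.cycleArrivals i x.1 x.2 : ℝ≥0∞))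
      fun i => (hcm i).const_mul _]
    simp_rw [lintegral_const_mul _ (hcm _), M.lintegral_cycleArrivals hM, mul_add]
    rw [ENNReal.tsum_add, hLdef, ← ENNReal.tsum_mul_left]
    congr 1
    exact tsum_congr fun i => by ring
  -- finiteness
  have hfin : ∀ f : ℕ → ℝ≥0∞, (∀ i, f i ≤ C) → ∑' i, p i * (ψ i * f i) ≠ ∞ := fun f hf => by
    refine ne_top_of_le_ne_top hC ?_
    calc ∑' i, p i * (ψ i * f i) ≤ ∑' i, p i * C :=
          ENNReal.tsum_le_tsum fun i => by
            gcongr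
            exact (mul_le_of_le_one_left zero_le (hψ1 i)).trans (hf i)
      _ = C := by rw [ENNReal.tsum_mul_right, p.tsum_coe, one_mul]
  have hSf : S ≠ ∞ := hfin _ fun i => (M.meanX_le_meanX2 i).trans (hCle i)
  have hS2f : S2 ≠ ∞ := hfin _ hCle
  have hSIf : SI ≠ ∞ := by
    refine ne_top_of_le_ne_top (ENNReal.mul_ne_top hC hL) ?_
    rw [hLdef, ← ENNReal.tsum_mul_left]
    refine ENNReal.tsum_le_tsum fun i => ?_
    calc p i * (i * (ψ i * M.meanX i)) ≤ p i * (i * (1 * C)) := by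
          gcongr
          · exact hψ1 i
          · exact (M.meanX_le_meanX2 i).trans (hCle i)
      _ = C * (i * p i) := by ring
  -- The comparison of first and second moments of an integer variable is the source of the second
  -- bound.
  have hSS2 : S ≤ S2 := ENNReal.tsum_le_tsum fun i => by
    gcongr
    exact M.meanX_le_meanX2 i
  have hrf : r ≠ ∞ := ENNReal.ofReal_ne_top
  have hβf : β ≠ ∞ := ENNReal.ofReal_ne_top
  have hrr : r.toReal = M.rho := ENNReal.toReal_ofReal M.rho_nonneg
  have hββ : β.toReal = M.rho + M.lam ^ 2 * M.meanB2 := ENNReal.toReal_ofReal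
    (add_nonneg M.rho_nonneg (mul_nonneg (sq_nonneg _) M.meanB2_nonneg))
  -- passage to Bochner integrals
  have hreal : ∀ {f : ℕ × ((ℕ → ℝ) × (ℝ × ℝ × E)) → ℕ} {c : ℝ≥0∞}, Measurable f →
      ∫⁻ z, (f z : ℝ≥0∞) ∂P = c → c ≠ ∞ →
      Integrable (fun z => (f z : ℝ)) P ∧ ∫ z, (f z : ℝ) ∂P = c.toReal := by
    intro f c hf hc hcf
    have hfm : Measurable fun z => (f z : ℝ≥0∞) := measurable_from_nat.comp hf
    have h1 := integrable_toReal_of_lintegral_ne_top hfm.aemeasurable (hc ▸ hcf)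
    have h2 := integral_toReal hfm.aemeasurable
      (ae_of_all P fun z => ENNReal.natCast_lt_top (f z))
    simp only [ENNReal.toReal_natCast] at h1 h2
    exact ⟨h1, hc ▸ h2⟩
  obtain ⟨iI, vI⟩ := hreal hIm eI hL
  obtain ⟨iN, vN⟩ := hreal hNm eN (ENNReal.add_ne_top.2 ⟨hSf, hrf⟩)
  obtain ⟨iN2, vN2⟩ := hreal (f := fun z => N z ^ 2) (hNm.pow_const 2)
    (by simpa only [Nat.cast_pow] using eN2) (by finiteness)
  obtain ⟨iIN, vIN⟩ := hreal (f := fun z => I z * N z) (hIm.mul hNm)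
    (by simpa only [Nat.cast_mul] using eIN) (by finiteness)
  simp only [Nat.cast_pow, Nat.cast_mul] at iN2 vN2 iIN vIN
  have hmap := M.map_stationaryLaw hM hstat
  have hstep := M.ae_stationaryLaw_step hM p
  have d1 := integral_increment_of_stationary (P := P) (I := I) (N := N) hIm hJm hmap hstep iN
  have d2 := integral_sq_increment_of_stationary (P := P) (I := I) (N := N) hIm hJm hmap hstep
    iN iN2 iI iIN
  -- With L, S, S2 and SI read as real numbers, the identities become S + ρ = 1 and 2(SI + ρL) + (S2
  -- + 2ρS + ρ + λ²E[B²]) + 1 = 2L + 2.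
  rw [d1, vIN, vN2, vI] at d2
  rw [vN] at d1
  rw [ENNReal.toReal_add hSf hrf, hrr] at d1
  rw [ENNReal.toReal_add hSIf (by finiteness), ENNReal.toReal_add (by finiteness) hβf,
    ENNReal.toReal_add hS2f (by finiteness), ENNReal.toReal_mul, ENNReal.toReal_mul,
    ENNReal.toReal_mul, hrr, hββ, ENNReal.toReal_ofNat] at d2
  have hS2r : S.toReal ≤ S2.toReal := ENNReal.toReal_mono hS2f hSS2
  have hSI0 : 0 ≤ SI.toReal := ENNReal.toReal_nonneg
  rw [← ENNReal.ofReal_toReal hL]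
  refine ENNReal.ofReal_le_ofReal (max_le ?_ ?_)
  · -- Jensen
    set m := ∑' m : ℕ, (m : ℝ≥0∞) * q m with hm
    have hmf : m ≠ ∞ := by
      rw [hm, ← hscen.meanX_eq le_rfl]
      exact ne_top_of_le_ne_top hC ((M.meanX_le_meanX2 1).trans (hCle 1))
    have hmr : ∑' m : ℕ, (m : ℝ) * (q m).toReal = m.toReal := by
      rw [hm, ENNReal.tsum_toReal_eq fun n => ENNReal.mul_ne_top (by simp) (q.apply_ne_top n)]
      exact tsum_congr fun n => by rw [ENNReal.toReal_mul, ENNReal.toReal_natCast]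
    have hm0 : 0 < m.toReal := ENNReal.toReal_pos hscen.mean_pos hmf
    have hψint : Integrable (fun z => M.psi (I z)) P :=
      Integrable.of_bound ((measurable_from_nat (f := fun i : ℕ => M.psi i)).comp
        hIm).aestronglyMeasurable 1 (ae_of_all _ fun z => by
          obtain ⟨h0, h1⟩ := M.psi_mem (I z) (Nat.cast_nonneg _)
          rwa [Real.norm_eq_abs, abs_of_nonneg h0])
    have hJ := hconv.map_integral_natCast_le iI hψint
    have hEψ : ENNReal.ofReal (∫ z, M.psi (I z) ∂P) = ∑' i, p i * ψ i := by
      rw [ofReal_integral_eq_lintegral_ofReal hψint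
        (ae_of_all _ fun z => (M.psi_mem (I z) (Nat.cast_nonneg _)).1),
        M.lintegral_stationaryLaw p (F := fun i _ => ψ i) fun i => measurable_const]
      simp
    -- Every X_i has mean at least that of X, including X_0 by stochastic order.
    have hle : ENNReal.ofReal (∫ z, M.psi (I z) ∂P) * m ≤ S := by
      rw [hEψ, ← ENNReal.tsum_mul_right]
      refine ENNReal.tsum_le_tsum fun i => ?_
      rw [mul_assoc]
      gcongr
      exact hscen.le_meanX i
    have hler := ENNReal.toReal_mono hSf hle
    rw [ENNReal.toReal_mul, ENNReal.toReal_ofReal (integral_nonneg fun z =>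
      (M.psi_mem (I z) (Nat.cast_nonneg _)).1)] at hler
    rw [vI] at hJ
    -- The mean itself lies in the set whose infimum is the inverse; what remains is ψ(E[L]) E[X] ≤
    -- 1 - ρ.
    refine csInf_le ⟨0, fun x hx => hx.1⟩ ⟨ENNReal.toReal_nonneg, ?_⟩
    rw [hmr, le_div_iff₀ hm0]
    nlinarith
  · have hS1 : S.toReal = 1 - M.rho := by linarith
    rw [← le_sub_iff_add_le, div_le_iff₀ (by linarith)]
    rw [hS1] at d2 hS2r
    -- After dropping SI ≥ 0 and using S2 ≥ 1 - ρ, the quadratic identity gives 2(1-ρ)L ≥ λ²E[B²] +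
    -- 2ρ(1-ρ).
    nlinarith
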